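/- **Setting.** In weighted set cover we are given sets $S_1,\dots,S_n\subseteq[m]$, $m\ge 1$, with $\bigcup_i S_i=[m]$ and weights $w_1,\dots,w_n\in\mathbb R_{>0}$. A cover is a set $X\subseteq[n]$ with $\bigcup_{i\in X}S_i=[m]$; its weight is $w(X)=\sum_{i\in X}w_i$. For $j\in[m]$ let $T_j=\{i: j\in S_i\}$, and let $f=\max_j|T_j|$. An $f$-approximation is a cover $X$ with $w(X)\le f\,w(Y)$ for every cover $Y$. The instance is a *vertex cover instance* if $f=2$ and the sets $T_j$ are pairwise distinct (the sets are the vertices, and the elements the edges, of a graph without parallel edges). **Model.** Let $0<\mu<c$, $m\le n^{1+c}$ and $s=\lceil n^{1+\mu}\rceil$. There are $\lceil m/s\rceil$ machines, each of which knows its own number, the number of machines, $n$, $m$ and $s$. Element $j$ is stored, together with $T_j$, on an arbitrary machine, subject to at most $s$ elements per machine; each weight $w_i$ is stored, with its index $i$, on an arbitrary machine. Computation proceeds in synchronous rounds. In each round every machine applies one and the same program, independent of the instance and of $c,\mu$, to its state, the messages just received and $s$ fresh uniformly random words, and produces a new state and messages to other machines, which are delivered before the next round. A word holds a natural number less than $n+m+s+2$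 or one real number, and the only real numbers kept or sent between rounds are input weights. The memory of a machine is the peak number of words in use during its local computation, including its state and the messages received and sent. After the last round one central machine outputs a set $X\subseteq[n]$. **Theorem.** There are a MapReduce algorithm and an absolute constant $K$ such that for all real $0<\mu<c$, every weighted set cover instance with $m\le n^{1+c}$, and every such placement of the input, the following holds with probability at least $1-K\,\frac c\mu\,e^{-n}$ after $R$ rounds: every machine has used at most $K\cdot f\cdot n^{1+\mu}$ words of memory and at most $(n+m+s+2)^K$ steps for each of its local computations, and the output is an $f$-approximation to the minimum weight set cover. Here * $R=\lfloor K\,c/\mu\rfloor$ if the instance is a vertex cover instance, and * $R=\lfloor K\,(c/\mu)^2\rfloor$ for every instance, in particular whenever $f>2$. -/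

import Mathlib

open Finset

/-! ## Weighted set cover -/

/-- A weighted set cover instance: `n` sets `S i` over the ground set `Fin m`, with positive real
weights, whose union is the ground set. -/
structure SetCover (n m : ℕ) where
  S : Fin n → Finset (Fin m)
  w : Fin n → ℝ
  w_pos : ∀ i, 0 < w i
  feasible : ∀ j, ∃ i, j ∈ S i

namespace SetCover

variable {n m : ℕ}

/-- `T j`: the (indices of the) sets that contain the element `j`. -/
def T (I : SetCover n m) (j : Fin m) : Finset (Fin n) := univ.filter fun i => j ∈ I.S i

/-- `f`: the maximum frequency of an element. -/
def maxFreq (I : SetCover n m) : ℕ := univ.sup fun j => (I.T j).card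

/-- `X` is a cover. -/
def IsCover (I : SetCover n m) (X : Finset (Fin n)) : Prop := ∀ j, ∃ i ∈ X, j ∈ I.S i

/-- The total weight of `X`. -/
noncomputable def cost (I : SetCover n m) (X : Finset (Fin n)) : ℝ := ∑ i ∈ X, I.w i

/-- `X` is a cover whose weight is at most `α` times the minimum weight of a cover. -/
def IsApprox (I : SetCover n m) (α : ℝ) (X : Finset (Fin n)) : Prop :=
  I.IsCover X ∧ ∀ Y, I.IsCover Y → I.cost X ≤ α * I.cost Y

/-- The instance is a vertex cover instance: `f = 2`, and the elements, as collections of at most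
two sets (edges between vertices), are pairwise distinct (no parallel edges). -/
def IsVertexCoverInstance (I : SetCover n m) : Prop := I.maxFreq = 2 ∧ Function.Injective I.T

end SetCover

namespace MapReduce

/-! ## Local computations

The functions that the machines compute are given by codes in a small first-order language over
natural numbers, real numbers, pairs and lists, with an explicit count of time and space.  A code is
one finite text that serves inputs of all sizes.

There are two types of real numbers.  `wt` is the type of the weights in the input; such a number can
be copied, stored, sent, and read into a `real`.  The type `real` is for the results of arithmetic
on weights; these may be used during a local computation only.  Storing and sending nothing but
natural numbers and input weights between rounds prevents one real number from carrying many words.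
-/

/-- Data types. -/
inductive Ty : Type
  | nat : Ty
  | wt : Ty
  | real : Ty
  | prod : Ty → Ty → Ty
  | list : Ty → Ty

namespace Ty

/-- The values of a data type. -/
@[reducible] def den : Ty → Type
  | nat => ℕ
  | wt => ℝ
  | real => ℝ
  | prod a b => a.den × b.den
  | list a => List a.den

/-- Data that may be kept or sent between rounds: no `real` in it. -/
def Storable : Ty → Prop
  | nat => True
  | wt => True
  | real => False
  | prod a b => a.Storable ∧ b.Storable
  | list a => a.Storable

/-- The size of a value in words, a word being able to hold the natural numbers below `B` or one real
number.  (A natural number `x` takes as many words as it has digits in base `B`.) -/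
def size (B : ℕ) : (a : Ty) → a.den → ℕ
  | nat, x => Nat.log B x + 1
  | wt, _ => 1
  | real, _ => 1
  | prod a b, x => a.size B x.1 + b.size B x.2
  | list a, x => (List.map (a.size B) x).sum + 1

end Ty

open Ty

/-- Elementary operations. -/
inductive Prim : Ty → Ty → Type
  | id {a : Ty} : Prim a a
  | fst {a b : Ty} : Prim (prod a b) a
  | snd {a b : Ty} : Prim (prod a b) b
  | nil {a b : Ty} : Prim a (list b)
  | cons {a : Ty} : Prim (prod a (list a)) (list a)
  | const {a : Ty} (k : ℕ) : Prim a nat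
  | add : Prim (prod nat nat) nat
  | sub : Prim (prod nat nat) nat
  | mul : Prim (prod nat nat) nat
  | div : Prim (prod nat nat) nat
  | le : Prim (prod nat nat) nat
  | read : Prim wt real
  | rzero {a : Ty} : Prim a real
  | radd : Prim (prod real real) real
  | rsub : Prim (prod real real) real
  | rle : Prim (prod real real) nat

open Classical in
/-- The value of an elementary operation; comparisons return `1` or `0`, and subtraction and division
of natural numbers are truncated. -/
noncomputable def Prim.eval : {a b : Ty} → Prim a b → a.den → b.den
  | _, _, .id, x => x
  | _, _, .fst, x => x.1
  | _, _, .snd, x => x.2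
  | _, _, .nil, _ => []
  | _, _, .cons, x => x.1 :: x.2
  | _, _, .const k, _ => k
  | _, _, .add, x => x.1 + x.2
  | _, _, .sub, x => x.1 - x.2
  | _, _, .mul, x => x.1 * x.2
  | _, _, .div, x => x.1 / x.2
  | _, _, .le, x => if x.1 ≤ x.2 then 1 else 0
  | _, _, .read, x => x
  | _, _, .rzero, _ => (0 : ℝ)
  | _, _, .radd, x => x.1 + x.2
  | _, _, .rsub, x => x.1 - x.2
  | _, _, .rle, x => if x.1 ≤ x.2 then 1 else 0

/-- Codes.  `pair p q` computes both results; `ite t p q` branches on whether the result of `t` is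
nonzero; `fold p` runs through a list and updates an accumulator by `p`, which sees the (fixed)
environment, the current entry and the accumulator; `loop p` does the same with the numbers
`0, …, k - 1` in place of the entries of a list. -/
inductive Code : Ty → Ty → Type
  | prim {a b : Ty} (p : Prim a b) : Code a b
  | comp {a b c : Ty} (q : Code b c) (p : Code a b) : Code a c
  | pair {a b c : Ty} (p : Code a b) (q : Code a c) : Code a (prod b c)
  | ite {a b : Ty} (t : Code a nat) (p q : Code a b) : Code a b
  | fold {e a b : Ty} (p : Code (prod e (prod a b)) b) : Code (prod e (prod (list a) b)) b
  | loop {e b : Ty} (p : Code (prod e (prod nat b)) b) : Code (prod e (prod nat b)) b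

/-- The number of steps of an iteration along a list with body `g`, if one run of the body takes
`t` steps. -/
def iterTime {α β : Type} (g : β → α → β) (t : β → α → ℕ) : β → List α → ℕ
  | _, [] => 1
  | y, x :: l => t y x + iterTime g t (g y x) l + 1

/-- The peak space of an iteration along a list with body `g`, if one run of the body takes space
`s`, and the final accumulator takes space `z`. -/
def iterSpace {α β : Type} (g : β → α → β) (s : β → α → ℕ) (z : β → ℕ) : β → List α → ℕ
  | y, [] => z y
  | y, x :: l => max (s y x) (iterSpace g s z (g y x) l)

namespace Code

/-- The function computed by a code. -/
noncomputable def eval : {a b : Ty} → Code a b → a.den → b.den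
  | _, _, .prim p, x => p.eval x
  | _, _, .comp q p, x => q.eval (p.eval x)
  | _, _, .pair p q, x => (p.eval x, q.eval x)
  | _, _, .ite t p q, x => if (show ℕ from t.eval x) ≠ 0 then p.eval x else q.eval x
  | _, _, .fold p, x => List.foldl (fun y z => p.eval (x.1, z, y)) x.2.2 x.2.1
  | _, _, .loop p, x => List.foldl (fun y i => p.eval (x.1, i, y)) x.2.2 (List.range x.2.1)

/-- The number of steps that a code takes on a given input. -/
noncomputable def time : {a b : Ty} → Code a b → a.den → ℕ
  | _, _, .prim _, _ => 1
  | _, _, .comp q p, x => p.time x + q.time (p.eval x) + 1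
  | _, _, .pair p q, x => p.time x + q.time x + 1
  | _, _, .ite t p q, x =>
      t.time x + (if (show ℕ from t.eval x) ≠ 0 then p.time x else q.time x) + 1
  | _, _, .fold p, x =>
      iterTime (fun y z => p.eval (x.1, z, y)) (fun y z => p.time (x.1, z, y)) x.2.2 x.2.1
  | _, _, .loop p, x =>
      iterTime (fun y i => p.eval (x.1, i, y)) (fun y i => p.time (x.1, i, y)) x.2.2
        (List.range x.2.1)

/-- The peak number of words (for word capacity `B`) in use while a code runs on a given input,
including the input, the output and everything that is kept for later during sub-computations. -/
noncomputable def space (B : ℕ) : {a b : Ty} → Code a b → a.den → ℕ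
  | a, b, .prim p, x => a.size B x + b.size B (p.eval x)
  | _, _, .comp q p, x => max (p.space B x) (q.space B (p.eval x))
  | a, _, .pair (b := b) p q, x =>
      max (a.size B x + p.space B x) (b.size B (p.eval x) + q.space B x)
  | a, _, .ite t p q, x =>
      max (a.size B x + t.space B x)
        (if (show ℕ from t.eval x) ≠ 0 then p.space B x else q.space B x)
  | _, _, .fold (e := e) (a := a) (b := b) p, x =>
      e.size B x.1 + (list a).size B x.2.1 +
        iterSpace (fun y z => p.eval (x.1, z, y)) (fun y z => p.space B (x.1, z, y)) (b.size B)
          x.2.2 x.2.1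
  | _, _, .loop (e := e) (b := b) p, x =>
      e.size B x.1 + nat.size B x.2.1 +
        iterSpace (fun y i => p.eval (x.1, i, y)) (fun y i => p.space B (x.1, i, y)) (b.size B)
          x.2.2 (List.range x.2.1)

end Code

/-! ## MapReduce algorithms for set cover -/

/-- The initial local data of a machine: its own number, the number of machines, `n`, `m`, and the
memory parameter `s`; then the elements `j` stored on it, each with the list of the sets that contain
`j`; then the indices of the sets whose weight is stored on it, each with the weight. -/
@[reducible] def inputTy : Ty :=
  prod (prod nat (prod nat (prod nat (prod nat nat))))
    (prod (list (prod nat (list nat))) (list (prod nat wt)))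

/-- A MapReduce algorithm: all machines run the same codes.  In every round a machine takes its
state, the list of messages it received and fresh random words, and computes its new state and a list
of messages, each with the number of the recipient.  When the run is over, machine `0` computes the
output, a list of indices of sets. -/
structure Algorithm where
  state : Ty
  msg : Ty
  state_storable : state.Storable
  msg_storable : msg.Storable
  init : Code inputTy state
  step : Code (prod state (prod (list msg) (list nat))) (prod state (list (prod nat msg)))
  output : Code state (list nat)

/-- The memory parameter `n ^ (1 + μ)`, rounded up. -/
noncomputable def memUnit (n : ℕ) (μ : ℝ) : ℕ := ⌈(n : ℝ) ^ (1 + μ)⌉₊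

/-- The number of machines: `m / s` rounded up (for `m, s ≥ 1`). -/
def numMachines (m s : ℕ) : ℕ := (m - 1) / s + 1

instance (m s : ℕ) : NeZero (numMachines m s) := ⟨Nat.succ_ne_zero _⟩

/-- The capacity of a word: a word holds a natural number below `n + m + s + 2`. -/
def wordCap (n m s : ℕ) : ℕ := n + m + s + 2

/-- A placement of the input on the machines: elements and weights are assigned to machines
arbitrarily, except that no machine is assigned more than `s` elements. -/
structure Placement (n m s : ℕ) where
  elt : Fin m → Fin (numMachines m s)
  set : Fin n → Fin (numMachines m s)
  balanced : ∀ k, (univ.filter fun j => elt j = k).card ≤ s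

/-- The random words used in `R` rounds: in every round, every machine gets `s` of them. -/
abbrev Tape (n m s R : ℕ) : Type :=
  Fin R → Fin (numMachines m s) → Fin s → Fin (wordCap n m s)

/-- The random words of machine `k` in round `r`, as a list. -/
def Tape.words {n m s R : ℕ} (ω : Tape n m s R) (r : ℕ) (k : Fin (numMachines m s)) : List ℕ :=
  if h : r < R then List.ofFn fun t => (ω ⟨r, h⟩ k t : ℕ) else []

/-- The local input of machine `k`. -/
def localInput {n m s : ℕ} (I : SetCover n m) (H : Placement n m s)
    (k : Fin (numMachines m s)) : inputTy.den :=
  (((k : ℕ), numMachines m s, n, m, s),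
    ((List.finRange m).filter fun j => decide (H.elt j = k)).map
      (fun j : Fin m => ((j : ℕ),
        ((List.finRange n).filter fun i => decide (i ∈ I.T j)).map (fun i : Fin n => (i : ℕ)))),
    ((List.finRange n).filter fun i => decide (H.set i = k)).map
      (fun i : Fin n => ((i : ℕ), I.w i)))

/-- A global configuration: the states of `M` machines and the messages waiting for them. -/
structure Config (P : Algorithm) (M : ℕ) where
  state : Fin M → P.state.den
  inbox : Fin M → List P.msg.den

namespace Algorithm

/-- What a machine in a given configuration feeds to its code in a round. -/
def stepInput (P : Algorithm) {M : ℕ} (C : Config P M) (ρ : Fin M → List ℕ) (k : Fin M) :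
    (prod P.state (prod (list P.msg) (list nat))).den :=
  (C.state k, C.inbox k, ρ k)

/-- One round: all machines compute, then the messages are delivered (in the order of the senders,
those of one sender in the order in which they were listed). -/
noncomputable def next (P : Algorithm) {M : ℕ} (C : Config P M) (ρ : Fin M → List ℕ) :
    Config P M where
  state k := (P.step.eval (P.stepInput C ρ k)).1
  inbox k := (List.finRange M).flatMap fun i =>
    (List.filter (fun z : ℕ × P.msg.den => decide (z.1 = (k : ℕ)))
      (P.step.eval (P.stepInput C ρ i)).2).map Prod.snd

variable {n m s R : ℕ}

/-- The configuration after `r` rounds. -/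
noncomputable def run (P : Algorithm) (I : SetCover n m) (H : Placement n m s)
    (ω : Tape n m s R) : ℕ → Config P (numMachines m s)
  | 0 => ⟨fun k => P.init.eval (localInput I H k), fun _ => []⟩
  | r + 1 => P.next (P.run I H ω r) (ω.words r)

/-- The collection of sets that is output after `R` rounds. -/
noncomputable def result (P : Algorithm) (I : SetCover n m) (H : Placement n m s)
    (ω : Tape n m s R) : Finset (Fin n) :=
  univ.filter fun i =>
    (i : ℕ) ∈ (show List ℕ from P.output.eval ((P.run I H ω R).state 0))

/-- Throughout the run of `R` rounds every machine uses at most `σ` words of memory, and at most `τ`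
steps for each of its local computations. -/
def Respects (P : Algorithm) (I : SetCover n m) (H : Placement n m s) (ω : Tape n m s R)
    (σ τ : ℝ) : Prop :=
  (∀ k, (P.init.space (wordCap n m s) (localInput I H k) : ℝ) ≤ σ ∧
    (P.init.time (localInput I H k) : ℝ) ≤ τ) ∧
  (∀ r < R, ∀ k,
    (P.step.space (wordCap n m s) (P.stepInput (P.run I H ω r) (ω.words r) k) : ℝ) ≤ σ ∧
    (P.step.time (P.stepInput (P.run I H ω r) (ω.words r) k) : ℝ) ≤ τ) ∧
  (P.output.space (wordCap n m s) ((P.run I H ω R).state 0) : ℝ) ≤ σ ∧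
    (P.output.time ((P.run I H ω R).state 0) : ℝ) ≤ τ

/-- The probability, over uniform random words, that the run of `R` rounds stays within memory `σ`
and local time `τ` on every machine and outputs an `α`-approximate set cover. -/
noncomputable def successProb (P : Algorithm) (I : SetCover n m) (H : Placement n m s) (R : ℕ)
    (σ τ α : ℝ) : ℝ :=
  (Nat.card {ω : Tape n m s R // P.Respects I H ω σ τ ∧ I.IsApprox α (P.result I H ω)} : ℝ) /
    Nat.card (Tape n m s R)

end Algorithm

end MapReduce

/-!
Randomized local ratio. In every phase each machine inspects a random word for each of its
uncovered elements and samples the element if the word is below the current threshold. Machine `0`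
receives the sample, continues the local ratio method on it, starting from the elements it has
recorded so far, and spreads the sets of residual weight zero to all machines along a tree of
degree `s`. Whatever the order of the elements, the sets of residual weight zero weigh at most `f`
times any cover, so the final cover is an `f`-approximation.

For a fixed collection of sets that leaves many elements uncovered, the sample avoids all of these
with probability at most `exp (-2 n)`. By the union bound over the `2 ^ n` collections, with high
probability only few elements survive the phase, so the next threshold may be larger by a factor
`s / n ≥ n ^ μ` without the sample exceeding `O(s)` elements. After at most `c / μ` phases every
word is below the threshold, and then every uncovered element is sampled. A phase takes as many
rounds as the tree has levels, up to a constant factor: `O(c / μ)` in general, but `O(1)` for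
vertex cover instances, where `m ≤ n ^ 2 ≤ s ^ 2`.
-/

namespace SetCover

variable {n m : ℕ} (I : SetCover n m)

@[simp] lemma mem_T {i : Fin n} {j : Fin m} : i ∈ I.T j ↔ j ∈ I.S i := by simp [T]

lemma card_T_le_maxFreq (j : Fin m) : #(I.T j) ≤ I.maxFreq :=
  le_sup (f := fun j => #(I.T j)) (mem_univ j)

lemma maxFreq_le : I.maxFreq ≤ n :=
  Finset.sup_le fun _ _ => (card_le_univ _).trans (by simp)

variable {I}

lemma exists_T_eq_pair (hfreq : I.maxFreq ≤ 2) (j : Fin m) : ∃ i i', I.T j = {i, i'} := by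
  obtain ⟨i, hi⟩ := I.feasible j
  have hi' : i ∈ I.T j := I.mem_T.2 hi
  have hcard : #((I.T j).erase i) ≤ 1 := by
    have := I.card_T_le_maxFreq j
    rw [card_erase_of_mem hi']
    omega
  have : Nonempty (Fin n) := ⟨i⟩
  obtain ⟨i', hsubset⟩ := card_le_one_iff_subset_singleton.mp hcard
  rcases subset_singleton_iff.mp hsubset with hempty | hsingle
  · exact ⟨i, i, by rw [← insert_erase hi', hempty]; simp⟩
  · exact ⟨i, i', by rw [← insert_erase hi', hsingle]⟩

lemma IsVertexCoverInstance.le_sq (h : I.IsVertexCoverInstance) : m ≤ n ^ 2 := by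
  have hsubset : univ.image I.T ⊆ univ.image fun x : Fin n × Fin n => {x.1, x.2} := by
    simp only [image_subset_iff, mem_image, mem_univ, true_and, Prod.exists, forall_const]
    exact fun j => (exists_T_eq_pair h.1.le j).imp fun i => Exists.imp fun i' => Eq.symm
  have hcard := (card_le_card hsubset).trans card_image_le
  rw [card_image_of_injective _ h.2] at hcard
  simpa [sq] using hcard

end SetCover

namespace MapReduce

open Ty

/-! ## The cost of codes -/

namespace Ty

lemma one_le_size (B : ℕ) : ∀ (a : Ty) (x : a.den), 1 ≤ a.size B x
  | nat, _ => Nat.le_add_left _ _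
  | wt, _ => le_rfl
  | real, _ => le_rfl
  | prod a _, x => (one_le_size B a x.1).trans (Nat.le_add_right _ _)
  | list _, _ => Nat.le_add_left _ _

lemma size_prod (B : ℕ) (a b : Ty) (x : (prod a b).den) :
    (prod a b).size B x = a.size B x.1 + b.size B x.2 := rfl

lemma size_nil (B : ℕ) (a : Ty) : (list a).size B [] = 1 := rfl

lemma size_cons (B : ℕ) (a : Ty) (x : a.den) (l : List a.den) :
    (list a).size B (x :: l) = a.size B x + (list a).size B l := by
  simp only [size, List.map_cons, List.sum_cons]
  omega

lemma length_lt_size (B : ℕ) (a : Ty) (l : List a.den) : l.length < (list a).size B l := by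
  induction l with
  | nil => exact Nat.one_pos
  | cons x l ih =>
    rw [size_cons, List.length_cons]
    have := one_le_size B a x
    omega

lemma size_append (B : ℕ) (a : Ty) (l l' : List a.den) :
    (list a).size B (l ++ l') + 1 = (list a).size B l + (list a).size B l' := by
  simp only [size, List.map_append, List.sum_append]
  omega

lemma size_perm (B : ℕ) (a : Ty) {l l' : List a.den} (h : l.Perm l') :
    (list a).size B l = (list a).size B l' := by
  simp only [size, (h.map (a.size B)).sum_eq]

lemma size_lt_of_mem (B : ℕ) (a : Ty) {l : List a.den} {x : a.den} (h : x ∈ l) :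
    a.size B x < (list a).size B l :=
  Nat.lt_succ_of_le <|
    List.single_le_sum (fun _ _ => Nat.zero_le _) _ (List.mem_map_of_mem (f := a.size B) h)

lemma size_list_le (B : ℕ) (a : Ty) {l : List a.den} {k : ℕ} (h : ∀ x ∈ l, a.size B x ≤ k) :
    (list a).size B l ≤ l.length * k + 1 := by
  have := List.sum_le_card_nsmul (l.map (a.size B)) k (by simpa using h)
  simp only [List.length_map, smul_eq_mul] at this
  exact Nat.add_le_add_right this 1

lemma size_nat_of_lt {B x : ℕ} (h : x < B) : nat.size B x = 1 := by
  simp [size, h]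

lemma size_nat_le {B x k : ℕ} (h : x < B ^ k) (hk : k ≠ 0) : nat.size B x ≤ k :=
  Nat.log_lt_of_lt_pow' hk h

lemma lt_pow_size {B : ℕ} (hB : 2 ≤ B) (x : ℕ) : x < B ^ nat.size B x :=
  Nat.lt_pow_succ_log_self (by omega) x

lemma size_nat_mono {B x y : ℕ} (h : x ≤ y) : nat.size B x ≤ nat.size B y :=
  Nat.add_le_add_right (Nat.log_mono_right h) 1

lemma size_nat_add {B : ℕ} (hB : 2 ≤ B) (x y : ℕ) :
    nat.size B (x + y) ≤ nat.size B x + nat.size B y := by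
  have hx := lt_pow_size hB x
  have hy := lt_pow_size hB y
  have hx₁ := one_le_size B nat x
  have hy₁ := one_le_size B nat y
  have hx₂ : 2 ≤ B ^ nat.size B x := hB.trans (Nat.le_self_pow (by omega) B)
  have hy₂ : 2 ≤ B ^ nat.size B y := hB.trans (Nat.le_self_pow (by omega) B)
  refine size_nat_le ?_ (by omega)
  rw [pow_add]
  nlinarith

lemma size_nat_mul {B : ℕ} (hB : 2 ≤ B) (x y : ℕ) :
    nat.size B (x * y) ≤ nat.size B x + nat.size B y := by
  have hx₁ := one_le_size B nat x
  refine size_nat_le ?_ (by omega)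
  rw [pow_add]
  exact Nat.mul_lt_mul'' (lt_pow_size hB x) (lt_pow_size hB y)

end Ty

lemma pow_add_pow_add_one_le {b : ℕ} (hb : 2 ≤ b) (k k' : ℕ) :
    b ^ k + b ^ k' + 1 ≤ b ^ (k + k' + 2) := by
  have hk : b ^ k ≤ b ^ (k + k') := Nat.pow_le_pow_right (by omega) (by omega)
  have hk' : b ^ k' ≤ b ^ (k + k') := Nat.pow_le_pow_right (by omega) (by omega)
  have hone : 1 ≤ b ^ (k + k') := Nat.one_le_pow _ _ (by omega)
  have hsq : 2 ^ 2 ≤ b ^ 2 := Nat.pow_le_pow_left hb 2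
  rw [pow_add b (k + k') 2]
  nlinarith

section Iteration

variable {α β : Type} (g : β → α → β)

lemma iterTime_le (t : β → α → ℕ) (T : ℕ) (l : List α) (y : β)
    (ht : ∀ l₁ z l₂, l = l₁ ++ z :: l₂ → t (l₁.foldl g y) z ≤ T) :
    iterTime g t y l ≤ l.length * (T + 1) + 1 := by
  induction l generalizing y with
  | nil => simp [iterTime]
  | cons x l ih =>
    have head : t y x ≤ T := ht [] x l rfl
    have tail := ih (g y x) fun l₁ z l₂ e => ht (x :: l₁) z l₂ (by rw [e]; rfl)
    rw [iterTime, List.length_cons]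
    linarith

lemma iterTime_le_pow {S k : ℕ} (t : β → α → ℕ) (l : List α) (y : β) (hS : 1 ≤ S)
    (hl : l.length ≤ S) (ht : ∀ l₁ z l₂, l = l₁ ++ z :: l₂ → t (l₁.foldl g y) z ≤ (S + 1) ^ k) :
    iterTime g t y l ≤ (S + 1) ^ (k + 3) := by
  refine (iterTime_le g t _ l y ht).trans ?_
  have hone : 1 ≤ (S + 1) ^ k := Nat.one_le_pow _ _ (by omega)
  calc l.length * ((S + 1) ^ k + 1) + 1
    _ ≤ S * (2 * (S + 1) ^ k) + 1 := by gcongr; omega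
    _ ≤ (2 * S + 1) * (S + 1) ^ k := by nlinarith
    _ ≤ (S + 1) ^ 3 * (S + 1) ^ k := by gcongr; nlinarith [pow_succ (S + 1) 2, sq_nonneg S]
    _ = (S + 1) ^ (k + 3) := by ring

variable (s : β → α → ℕ) (size : β → ℕ)

lemma iterSpace_le (hsize : ∀ y x, size (g y x) ≤ s y x) (S : ℕ) (l : List α) (y : β)
    (hy : size y ≤ S) (hs : ∀ l₁ z l₂, l = l₁ ++ z :: l₂ → s (l₁.foldl g y) z ≤ S) :
    iterSpace g s size y l ≤ S := by
  induction l generalizing y with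
  | nil => exact hy
  | cons x l ih =>
    have head : s y x ≤ S := hs [] x l rfl
    exact max_le head <| ih (g y x) ((hsize y x).trans head)
      fun l₁ z l₂ e => hs (x :: l₁) z l₂ (by rw [e]; rfl)

lemma size_foldl_le_iterSpace (l : List α) (y : β) :
    size (l.foldl g y) ≤ iterSpace g s size y l := by
  induction l generalizing y with
  | nil => exact le_rfl
  | cons x l ih => exact (ih (g y x)).trans (le_max_right _ _)

lemma size_le_iterSpace (hs : ∀ y x, size y ≤ s y x) (l : List α) (y : β) :
    size y ≤ iterSpace g s size y l := by
  cases l with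
  | nil => exact le_rfl
  | cons x l => exact (hs y x).trans (le_max_left _ _)

end Iteration

namespace Code

lemma size_eval_le_space (B : ℕ) : ∀ {a b : Ty} (p : Code a b) (x : a.den),
    b.size B (p.eval x) ≤ p.space B x
  | _, _, prim _, _ => Nat.le_add_left _ _
  | _, _, comp q p, x => (size_eval_le_space B q (p.eval x)).trans (le_max_right _ _)
  | _, _, pair p q, x =>
    (Nat.add_le_add_left (size_eval_le_space B q x) _).trans (le_max_right _ _)
  | _, _, ite t p q, x => by
    refine le_trans ?_ (le_max_right _ _)
    simp only [eval]
    split_ifs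
    exacts [size_eval_le_space B p x, size_eval_le_space B q x]
  | _, _, fold p, x => (size_foldl_le_iterSpace _ _ _ x.2.1 x.2.2).trans (Nat.le_add_left _ _)
  | _, _, loop p, x =>
    (size_foldl_le_iterSpace _ _ _ (List.range x.2.1) x.2.2).trans (Nat.le_add_left _ _)

lemma size_le_space (B : ℕ) : ∀ {a b : Ty} (p : Code a b) (x : a.den),
    a.size B x ≤ p.space B x
  | _, _, prim _, _ => Nat.le_add_right _ _
  | _, _, comp _ p, x => (size_le_space B p x).trans (le_max_left _ _)
  | _, _, pair _ _, _ => (Nat.le_add_right _ _).trans (le_max_left _ _)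
  | _, _, ite _ _ _, _ => (Nat.le_add_right _ _).trans (le_max_left _ _)
  | _, b, fold p, x => by
    have := size_le_iterSpace (fun y z => p.eval (x.1, z, y)) (fun y z => p.space B (x.1, z, y))
      (b.size B)
      (fun y z => le_trans (by simp only [size_prod]; omega) (size_le_space B p (x.1, z, y)))
      x.2.1 x.2.2
    simp only [space, size_prod]
    omega
  | _, b, loop p, x => by
    have := size_le_iterSpace (fun y z => p.eval (x.1, z, y)) (fun y z => p.space B (x.1, z, y))
      (b.size B)
      (fun y z => le_trans (by simp only [size_prod]; omega) (size_le_space B p (x.1, z, y)))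
      (List.range x.2.1) x.2.2
    simp only [space, size_prod]
    omega

variable {a b c e : Ty}

/-- On the input `x`, and for words of capacity `B`, the code `p` runs in space `S` and in time
`(S + 1) ^ k`.  As the space comprises the input and the output, `S` also bounds their sizes. -/
structure Cost (p : Code a b) (B S k : ℕ) (x : a.den) : Prop where
  space_le : p.space B x ≤ S
  time_le : p.time x ≤ (S + 1) ^ k

namespace Cost

variable {B S S' k k' : ℕ}

lemma size_le {p : Code a b} {x : a.den} (h : p.Cost B S k x) : a.size B x ≤ S :=
  (size_le_space B p x).trans h.space_le

lemma size_eval_le {p : Code a b} {x : a.den} (h : p.Cost B S k x) : b.size B (p.eval x) ≤ S :=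
  (size_eval_le_space B p x).trans h.space_le

lemma one_le {p : Code a b} {x : a.den} (h : p.Cost B S k x) : 1 ≤ S :=
  (one_le_size B a x).trans h.size_le

lemma mono {p : Code a b} {x : a.den} (h : p.Cost B S k x) (hS : S ≤ S') (hk : k ≤ k') :
    p.Cost B S' k' x :=
  ⟨h.space_le.trans hS, h.time_le.trans <|
    (Nat.pow_le_pow_left (by omega) _).trans (Nat.pow_le_pow_right (by omega) hk)⟩

lemma comp {p : Code a b} {q : Code b c} {x : a.den} (hp : p.Cost B S k x)
    (hq : q.Cost B S k' (p.eval x)) : (comp q p).Cost B S (k + k' + 2) x :=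
  ⟨max_le hp.space_le hq.space_le,
    (Nat.add_le_add_right (Nat.add_le_add hp.time_le hq.time_le) 1).trans
      (pow_add_pow_add_one_le (by have := hp.one_le; omega) k k')⟩

lemma pair {p : Code a b} {q : Code a c} {x : a.den} (hp : p.Cost B S k x)
    (hq : q.Cost B S k' x) : (pair p q).Cost B (2 * S) (k + k' + 2) x := by
  have time_le : (p.pair q).time x ≤ (S + 1) ^ (k + k' + 2) :=
    (Nat.add_le_add_right (Nat.add_le_add hp.time_le hq.time_le) 1).trans
      (pow_add_pow_add_one_le (by have := hp.one_le; omega) k k')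
  refine ⟨?_, time_le.trans (Nat.pow_le_pow_left (by omega) _)⟩
  rw [two_mul]
  exact max_le (Nat.add_le_add hp.size_le hp.space_le) (Nat.add_le_add hp.size_eval_le hq.space_le)

lemma ite {t : Code a nat} {p q : Code a b} {x : a.den} (ht : t.Cost B S k x)
    (hp : t.eval x ≠ (0 : ℕ) → p.Cost B S k' x) (hq : t.eval x = (0 : ℕ) → q.Cost B S k' x) :
    (ite t p q).Cost B (2 * S) (k + k' + 2) x := by
  have branch : (if (show ℕ from t.eval x) ≠ 0 then p.space B x else q.space B x) ≤ S ∧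
      (if (show ℕ from t.eval x) ≠ 0 then p.time x else q.time x) ≤ (S + 1) ^ k' := by
    split_ifs with h
    exacts [⟨(hp h).space_le, (hp h).time_le⟩,
      ⟨(hq (not_not.1 h)).space_le, (hq (not_not.1 h)).time_le⟩]
  have time_le : (t.ite p q).time x ≤ (S + 1) ^ (k + k' + 2) :=
    (Nat.add_le_add_right (Nat.add_le_add ht.time_le branch.2) 1).trans
      (pow_add_pow_add_one_le (by have := ht.one_le; omega) k k')
  refine ⟨?_, time_le.trans (Nat.pow_le_pow_left (by omega) _)⟩
  rw [two_mul]
  exact max_le (Nat.add_le_add ht.size_le ht.space_le) (branch.1.trans (Nat.le_add_left _ _))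

lemma fold {p : Code (.prod e (.prod a b)) b} {x : (Ty.prod e (.prod (.list a) b)).den}
    (hx : (Ty.prod e (.prod (.list a) b)).size B x ≤ S)
    (hp : ∀ l₁ z l₂, x.2.1 = l₁ ++ z :: l₂ →
      p.Cost B S k (x.1, z, l₁.foldl (fun y z => p.eval (x.1, z, y)) x.2.2)) :
    (fold p).Cost B (2 * S) (k + 3) x := by
  simp only [size_prod] at hx
  have hlen := length_lt_size B a x.2.1
  constructor
  · have := iterSpace_le (fun y z => p.eval (x.1, z, y)) (fun y z => p.space B (x.1, z, y))
      (b.size B) (fun _ _ => size_eval_le_space B p _) S x.2.1 x.2.2 (by omega)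
      fun l₁ z l₂ h => (hp l₁ z l₂ h).space_le
    simp only [space]
    omega
  · have := iterTime_le_pow (fun y z => p.eval (x.1, z, y)) (fun y z => p.time (x.1, z, y))
      x.2.1 x.2.2 (by omega) (by omega) fun l₁ z l₂ h => (hp l₁ z l₂ h).time_le
    exact this.trans (Nat.pow_le_pow_left (by omega) _)

lemma loop {p : Code (.prod e (.prod .nat b)) b} {x : (Ty.prod e (.prod .nat b)).den}
    (hx : (Ty.prod e (.prod .nat b)).size B x ≤ S) (hlen : x.2.1 ≤ S)
    (hp : ∀ l₁ z l₂, List.range x.2.1 = l₁ ++ z :: l₂ →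
      p.Cost B S k (x.1, z, l₁.foldl (fun y z => p.eval (x.1, z, y)) x.2.2)) :
    (loop p).Cost B (2 * S) (k + 3) x := by
  simp only [size_prod] at hx
  have hone := one_le_size B nat x.2.1
  constructor
  · have := iterSpace_le (fun y z => p.eval (x.1, z, y)) (fun y z => p.space B (x.1, z, y))
      (b.size B) (fun _ _ => size_eval_le_space B p _) S (List.range x.2.1) x.2.2 (by omega)
      fun l₁ z l₂ h => (hp l₁ z l₂ h).space_le
    simp only [space]
    omega
  · have := iterTime_le_pow (fun y z => p.eval (x.1, z, y)) (fun y z => p.time (x.1, z, y))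
      (List.range x.2.1) x.2.2 (by omega) (by simpa using hlen)
      fun l₁ z l₂ h => (hp l₁ z l₂ h).time_le
    exact this.trans (Nat.pow_le_pow_left (by omega) _)

end Cost

/-- The code `p` runs in linear space and in polynomial time on the inputs `x` with `P B N x`,
where `N` is any bound for the size of `x` in words of capacity `B`. -/
def EfficientOn (P : ℕ → ℕ → a.den → Prop) (p : Code a b) : Prop :=
  ∃ C, ∀ B, 2 ≤ B → ∀ N x, a.size B x ≤ N → P B N x → p.Cost B (C * N) C x

/-- The code `p` runs in linear space and in polynomial time on all inputs. -/
class Efficient (p : Code a b) : Prop where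
  efficientOn : EfficientOn (fun _ _ _ => True) p

lemma Efficient.on (p : Code a b) [h : Efficient p] (P : ℕ → ℕ → a.den → Prop) :
    EfficientOn P p :=
  let ⟨C, hC⟩ := h.efficientOn
  ⟨C, fun B hB N x hx _ => hC B hB N x hx trivial⟩

lemma Efficient.exists_size_eval_le (p : Code a b) [h : Efficient p] :
    ∃ C, ∀ B, 2 ≤ B → ∀ x, b.size B (p.eval x) ≤ C * a.size B x :=
  let ⟨C, hC⟩ := h.efficientOn
  ⟨C, fun B hB x => (hC B hB _ x le_rfl trivial).size_eval_le⟩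

namespace EfficientOn

variable {P : ℕ → ℕ → a.den → Prop}

lemma mono {p : Code a b} {Q : ℕ → ℕ → a.den → Prop} (hp : EfficientOn Q p)
    (h : ∀ B N x, P B N x → Q B N x) : EfficientOn P p :=
  let ⟨C, hC⟩ := hp
  ⟨C, fun B hB N x hx hP => hC B hB N x hx (h B N x hP)⟩

lemma comp {Q : ℕ → ℕ → b.den → Prop} {p : Code a b} {q : Code b c} (hp : EfficientOn P p)
    (hq : EfficientOn Q q)
    (h : ∀ B N x, 2 ≤ B → a.size B x ≤ N → P B N x → ∀ N' ≥ N, Q B N' (p.eval x)) :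
    EfficientOn P (comp q p) := by
  obtain ⟨C, hC⟩ := hp
  obtain ⟨D, hD⟩ := hq
  refine ⟨C + D * C + D + 2, fun B hB N x hx hP => ?_⟩
  have costp := hC B hB N x hx hP
  have hCN : N ≤ C * N :=
    Nat.le_mul_of_pos_left N (Nat.pos_of_mul_pos_right (Nat.lt_of_succ_le costp.one_le))
  have costq := hD B hB (C * N) _ costp.size_eval_le (h B N x hB hx hP _ hCN)
  exact ((costp.mono (by nlinarith) le_rfl).comp
    (costq.mono (by nlinarith) le_rfl)).mono le_rfl (by nlinarith)

lemma pair {p : Code a b} {q : Code a c} (hp : EfficientOn P p) (hq : EfficientOn P q) :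
    EfficientOn P (pair p q) := by
  obtain ⟨C, hC⟩ := hp
  obtain ⟨D, hD⟩ := hq
  refine ⟨2 * (C + D) + 2, fun B hB N x hx hP => ?_⟩
  exact (((hC B hB N x hx hP).mono (Nat.mul_le_mul_right N (Nat.le_add_right C D)) le_rfl).pair
    ((hD B hB N x hx hP).mono (Nat.mul_le_mul_right N (Nat.le_add_left D C)) le_rfl)).mono
    (by nlinarith) (by omega)

lemma ite {t : Code a nat} {p q : Code a b} (ht : EfficientOn P t)
    (hp : EfficientOn (fun B N x => P B N x ∧ t.eval x ≠ (0 : ℕ)) p)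
    (hq : EfficientOn (fun B N x => P B N x ∧ t.eval x = (0 : ℕ)) q) :
    EfficientOn P (ite t p q) := by
  obtain ⟨C, hC⟩ := ht
  obtain ⟨D, hD⟩ := hp
  obtain ⟨E, hE⟩ := hq
  refine ⟨2 * (C + D + E) + 2, fun B hB N x hx hP => ?_⟩
  exact (((hC B hB N x hx hP).mono (S' := (C + D + E) * N) (by gcongr; omega) le_rfl).ite
    (k' := D + E)
    (fun h => (hD B hB N x hx ⟨hP, h⟩).mono (by gcongr; omega) (by omega))
    (fun h => (hE B hB N x hx ⟨hP, h⟩).mono (by gcongr; omega) (by omega))).mono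
    (by nlinarith) (by omega)

lemma fold {p : Code (.prod e (.prod a b)) b}
    {P : ℕ → ℕ → (Ty.prod e (.prod (.list a) b)).den → Prop}
    {Q : ℕ → ℕ → (Ty.prod e (.prod a b)).den → Prop} (hp : EfficientOn Q p) (D : ℕ)
    (h : ∀ B N x, 2 ≤ B → (Ty.prod e (.prod (.list a) b)).size B x ≤ N → P B N x →
      ∀ l₁ z l₂, x.2.1 = l₁ ++ z :: l₂ →
        b.size B (l₁.foldl (fun y z => p.eval (x.1, z, y)) x.2.2) ≤ D * N ∧
        ∀ N' ≥ N, Q B N' (x.1, z, l₁.foldl (fun y z => p.eval (x.1, z, y)) x.2.2)) :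
    EfficientOn P (fold p) := by
  obtain ⟨C, hC⟩ := hp
  refine ⟨2 * (C * (D + 1) + 1) + C + 3, fun B hB N x hx hP => ?_⟩
  refine (Cost.fold (S := (C * (D + 1) + 1) * N) (k := C)
    (hx.trans (Nat.le_mul_of_pos_left N (Nat.succ_pos _)))
    fun l₁ z l₂ hl => ?_).mono (by nlinarith) (by omega)
  obtain ⟨hacc, hQ⟩ := h B N x hB hx hP l₁ z l₂ hl
  have hz := size_lt_of_mem B a (l := x.2.1) (x := z) (by rw [hl]; simp)
  refine (hC B hB ((D + 1) * N) _ ?_ (hQ _ (by nlinarith))).mono (by nlinarith) le_rfl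
  simp only [size_prod] at hx ⊢
  nlinarith

lemma loop {p : Code (.prod e (.prod .nat b)) b}
    {P : ℕ → ℕ → (Ty.prod e (.prod .nat b)).den → Prop}
    {Q : ℕ → ℕ → (Ty.prod e (.prod .nat b)).den → Prop} (hp : EfficientOn Q p) (D : ℕ)
    (h : ∀ B N x, 2 ≤ B → (Ty.prod e (.prod .nat b)).size B x ≤ N → P B N x →
      x.2.1 ≤ D * N ∧ ∀ l₁ z l₂, List.range x.2.1 = l₁ ++ z :: l₂ →
        b.size B (l₁.foldl (fun y z => p.eval (x.1, z, y)) x.2.2) ≤ D * N ∧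
        ∀ N' ≥ N, Q B N' (x.1, z, l₁.foldl (fun y z => p.eval (x.1, z, y)) x.2.2)) :
    EfficientOn P (loop p) := by
  obtain ⟨C, hC⟩ := hp
  refine ⟨2 * (C * (D + 1) + D + 1) + C + 3, fun B hB N x hx hP => ?_⟩
  obtain ⟨hlen, hbody⟩ := h B N x hB hx hP
  refine (Cost.loop (S := (C * (D + 1) + D + 1) * N) (k := C)
    (hx.trans (Nat.le_mul_of_pos_left N (Nat.succ_pos _)))
    (hlen.trans (Nat.mul_le_mul_right N (by omega))) fun l₁ z l₂ hl => ?_).mono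
    (by nlinarith) (by omega)
  obtain ⟨hacc, hQ⟩ := hbody l₁ z l₂ hl
  have hz : z < x.2.1 := List.mem_range.1 (by rw [hl]; simp)
  have hzs : nat.size B z ≤ nat.size B x.2.1 := size_nat_mono hz.le
  refine (hC B hB ((D + 1) * N) _ ?_ (hQ _ (by nlinarith))).mono (by nlinarith) le_rfl
  simp only [size_prod] at hx ⊢
  nlinarith

/-- Here the accumulator stays linear because the sizes of the entries add up to the size of the
list. -/
lemma fold_of_increment {p : Code (.prod e (.prod a b)) b} [Efficient p]
    {P : ℕ → ℕ → (Ty.prod e (.prod (.list a) b)).den → Prop} (D : ℕ)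
    (h : ∀ B N x, 2 ≤ B → (Ty.prod e (.prod (.list a) b)).size B x ≤ N → P B N x →
      ∀ z ∈ x.2.1, ∀ y, b.size B (p.eval (x.1, z, y)) ≤ b.size B y + D * a.size B z) :
    EfficientOn P (Code.fold p) := by
  refine (Efficient.on p fun _ _ _ => True).fold (D + 1) fun B N x hB hx hP l₁ z l₂ hl => ?_
  refine ⟨?_, fun _ _ => trivial⟩
  have acc_le (l : List a.den) (hl : ∀ z ∈ l, z ∈ x.2.1) (y : b.den) :
      b.size B (l.foldl (fun y z => p.eval (x.1, z, y)) y) ≤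
        b.size B y + D * (list a).size B l := by
    induction l generalizing y with
    | nil => simp
    | cons z l ih =>
      have head := h B N x hB hx hP z (hl z List.mem_cons_self) y
      have tail := ih (fun z hz => hl z (List.mem_cons_of_mem _ hz)) (p.eval (x.1, z, y))
      rw [size_cons, mul_add, List.foldl_cons]
      omega
  have hacc := acc_le l₁ (fun z hz => by rw [hl]; simp [hz]) x.2.2
  have happ : (list a).size B x.2.1 + 1 = (list a).size B l₁ + (list a).size B (z :: l₂) := by
    rw [hl]
    exact size_append B a _ _
  have hrest := one_le_size B (list a) (z :: l₂)
  simp only [size_prod] at hx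
  nlinarith

end EfficientOn

namespace Efficient

instance (p : Code a b) (q : Code b c) [Efficient p] [Efficient q] : Efficient (comp q p) :=
  ⟨(Efficient.on p _).comp (Efficient.on q fun _ _ _ => True) fun _ _ _ _ _ _ _ _ => trivial⟩

instance (p : Code a b) (q : Code a c) [Efficient p] [Efficient q] : Efficient (pair p q) :=
  ⟨(Efficient.on p _).pair (Efficient.on q _)⟩

instance (t : Code a nat) (p q : Code a b) [Efficient t] [Efficient p] [Efficient q] :
    Efficient (ite t p q) :=
  ⟨(Efficient.on t _).ite (Efficient.on p _) (Efficient.on q _)⟩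

lemma fold (p : Code (.prod e (.prod a b)) b) [Efficient p] (D : ℕ)
    (h : ∀ B, 2 ≤ B → ∀ x z y, b.size B (p.eval (x, z, y)) ≤ b.size B y + D * a.size B z) :
    Efficient (fold p) :=
  ⟨EfficientOn.fold_of_increment D fun B _ x hB _ _ z _ y => h B hB x.1 z y⟩

end Efficient

lemma size_ite_one_zero {B : ℕ} (hB : 2 ≤ B) (P : Prop) [Decidable P] :
    nat.size B (if P then 1 else 0) = 1 := by
  apply size_nat_of_lt
  split_ifs <;> omega

/-- A factor by which an elementary operation can increase the size. -/
def primFactor : {a b : Ty} → Prim a b → ℕ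
  | _, _, .const k => k + 1
  | _, _, _ => 1

lemma size_eval_prim_le {B : ℕ} (hB : 2 ≤ B) : ∀ {a b : Ty} (p : Prim a b) (x : a.den),
    b.size B (p.eval x) ≤ primFactor p * a.size B x
  | a, _, .const k, x => by
      have hx := one_le_size B a x
      have hk := Nat.log_le_self B k
      simp only [primFactor, Prim.eval, size]
      nlinarith
  | _, _, .add, x => by simpa [primFactor, Prim.eval, size_prod] using size_nat_add hB _ _
  | _, _, .mul, x => by simpa [primFactor, Prim.eval, size_prod] using size_nat_mul hB _ _
  | _, _, .sub, x => by
      have := size_nat_mono (B := B) (Nat.sub_le x.1 x.2)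
      simp only [primFactor, Prim.eval, size_prod, one_mul]
      omega
  | _, _, .div, x => by
      have := size_nat_mono (B := B) (Nat.div_le_self x.1 x.2)
      simp only [primFactor, Prim.eval, size_prod, one_mul]
      omega
  | _, _, .le, x => by
      simp only [primFactor, Prim.eval, size_ite_one_zero hB, one_mul, one_le_size]
  | _, _, .rle, x => by
      simp only [primFactor, Prim.eval, size_ite_one_zero hB, one_mul, one_le_size]
  | _, _, .cons, x => by
      simp only [primFactor, Prim.eval, size_cons, one_mul, size_prod, le_refl]
  | _, _, .nil, x => by simp only [primFactor, Prim.eval, size_nil, one_mul, one_le_size]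
  | _, _, .rzero, x => by simp only [primFactor, size, one_mul, one_le_size]
  | _, _, .id, x => by simp [primFactor, Prim.eval]
  | _, _, .fst, x => by simp [primFactor, Prim.eval, size]
  | _, _, .snd, x => by simp [primFactor, Prim.eval, size]
  | _, _, .read, x => by simp [primFactor, size]
  | _, _, .radd, x => by simp [primFactor, size]
  | _, _, .rsub, x => by simp [primFactor, size]

instance (p : Prim a b) : Efficient (prim p) := by
  refine ⟨primFactor p + 1, fun B hB N x hx _ => ⟨?_, Nat.one_le_pow _ _ (Nat.succ_pos _)⟩⟩
  have hout := (size_eval_prim_le hB p x).trans (Nat.mul_le_mul_left _ hx)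
  rw [space, add_mul, one_mul]
  omega

end Code

local notation:65 p:65 "⊳" q:66 => Code.comp q p

variable {a b c d e : Ty}

attribute [local simp] Prim.eval

namespace Code

/-! ## A library of codes -/

/-- The first component of a pair. -/
abbrev π₁ : Code (prod a b) a := prim .fst

/-- The second component of a pair. -/
abbrev π₂ : Code (prod a b) b := prim .snd

/-- A constant natural number. -/
abbrev num (k : ℕ) : Code a nat := prim (.const k)

/-- The empty list. -/
abbrev nil : Code a (list b) := prim .nil

/-- A binary elementary operation applied to the results of two codes. -/
abbrev bin (o : Prim (prod b c) d) (p : Code a b) (q : Code a c) : Code a d :=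
  pair p q ⊳ prim o

@[simp] lemma eval_prim (p : Prim a b) (x : a.den) : (prim p).eval x = p.eval x := by
  rw [eval]

@[simp] lemma eval_comp (p : Code a b) (q : Code b c) (x : a.den) :
    (p ⊳ q).eval x = q.eval (p.eval x) := by
  rw [eval]

@[simp] lemma eval_pair (p : Code a b) (q : Code a c) (x : a.den) :
    (pair p q).eval x = (p.eval x, q.eval x) := by
  rw [eval]

@[simp] lemma eval_ite (t : Code a nat) (p q : Code a b) (x : a.den) :
    (ite t p q).eval x = if t.eval x = (0 : ℕ) then q.eval x else p.eval x := by
  rw [eval]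
  exact ite_not _ _ _

@[simp] lemma eval_fold (p : Code (prod e (prod a b)) b) (x : (prod e (prod (list a) b)).den) :
    (fold p).eval x = x.2.1.foldl (fun y z => p.eval (x.1, z, y)) x.2.2 := by
  rw [eval]

@[simp] lemma eval_loop (p : Code (prod e (prod nat b)) b) (x : (prod e (prod nat b)).den) :
    (loop p).eval x = (List.range x.2.1).foldl (fun y z => p.eval (x.1, z, y)) x.2.2 := by
  rw [eval]

/-- Equality of natural numbers, as `x ≤ y` times `y ≤ x`. -/
def eqNat : Code (prod nat nat) nat :=
  bin .mul (prim .le) (pair π₂ π₁ ⊳ prim .le)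

@[simp] lemma eval_eqNat (x : ℕ × ℕ) :
    eqNat.eval x = if x.1 = x.2 then (1 : ℕ) else (0 : ℕ) := by
  obtain ⟨x, y⟩ := x
  simp only [eqNat, eval_prim, eval_comp, eval_pair, Prim.eval]
  rcases lt_trichotomy x y with h | h | h
  · simp [h.le, h.not_ge, h.ne]
  · simp [h]
  · simp [h.le, h.not_ge, h.ne']

instance : Efficient eqNat := by unfold eqNat; infer_instance

/-- Whether the test `t` succeeds on some entry of a list. -/
def any (t : Code (prod e a) nat) : Code (prod e (list a)) nat :=
  pair π₁ (pair π₂ (num 0)) ⊳ fold (ite (pair π₁ (π₂ ⊳ π₁) ⊳ t) (num 1) (π₂ ⊳ π₂))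

lemma foldl_ite_one {α : Type} (P : α → Prop) [DecidablePred P] (l : List α) (y : ℕ) :
    l.foldl (fun y z => if P z then y else 1) y = if ∃ z ∈ l, ¬ P z then 1 else y := by
  induction l generalizing y with
  | nil => simp
  | cons x l ih =>
    rw [List.foldl_cons, ih]
    by_cases h : P x <;> by_cases h' : ∃ z ∈ l, ¬ P z <;> simp [h, h']

@[simp] lemma eval_any (t : Code (prod e a) nat) (x : e.den × List a.den) :
    (any t).eval x = if ∃ z ∈ x.2, t.eval (x.1, z) ≠ (0 : ℕ) then (1 : ℕ) else (0 : ℕ) := by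
  simp only [any, eval_comp, eval_prim, eval_pair, eval_fold, eval_ite, Prim.eval]
  exact foldl_ite_one (fun z => t.eval (x.1, z) = (0 : ℕ)) x.2 0

instance (t : Code (prod e a) nat) [Efficient t] : Efficient (any t) := by
  have : Efficient (fold (e := e) (ite (pair π₁ (π₂ ⊳ π₁) ⊳ t) (num 1) (π₂ ⊳ π₂))) := by
    refine Efficient.fold _ 1 fun B hB x z y => ?_
    have hy := one_le_size B nat y
    simp only [eval_prim, eval_comp, eval_pair, eval_ite, Prim.eval]
    split_ifs
    · omega
    · rw [size_nat_of_lt (by omega)]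
      omega
  unfold any
  infer_instance

/-- Membership in a list of natural numbers. -/
def mem : Code (prod nat (list nat)) nat := any eqNat

@[simp] lemma eval_mem (x : ℕ × List ℕ) :
    mem.eval x = if x.1 ∈ x.2 then (1 : ℕ) else (0 : ℕ) := by
  rw [mem, eval_any]
  simp

instance : Efficient mem := by unfold mem; infer_instance

instance : Efficient (fold (e := e) (π₂ ⊳ prim (.cons (a := a)))) :=
  Efficient.fold _ 1 fun B _ x z y => by
    simp only [eval_prim, eval_comp, Prim.eval, size_cons]
    omega

/-- Reversal of a list. -/
def reverse : Code (list a) (list a) :=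
  pair (num 0) (pair (prim .id) nil) ⊳ fold (π₂ ⊳ prim .cons)

@[simp] lemma eval_reverse (l : List a.den) : (reverse (a := a)).eval l = l.reverse := by
  simp [reverse]

instance : Efficient (reverse (a := a)) := by unfold reverse; infer_instance

/-- The entries of a list on which the test `t` succeeds. -/
def filter (t : Code (prod e a) nat) : Code (prod e (list a)) (list a) :=
  pair π₁ (pair π₂ nil) ⊳
    fold (ite (pair π₁ (π₂ ⊳ π₁) ⊳ t) (π₂ ⊳ prim .cons) (π₂ ⊳ π₂)) ⊳ reverse

lemma foldl_ite_cons {α : Type} (P : α → Prop) [DecidablePred P] (l y : List α) :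
    l.foldl (fun y z => if P z then y else z :: y) y =
      (l.filter fun z => ¬ P z).reverse ++ y := by
  induction l generalizing y with
  | nil => simp
  | cons x l ih =>
    rw [List.foldl_cons, ih]
    by_cases h : P x <;> simp [h]

@[simp] lemma eval_filter (t : Code (prod e a) nat) (x : e.den × List a.den) :
    (filter t).eval x = x.2.filter fun z => t.eval (x.1, z) ≠ (0 : ℕ) := by
  have h := foldl_ite_cons (fun z => t.eval (x.1, z) = (0 : ℕ)) x.2 []
  rw [List.append_nil] at h
  simp only [filter, eval_prim, eval_comp, eval_pair, eval_ite, eval_fold, Prim.eval, eval_reverse]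
  rw [← List.reverse_reverse (List.filter _ x.2)]
  exact congrArg List.reverse h

instance (t : Code (prod e a) nat) [Efficient t] : Efficient (filter t) := by
  have : Efficient (fold (ite (pair π₁ (π₂ ⊳ π₁) ⊳ t) (π₂ ⊳ prim .cons) (π₂ ⊳ π₂))) := by
    refine Efficient.fold _ 1 fun B _ x z y => ?_
    simp only [eval_prim, eval_comp, eval_pair, eval_ite, Prim.eval]
    split_ifs
    · omega
    · rw [size_cons]
      omega
  unfold filter
  infer_instance

/-- The images of the entries of a list under `p`, which also sees the environment. -/
def mapEnv (p : Code (prod e a) b) : Code (prod e (list a)) (list b) :=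
  pair π₁ (pair π₂ nil) ⊳ fold (bin .cons (pair π₁ (π₂ ⊳ π₁) ⊳ p) (π₂ ⊳ π₂)) ⊳ reverse

lemma foldl_map_cons {α β : Type} (f : α → β) (l : List α) (y : List β) :
    l.foldl (fun y z => f z :: y) y = (l.map f).reverse ++ y := by
  induction l generalizing y with
  | nil => simp
  | cons x l ih => simp [ih]

@[simp] lemma eval_mapEnv (p : Code (prod e a) b) (x : e.den × List a.den) :
    (mapEnv p).eval x = x.2.map fun z => p.eval (x.1, z) := by
  simp only [mapEnv, eval_prim, eval_comp, eval_pair, eval_fold, Prim.eval, eval_reverse]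
  rw [foldl_map_cons (fun z => p.eval (x.1, z)) x.2 [], List.append_nil, List.reverse_reverse]

lemma efficientOn_mapEnv {p : Code (prod e a) b} [Efficient p]
    {P : ℕ → ℕ → (prod e (list a)).den → Prop} (D : ℕ)
    (h : ∀ B N x, 2 ≤ B → (prod e (list a)).size B x ≤ N → P B N x →
      ∀ z ∈ x.2, b.size B (p.eval (x.1, z)) ≤ D * a.size B z) :
    EfficientOn P (mapEnv p) := by
  have body : EfficientOn
      (fun B _ (x : (prod e (prod (list a) (list b))).den) =>
        ∀ z ∈ x.2.1, b.size B (p.eval (x.1, z)) ≤ D * a.size B z)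
      (fold (bin .cons (pair π₁ (π₂ ⊳ π₁) ⊳ p) (π₂ ⊳ π₂))) := by
    refine EfficientOn.fold_of_increment D fun B N x _ _ hx z hz y => ?_
    have := hx z hz
    simp only [eval_prim, eval_comp, eval_pair, Prim.eval, size_cons] at this ⊢
    omega
  refine EfficientOn.comp (EfficientOn.comp (Efficient.on _ P) body fun B N x hB hx hP N' _ => ?_)
    (Efficient.on reverse fun _ _ _ => True) fun _ _ _ _ _ _ _ _ => trivial
  simpa using h B N x hB hx hP

lemma efficient_mapEnv (p : Code (prod e a) b) [Efficient p] (D : ℕ)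
    (h : ∀ B, 2 ≤ B → ∀ x z, b.size B (p.eval (x, z)) ≤ D * a.size B z) :
    Efficient (mapEnv p) :=
  ⟨efficientOn_mapEnv D fun B _ _ hB _ _ z _ => h B hB _ z⟩

/-- The images of the entries of a list under `p`. -/
def map (p : Code a b) : Code (list a) (list b) :=
  pair (num 0) (prim .id) ⊳ mapEnv (π₂ ⊳ p)

@[simp] lemma eval_map (p : Code a b) (l : List a.den) : (map p).eval l = l.map p.eval := by
  simp [map]

instance (p : Code a b) [Efficient p] : Efficient (map p) := by
  have : Efficient (mapEnv (e := nat) (π₂ ⊳ p)) := by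
    obtain ⟨C, hC⟩ := Efficient.exists_size_eval_le p
    exact efficient_mapEnv _ C fun B hB _ z => by simpa using hC B hB z
  unfold map
  infer_instance

/-- Concatenation of two lists. -/
def append : Code (prod (list a) (list a)) (list a) :=
  pair (num 0) (pair (π₁ ⊳ reverse) π₂) ⊳ fold (π₂ ⊳ prim .cons)

@[simp] lemma eval_append (x : List a.den × List a.den) :
    (append (a := a)).eval x = x.1 ++ x.2 := by
  simp [append]

instance : Efficient (append (a := a)) := by unfold append; infer_instance

/-- Concatenation of the entries of a list of lists. -/
def flatten : Code (list (list a)) (list a) :=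
  pair (num 0) (pair reverse nil) ⊳ fold (π₂ ⊳ append)

@[simp] lemma eval_flatten (l : List (List a.den)) : (flatten (a := a)).eval l = l.flatten := by
  simp only [flatten, eval_prim, eval_comp, eval_pair, eval_fold, Prim.eval, eval_reverse,
    eval_append]
  induction l with
  | nil => simp
  | cons x l ih => simp only [List.reverse_cons, List.foldl_append, ih]; simp

instance : Efficient (flatten (a := a)) := by
  have : Efficient (fold (e := nat) (π₂ ⊳ append (a := a))) := by
    refine Efficient.fold _ 1 fun B _ x z y => ?_
    have := size_append B a z y
    simp only [eval_prim, eval_comp, Prim.eval, eval_append]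
    omega
  unfold flatten
  infer_instance

/-- The length of a list. -/
def length : Code (list a) nat :=
  pair (num 0) (pair (prim .id) (num 0)) ⊳ fold (bin .add (π₂ ⊳ π₂) (num 1))

@[simp] lemma eval_length (l : List a.den) : (length (a := a)).eval l = l.length := by
  simp [length]

instance : Efficient (length (a := a)) := by
  have : Efficient (fold (e := nat) (a := a) (bin .add (π₂ ⊳ π₂) (num 1))) := by
    refine Efficient.fold _ 1 fun B hB x z y => ?_
    have hadd := size_nat_add hB y 1
    have hz := one_le_size B a z
    rw [size_nat_of_lt (x := 1) (by omega)] at hadd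
    simp only [eval_prim, eval_comp, eval_pair, Prim.eval]
    omega
  unfold length
  infer_instance

/-- The entry of a list of numbers at a given position, or `0`.  The accumulator is the position of
the current entry together with the result. -/
def getD : Code (prod nat (list nat)) nat :=
  pair π₁ (pair π₂ (pair (num 0) (num 0))) ⊳
    fold (pair (bin .add (π₂ ⊳ π₂ ⊳ π₁) (num 1))
      (ite (pair (π₂ ⊳ π₂ ⊳ π₁) π₁ ⊳ eqNat) (π₂ ⊳ π₁) (π₂ ⊳ π₂ ⊳ π₂))) ⊳ π₂

lemma foldl_getD {α : Type} (k : ℕ) (l : List α) (y : ℕ × α) :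
    (l.foldl (fun (y : ℕ × α) z => (y.1 + 1, if y.1 = k then z else y.2)) y).2 =
      if y.1 ≤ k then l.getD (k - y.1) y.2 else y.2 := by
  induction l generalizing y with
  | nil => simp
  | cons z l ih =>
    rw [List.foldl_cons, ih]
    rcases lt_trichotomy y.1 k with h | h | h
    · obtain ⟨d, hd⟩ : ∃ d, k - y.1 = d + 1 := ⟨k - y.1 - 1, by omega⟩
      have hd' : k - (y.1 + 1) = d := by omega
      simp [h.le, h.ne, hd, hd', Nat.succ_le_of_lt h]
    · simp [h]
    · simp [h.ne', h.not_ge, Nat.not_le_of_lt (Nat.lt_succ_of_lt h)]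

@[simp] lemma eval_getD (x : ℕ × List ℕ) : getD.eval x = x.2.getD x.1 0 := by
  have h := foldl_getD x.1 x.2 ((0, 0) : ℕ × ℕ)
  rw [if_pos (Nat.zero_le _), Nat.sub_zero] at h
  rw [← h]
  simp [getD]

instance : Efficient getD := by
  have : Efficient (fold (a := nat) (pair (bin .add (π₂ ⊳ π₂ ⊳ π₁) (num 1))
      (ite (pair (π₂ ⊳ π₂ ⊳ π₁) π₁ ⊳ eqNat) (π₂ ⊳ π₁) (π₂ ⊳ π₂ ⊳ π₂)))) := by
    refine Efficient.fold _ 2 fun B hB x z y => ?_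
    have hadd := size_nat_add hB y.1 1
    have hz := one_le_size B nat z
    have hy := one_le_size B nat y.2
    rw [size_nat_of_lt (x := 1) (by omega)] at hadd
    simp only [eval_prim, eval_comp, eval_pair, eval_ite, Prim.eval, size_prod]
    split_ifs <;> omega
  unfold getD
  infer_instance

end Code

/-! ## The local ratio method -/

/-- Residual weights: the indices of sets, each with its residual weight. -/
abbrev residualTy : Ty := list (prod nat real)

namespace LocalRatio

open Classical in
/-- The minimum of the residual weights of the indices in `T`, with the flag `1`; if none of these
indices has a residual weight, the flag is `0` and so is the number. -/
noncomputable def minResidual (T : List ℕ) (res : List (ℕ × ℝ)) : ℕ × ℝ :=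
  res.foldl (fun y z => if z.1 ∈ T ∧ (y.1 = 0 ∨ z.2 ≤ y.2) then (1, z.2) else y) (0, 0)

/-- The residual weights after subtracting `ε` from those of the indices in `T`. -/
noncomputable def lower (T : List ℕ) (ε : ℝ) (res : List (ℕ × ℝ)) : List (ℕ × ℝ) :=
  res.map fun z => if z.1 ∈ T then (z.1, z.2 - ε) else z

open Classical in
/-- One step of the local ratio method: an element, given by the list `T` of the sets that contain
it, lowers the residual weights of these sets until one of them vanishes.  The list `y.2` records
the elements that had an effect; replaying them reproduces the residual weights. -/
noncomputable def process (y : List (ℕ × ℝ) × List (List ℕ)) (T : List ℕ) :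
    List (ℕ × ℝ) × List (List ℕ) :=
  if (minResidual T y.1).2 ≤ 0 then y else (lower T (minResidual T y.1).2 y.1, T :: y.2)

end LocalRatio

open LocalRatio

namespace Code

/-- The step of the fold in `LocalRatio.minResidual`. -/
def updateMin : Code (prod (list nat) (prod (prod nat real) (prod nat real))) (prod nat real) :=
  ite (pair (π₂ ⊳ π₁ ⊳ π₁) π₁ ⊳ mem)
    (ite (π₂ ⊳ π₂ ⊳ π₁)
      (ite (bin .rle (π₂ ⊳ π₁ ⊳ π₂) (π₂ ⊳ π₂ ⊳ π₂)) (pair (num 1) (π₂ ⊳ π₁ ⊳ π₂)) (π₂ ⊳ π₂))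
      (pair (num 1) (π₂ ⊳ π₁ ⊳ π₂)))
    (π₂ ⊳ π₂)

instance : Efficient updateMin := by unfold updateMin; infer_instance

instance : Efficient (fold updateMin) := by
  refine Efficient.fold _ 1 fun B hB x z y => ?_
  have hz := one_le_size B nat z.1
  have hy := one_le_size B nat y.1
  have hone (r : ℝ) : (prod nat real).size B (1, r) = 2 := by
    rw [size_prod, size_nat_of_lt (x := 1) (by omega)]
    rfl
  have hsize (z : ℕ × ℝ) : (prod nat real).size B z = nat.size B z.1 + 1 := rfl
  simp only [updateMin, eval_prim, eval_comp, eval_pair, eval_ite, eval_mem, Prim.eval]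
  split_ifs <;> simp only [hone, hsize] <;> omega

/-- A code for `LocalRatio.minResidual`. -/
def minResidual : Code (prod (list nat) residualTy) (prod nat real) :=
  pair π₁ (pair π₂ (pair (num 0) (prim .rzero))) ⊳ fold updateMin

@[simp] lemma eval_minResidual (x : List ℕ × List (ℕ × ℝ)) :
    minResidual.eval x = LocalRatio.minResidual x.1 x.2 := by
  simp only [minResidual, eval_prim, eval_comp, eval_pair, eval_fold, Prim.eval,
    LocalRatio.minResidual]
  congr 1
  ext y z : 2
  simp only [updateMin, eval_prim, eval_comp, eval_pair, eval_ite, eval_mem, Prim.eval]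
  by_cases hmem : z.1 ∈ x.1 <;> by_cases hflag : y.1 = 0 <;> by_cases hle : z.2 ≤ y.2 <;>
    simp [hmem, hflag, hle]

instance : Efficient minResidual := by unfold minResidual; infer_instance

/-- A code for the effect of `LocalRatio.lower` on one entry. -/
def lowerEntry : Code (prod (prod (list nat) real) (prod nat real)) (prod nat real) :=
  ite (pair (π₂ ⊳ π₁) (π₁ ⊳ π₁) ⊳ mem) (pair (π₂ ⊳ π₁) (bin .rsub (π₂ ⊳ π₂) (π₁ ⊳ π₂))) π₂

@[simp] lemma eval_lowerEntry (x : (List ℕ × ℝ) × (ℕ × ℝ)) :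
    lowerEntry.eval x = if x.2.1 ∈ x.1.1 then (x.2.1, x.2.2 - x.1.2) else x.2 := by
  simp only [lowerEntry, eval_prim, eval_comp, eval_pair, eval_ite, eval_mem, Prim.eval]
  by_cases h : x.2.1 ∈ x.1.1 <;> simp [h]

instance : Efficient lowerEntry := by unfold lowerEntry; infer_instance

lemma size_eval_lowerEntry (B : ℕ) (x : List ℕ × ℝ) (z : ℕ × ℝ) :
    (prod nat real).size B (lowerEntry.eval (x, z)) = (prod nat real).size B z := by
  rw [eval_lowerEntry]
  split_ifs <;> rfl

instance : Efficient (mapEnv lowerEntry) :=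
  efficient_mapEnv _ 1 fun B _ x z => by rw [size_eval_lowerEntry, one_mul]

lemma size_lower (B : ℕ) (T : List ℕ) (ε : ℝ) (res : List (ℕ × ℝ)) :
    residualTy.size B (lower T ε res) = residualTy.size B res := by
  induction res with
  | nil => rfl
  | cons z res ih =>
    have hcons : lower T ε (z :: res) =
        (lowerEntry.eval ((T, ε), z) : ℕ × ℝ) :: lower T ε res := by
      rw [eval_lowerEntry]
      rfl
    rw [hcons, size_cons, size_cons, ih, size_eval_lowerEntry]

/-- A code for `LocalRatio.process`, as the body of a fold without environment. -/
def process : Code (prod nat (prod (list nat) (prod residualTy (list (list nat)))))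
    (prod residualTy (list (list nat))) :=
  pair (pair (π₂ ⊳ π₁) (π₂ ⊳ π₂ ⊳ π₁) ⊳ minResidual ⊳ π₂) π₂ ⊳
    ite (bin .rle π₁ (prim .rzero)) (π₂ ⊳ π₂)
      (pair (pair (pair (π₂ ⊳ π₁) π₁) (π₂ ⊳ π₂ ⊳ π₁) ⊳ mapEnv lowerEntry)
        (bin .cons (π₂ ⊳ π₁) (π₂ ⊳ π₂ ⊳ π₂)))

@[simp] lemma eval_process (x : ℕ × List ℕ × List (ℕ × ℝ) × List (List ℕ)) :
    process.eval x = LocalRatio.process x.2.2 x.2.1 := by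
  simp only [process, eval_prim, eval_comp, eval_pair, eval_ite, eval_minResidual, eval_mapEnv,
    eval_lowerEntry, Prim.eval, LocalRatio.process, lower]
  by_cases h : (LocalRatio.minResidual x.2.1 x.2.2.1).2 ≤ 0 <;> simp [h]

instance : Efficient process := by unfold process; infer_instance

instance : Efficient (fold process) := by
  refine Efficient.fold _ 1 fun B _ x z y => ?_
  rw [eval_process, LocalRatio.process]
  split_ifs
  · exact Nat.le_add_right _ _
  · have := size_cons B (list nat) z y.2
    simp only [size_prod, size_lower]
    omega

/-- The local ratio method on a list of elements, for given weights. -/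
def localRatio :
    Code (prod (list (list nat)) (list (prod nat wt))) (prod residualTy (list (list nat))) :=
  pair (num 0) (pair π₁ (pair (π₂ ⊳ map (pair π₁ (π₂ ⊳ prim .read))) nil)) ⊳ fold process

@[simp] lemma eval_localRatio (x : List (List ℕ) × List (ℕ × ℝ)) :
    localRatio.eval x = x.1.foldl LocalRatio.process (x.2, []) := by
  simp only [localRatio, eval_prim, eval_comp, eval_pair, eval_fold, eval_map, Prim.eval,
    eval_process]
  congr
  exact List.map_id _

instance : Efficient localRatio := by unfold localRatio; infer_instance

end Code

/-! ## The algorithm -/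

/-- A message: a list of sets (or the list of the sets that contain an element), and a list of
weights. -/
abbrev messageTy : Ty := prod (list nat) (list (prod nat wt))

/-- A state `(input, X, E, θ, mode, q)`: the chosen sets `X`, the recorded elements `E` (on machine
`0`), the threshold `θ` for the random words, the number `mode` of the task in the next round, and
the number `q` of machines that know the chosen sets. -/
abbrev stateTy : Ty :=
  prod inputTy (prod (list nat) (prod (list (list nat)) (prod nat (prod nat nat))))

/-- The input of a machine in a round. -/
abbrev stepInputTy : Ty := prod stateTy (prod (list messageTy) (list nat))

/-- The output of a machine in a round. -/
abbrev stepOutputTy : Ty := prod stateTy (list (prod nat messageTy))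

/-- The number of elements in the list `els` with an index below `j`; this is the position of the
random word that belongs to the element `j`. -/
def rank (els : List (ℕ × List ℕ)) (j : ℕ) : ℕ := (els.filter fun z => z.1 < j).length

/-- The element `z` is not covered by `X`, and its random word is below `θ`. -/
def IsSampled (els : List (ℕ × List ℕ)) (X words : List ℕ) (θ : ℕ) (z : ℕ × List ℕ) : Prop :=
  (∀ i ∈ z.2, i ∉ X) ∧ words.getD (rank els z.1) 0 < θ

/-- The size of the group of at most `s` consecutive machines, out of `M`, that starts at `b`. -/
def groupSize (s M b : ℕ) : ℕ := min s (M - b)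

namespace Code

abbrev getInput : Code stepInputTy inputTy := π₁ ⊳ π₁
abbrev getSelf : Code stepInputTy nat := getInput ⊳ π₁ ⊳ π₁
abbrev getNumMachines : Code stepInputTy nat := getInput ⊳ π₁ ⊳ π₂ ⊳ π₁
abbrev getN : Code stepInputTy nat := getInput ⊳ π₁ ⊳ π₂ ⊳ π₂ ⊳ π₁
abbrev getM : Code stepInputTy nat := getInput ⊳ π₁ ⊳ π₂ ⊳ π₂ ⊳ π₂ ⊳ π₁
abbrev getS : Code stepInputTy nat := getInput ⊳ π₁ ⊳ π₂ ⊳ π₂ ⊳ π₂ ⊳ π₂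
abbrev getElts : Code stepInputTy (list (prod nat (list nat))) := getInput ⊳ π₂ ⊳ π₁
abbrev getWts : Code stepInputTy (list (prod nat wt)) := getInput ⊳ π₂ ⊳ π₂
abbrev getChosen : Code stepInputTy (list nat) := π₁ ⊳ π₂ ⊳ π₁
abbrev getRecorded : Code stepInputTy (list (list nat)) := π₁ ⊳ π₂ ⊳ π₂ ⊳ π₁
abbrev getThreshold : Code stepInputTy nat := π₁ ⊳ π₂ ⊳ π₂ ⊳ π₂ ⊳ π₁
abbrev getMode : Code stepInputTy nat := π₁ ⊳ π₂ ⊳ π₂ ⊳ π₂ ⊳ π₂ ⊳ π₁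
abbrev getInformed : Code stepInputTy nat := π₁ ⊳ π₂ ⊳ π₂ ⊳ π₂ ⊳ π₂ ⊳ π₂
abbrev getInbox : Code stepInputTy (list messageTy) := π₂ ⊳ π₁
abbrev getWords : Code stepInputTy (list nat) := π₂ ⊳ π₂

/-- The state with the given components. -/
abbrev mkState (input : Code a inputTy) (X : Code a (list nat)) (E : Code a (list (list nat)))
    (θ mode q : Code a nat) : Code a stateTy :=
  pair input (pair X (pair E (pair θ (pair mode q))))

/-- The state with a new mode. -/
abbrev setMode (mode : ℕ) : Code stepInputTy stateTy :=
  mkState getInput getChosen getRecorded getThreshold (num mode) getInformed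

/-- A code for `MapReduce.rank`. -/
def rank : Code (prod nat (list (prod nat (list nat)))) nat :=
  filter (ite (bin .le π₁ (π₂ ⊳ π₁)) (num 0) (num 1)) ⊳ length

@[simp] lemma eval_rank (x : ℕ × List (ℕ × List ℕ)) :
    rank.eval x = MapReduce.rank x.2 x.1 := by
  simp only [rank, eval_prim, eval_comp, eval_pair, eval_ite, eval_filter, eval_length, Prim.eval,
    MapReduce.rank]
  congr 2
  ext z
  by_cases h : x.1 ≤ z.1
  · simp [h]
  · simp [h, not_le.1 h]

instance : Efficient rank := by unfold rank; infer_instance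

/-- What `Code.isSampled` needs to know apart from the element: the elements on the machine, the
chosen sets, the random words and the threshold. -/
abbrev sampleEnvTy : Ty :=
  prod (list (prod nat (list nat))) (prod (list nat) (prod (list nat) nat))

/-- A code for `MapReduce.IsSampled`. -/
def isSampled : Code (prod sampleEnvTy (prod nat (list nat))) nat :=
  ite (pair (π₁ ⊳ π₂ ⊳ π₁) (π₂ ⊳ π₂) ⊳ any (pair π₂ π₁ ⊳ mem)) (num 0)
    (ite (bin .le (π₁ ⊳ π₂ ⊳ π₂ ⊳ π₂)
        (pair (pair (π₂ ⊳ π₁) (π₁ ⊳ π₁) ⊳ rank) (π₁ ⊳ π₂ ⊳ π₂ ⊳ π₁) ⊳ getD))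
      (num 0) (num 1))

open Classical in
@[simp] lemma eval_isSampled (x : sampleEnvTy.den × (ℕ × List ℕ)) :
    isSampled.eval x =
      if IsSampled x.1.1 x.1.2.1 x.1.2.2.1 x.1.2.2.2 x.2 then (1 : ℕ) else (0 : ℕ) := by
  obtain ⟨⟨els, X, words, θ⟩, z⟩ := x
  simp only [isSampled, eval_prim, eval_comp, eval_pair, eval_ite, eval_any, eval_mem,
    eval_rank, eval_getD, Prim.eval]
  by_cases hcov : ∃ i ∈ z.2, i ∈ X
  · have hnot : ¬ IsSampled els X words θ z := fun h =>
      let ⟨i, hi, hiX⟩ := hcov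
      h.1 i hi hiX
    simp [hcov, hnot]
  · have hiff : IsSampled els X words θ z ↔ words.getD (MapReduce.rank els z.1) 0 < θ :=
      and_iff_right fun i hi hiX => hcov ⟨i, hi, hiX⟩
    by_cases hle : θ ≤ words.getD (MapReduce.rank els z.1) 0
    · simp only [hiff, hcov, hle, not_lt.2 hle, ne_eq, ite_eq_right_iff, one_ne_zero, imp_false,
        not_not, if_false, if_true]
    · simp only [hiff, hcov, hle, not_le.1 hle, ne_eq, ite_eq_right_iff, one_ne_zero, imp_false,
        not_not, if_false, if_true]

instance : Efficient isSampled := by unfold isSampled; infer_instance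

/-- Every machine sends its weights and a sample of its uncovered elements to machine `0`. -/
def sample : Code stepInputTy stepOutputTy :=
  pair (setMode 1)
    (pair
      (pair (pair getElts (pair getChosen (pair getWords getThreshold))) getElts ⊳
        filter isSampled ⊳ map (pair (num 0) (pair π₂ nil)))
      (getWts ⊳ map (pair (num 0) (pair nil (bin .cons (prim .id) nil)))) ⊳ append)

/-- The threshold for the next sample. -/
def nextThreshold : Code stepInputTy nat :=
  ite (bin .le (bin .add (bin .add (bin .add getN getM) getS) (num 2)) getThreshold) getThreshold
    (bin .div (bin .mul (bin .mul (num 2) getS) getThreshold) getN)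

/-- The local ratio method on the recorded elements and those received; the sets without residual
weight are chosen.  Machines other than `0` receive nothing and therefore choose no sets. -/
def updateChosen : Code stepInputTy stepOutputTy :=
  pair (pair (pair getRecorded (getInbox ⊳ map π₁) ⊳ append) (getInbox ⊳ map π₂ ⊳ flatten) ⊳
      localRatio) (prim .id) ⊳
    pair (mkState (π₂ ⊳ getInput)
      (pair (num 0) (π₁ ⊳ π₁) ⊳ filter (bin .rle (π₂ ⊳ π₂) (prim .rzero)) ⊳ map π₁)
      (π₁ ⊳ π₂ ⊳ reverse) (π₂ ⊳ nextThreshold) (num 2) (num 1)) nil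

/-- A code for `MapReduce.groupSize`; the minimum is obtained by truncated subtraction. -/
def groupSize : Code (prod nat (prod nat nat)) nat :=
  bin .sub π₁ (bin .sub π₁ (bin .sub (π₂ ⊳ π₁) (π₂ ⊳ π₂)))

@[simp] lemma eval_groupSize (x : ℕ × ℕ × ℕ) :
    groupSize.eval x = MapReduce.groupSize x.1 x.2.1 x.2.2 := by
  simp only [groupSize, eval_prim, eval_comp, eval_pair, Prim.eval, MapReduce.groupSize]
  exact tsub_tsub_eq_min _ _

instance : Efficient groupSize := by unfold groupSize; infer_instance

/-- The set `i` is sent to the member `i % g` of the group of size `g` that starts at `b`; the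
environment is `(b, g)`. -/
def scatterMessage : Code (prod (prod nat nat) nat) (prod nat messageTy) :=
  pair (bin .add (π₁ ⊳ π₁) (bin .sub π₂ (bin .mul (bin .div π₂ (π₁ ⊳ π₂)) (π₁ ⊳ π₂))))
    (pair (bin .cons π₂ nil) nil)

@[simp] lemma eval_scatterMessage (x : (ℕ × ℕ) × ℕ) :
    scatterMessage.eval x = (x.1.1 + x.2 % x.1.2, [x.2], []) := by
  simp only [scatterMessage, eval_prim, eval_comp, eval_pair, Prim.eval, Nat.mod_eq_sub_div_mul]

instance : Efficient scatterMessage := by unfold scatterMessage; infer_instance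

/-- The environment of `scatterMessage` for the group that machine `k` has to inform. -/
def scatterGroup : Code stepInputTy (prod nat nat) :=
  pair (bin .mul getSelf getS)
    (pair getS (pair getNumMachines (bin .mul getSelf getS)) ⊳ groupSize)

@[simp] lemma eval_scatterGroup (x : stepInputTy.den) :
    scatterGroup.eval x = ((getSelf.eval x * getS.eval x : ℕ),
      MapReduce.groupSize (getS.eval x) (getNumMachines.eval x)
        (getSelf.eval x * getS.eval x : ℕ)) := by
  simp only [scatterGroup, eval_comp, eval_pair, eval_prim, Prim.eval, eval_groupSize]

instance : Efficient scatterGroup := by unfold scatterGroup; infer_instance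

/-- Unless all machines are informed, distribute the chosen sets over a group of machines. -/
def scatter : Code stepInputTy stepOutputTy :=
  ite (bin .le getNumMachines getInformed) (pair (setMode 0) nil)
    (pair (setMode 3) (pair scatterGroup getChosen ⊳ mapEnv scatterMessage))

/-- Send a message to all members of a group; the environment is the first member and the size of
the group. -/
def forward : Code (prod (prod nat nat) (prod messageTy (list (prod nat messageTy))))
    (list (prod nat messageTy)) :=
  pair (pair (π₁ ⊳ π₁) (π₂ ⊳ π₁)) (pair (π₁ ⊳ π₂) (π₂ ⊳ π₂)) ⊳
    loop (bin .cons (pair (bin .add (π₁ ⊳ π₁) (π₂ ⊳ π₁)) (π₁ ⊳ π₂)) (π₂ ⊳ π₂))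

/-- The first member and the size of the group to which machine `k` belongs. -/
def ownGroup : Code stepInputTy (prod nat nat) :=
  pair (bin .mul (bin .div getSelf getS) getS) (prim .id) ⊳
    pair π₁ (pair (π₂ ⊳ getS) (pair (π₂ ⊳ getNumMachines) π₁) ⊳ groupSize)

@[simp] lemma eval_ownGroup (x : stepInputTy.den) :
    ownGroup.eval x = ((getSelf.eval x / getS.eval x * getS.eval x : ℕ),
      MapReduce.groupSize (getS.eval x) (getNumMachines.eval x)
        (getSelf.eval x / getS.eval x * getS.eval x : ℕ)) := by
  simp only [ownGroup, eval_comp, eval_pair, eval_prim, Prim.eval, eval_groupSize]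

instance : Efficient ownGroup := by unfold ownGroup; infer_instance

/-- Forward all messages received to all members of the group. -/
def gather : Code stepInputTy stepOutputTy :=
  pair (setMode 4) (pair ownGroup (pair getInbox nil) ⊳ fold forward)

/-- Collect the chosen sets. -/
def receive : Code stepInputTy stepOutputTy :=
  pair (mkState getInput (getInbox ⊳ map π₁ ⊳ flatten) getRecorded getThreshold (num 2)
    (bin .mul getInformed getS)) nil

/-- One round; the modes `0, …, 4` stand for the codes from `sample` to `receive`. -/
def step : Code stepInputTy stepOutputTy :=
  ite getMode
    (ite (bin .le getMode (num 1)) updateChosen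
      (ite (bin .le getMode (num 2)) scatter (ite (bin .le getMode (num 3)) gather receive)))
    sample

/-- The initial state.  With the threshold `4 * s * (n + m + s + 2) / m`, the expected size of the
first sample is at most `4 * s`. -/
def init : Code inputTy stateTy :=
  mkState (prim .id) nil nil
    (bin .div (bin .mul (bin .mul (num 4) (π₁ ⊳ π₂ ⊳ π₂ ⊳ π₂ ⊳ π₂))
      (bin .add (bin .add (bin .add (π₁ ⊳ π₂ ⊳ π₂ ⊳ π₁) (π₁ ⊳ π₂ ⊳ π₂ ⊳ π₂ ⊳ π₁))
        (π₁ ⊳ π₂ ⊳ π₂ ⊳ π₂ ⊳ π₂)) (num 2))) (π₁ ⊳ π₂ ⊳ π₂ ⊳ π₂ ⊳ π₁))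
    (num 0) (num 1)

end Code

/-- Randomized local ratio. -/
abbrev randomizedLocalRatio : Algorithm where
  state := stateTy
  msg := messageTy
  state_storable := by simp [Ty.Storable]
  msg_storable := by simp [Ty.Storable]
  init := Code.init
  step := Code.step
  output := Code.π₂ ⊳ Code.π₁

namespace Code

section Eval

variable (k M n m s : ℕ) (els : List (ℕ × List ℕ)) (wts : List (ℕ × ℝ)) (X : List ℕ)
  (E : List (List ℕ)) (θ q : ℕ) (inbox : List messageTy.den) (words : List ℕ)

open Classical in
lemma eval_step_sample :
    step.eval ((((k, M, n, m, s), els, wts), X, E, θ, (0 : ℕ), q), inbox, words) =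
      ((((k, M, n, m, s), els, wts), X, E, θ, (1 : ℕ), q),
        (els.filter fun z => IsSampled els X words θ z).map (fun z => ((0 : ℕ), z.2, [])) ++
          wts.map fun z => ((0 : ℕ), [], [z])) := by
  simp only [step, sample, eval_prim, eval_comp, eval_pair, eval_ite, eval_filter, eval_map,
    eval_isSampled, eval_append, Prim.eval, if_true]
  congr 3
  congr 1
  ext z
  by_cases h : IsSampled els X words θ z <;> simp [h]

lemma eval_map_fst (l : List (prod a b).den) :
    (map (π₁ : Code (prod a b) a)).eval l = l.map Prod.fst :=
  (eval_map _ l).trans (List.map_congr_left fun _ _ => eval_prim _ _)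

lemma eval_map_snd (l : List (prod a b).den) :
    (map (π₂ : Code (prod a b) b)).eval l = l.map Prod.snd :=
  (eval_map _ l).trans (List.map_congr_left fun _ _ => eval_prim _ _)

open Classical in
lemma eval_step_updateChosen :
    step.eval ((((k, M, n, m, s), els, wts), X, E, θ, (1 : ℕ), q), inbox, words) =
      ((((k, M, n, m, s), els, wts),
        (((E ++ inbox.map Prod.fst).foldl LocalRatio.process
          ((inbox.map Prod.snd).flatten, [])).1.filter fun z => z.2 ≤ 0).map Prod.fst,
        ((E ++ inbox.map Prod.fst).foldl LocalRatio.process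
          ((inbox.map Prod.snd).flatten, [])).2.reverse,
        (if n + m + s + 2 ≤ θ then θ else 2 * s * θ / n), (2 : ℕ), (1 : ℕ)), []) := by
  simp only [step, updateChosen, nextThreshold, eval_prim, eval_comp, eval_pair, eval_ite,
    eval_filter, eval_map_fst, eval_map_snd, eval_append, eval_flatten, eval_localRatio,
    eval_reverse, Prim.eval]
  by_cases h : n + m + s + 2 ≤ θ <;> simp [h]

lemma eval_step_scatter :
    step.eval ((((k, M, n, m, s), els, wts), X, E, θ, (2 : ℕ), q), inbox, words) =
      if M ≤ q then ((((k, M, n, m, s), els, wts), X, E, θ, (0 : ℕ), q), [])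
      else ((((k, M, n, m, s), els, wts), X, E, θ, (3 : ℕ), q),
        X.map fun i => (k * s + i % MapReduce.groupSize s M (k * s), [i], [])) := by
  simp only [step, scatter, eval_scatterGroup, eval_prim, eval_comp, eval_pair, eval_ite,
    eval_mapEnv, eval_scatterMessage, Prim.eval]
  by_cases h : M ≤ q <;> simp [h]

lemma foldl_append_reverse {α β : Type} (f : α → List β) (l : List α) (y : List β) :
    l.foldl (fun y z => (f z).reverse ++ y) y = (l.flatMap f).reverse ++ y := by
  induction l generalizing y with
  | nil => simp
  | cons x l ih => simp [ih]

@[simp] lemma eval_forward (x : (ℕ × ℕ) × messageTy.den × List (ℕ × messageTy.den)) :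
    forward.eval x =
      ((List.range x.1.2).map fun t => (x.1.1 + t, x.2.1)).reverse ++ x.2.2 := by
  simp only [forward, eval_prim, eval_comp, eval_pair, eval_loop, Prim.eval]
  exact foldl_map_cons (fun t : ℕ => (x.1.1 + t, x.2.1)) _ _

lemma foldl_forward (x : ℕ × ℕ) (l : List messageTy.den) (y : List (ℕ × messageTy.den)) :
    l.foldl (fun y z => forward.eval (x, z, y)) y =
      (l.flatMap fun z => (List.range x.2).map fun t => (x.1 + t, z)).reverse ++ y := by
  simp only [eval_forward]
  exact foldl_append_reverse (fun z : messageTy.den => (List.range x.2).map fun t => (x.1 + t, z))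
    l y

lemma eval_step_gather :
    step.eval ((((k, M, n, m, s), els, wts), X, E, θ, (3 : ℕ), q), inbox, words) =
      ((((k, M, n, m, s), els, wts), X, E, θ, (4 : ℕ), q),
        (inbox.flatMap fun z => (List.range (MapReduce.groupSize s M (k / s * s))).map
          fun t => (k / s * s + t, z)).reverse) := by
  have hfold := foldl_forward (k / s * s, MapReduce.groupSize s M (k / s * s)) inbox []
  rw [List.append_nil] at hfold
  rw [← hfold]
  simp only [step, gather, eval_prim, eval_comp, eval_pair, eval_ite, eval_fold, eval_ownGroup,
    Prim.eval]
  rfl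

lemma eval_step_receive :
    step.eval ((((k, M, n, m, s), els, wts), X, E, θ, (4 : ℕ), q), inbox, words) =
      ((((k, M, n, m, s), els, wts), (inbox.map Prod.fst).flatten, E, θ, (2 : ℕ), q * s),
        []) := by
  simp only [step, receive, eval_prim, eval_comp, eval_pair, eval_ite, eval_map_fst, eval_flatten,
    Prim.eval]
  rfl

end Eval

/-! ## The cost of the algorithm -/

lemma size_append_le (B : ℕ) (a : Ty) {l l' : List a.den} {x y : ℕ}
    (h : (list a).size B l ≤ x) (h' : (list a).size B l' ≤ y + 1) :
    (list a).size B (l ++ l') ≤ x + y := by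
  have := size_append B a l l'
  omega

lemma size_scatterMessage (B d i : ℕ) :
    (prod nat messageTy).size B (d, [i], []) = nat.size B d + nat.size B i + 2 := by
  simp [Ty.size]
  omega

lemma efficientOn_scatter : EfficientOn (fun B _ (x : stepInputTy.den) =>
    ∀ i ∈ getChosen.eval x,
      (scatterGroup.eval x).1 + i % (scatterGroup.eval x).2 < B ^ 2) scatter := by
  have messages : EfficientOn (fun B _ (x : (prod (prod nat nat) (list nat)).den) =>
      ∀ i ∈ x.2, x.1.1 + i % x.1.2 < B ^ 2) (mapEnv scatterMessage) := by
    refine efficientOn_mapEnv 5 fun B N x _ _ hx i hi => ?_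
    have haddr := size_nat_le (hx i hi) two_ne_zero
    have hone := one_le_size B nat i
    rw [eval_scatterMessage]
    refine (size_scatterMessage B _ _).le.trans ?_
    simp only at haddr ⊢
    omega
  refine (Efficient.on _ _).ite (Efficient.on _ _) ((Efficient.on _ _).pair
    ((Efficient.on _ _).comp messages fun B N x _ _ hx _ _ => ?_))
  simpa only [eval_pair] using hx.1

lemma size_map_address_le {B g : ℕ} {x : ℕ} (hx : x + g ≤ B ^ 2) (z : messageTy.den)
    {l : List ℕ} (hl : ∀ t ∈ l, t < g) :
    (list (prod nat messageTy)).size B (l.map fun t => (x + t, z)) ≤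
      l.length * (3 * messageTy.size B z) + 1 := by
  refine (size_list_le B _ (k := 3 * messageTy.size B z) ?_).trans (by rw [List.length_map])
  simp only [List.mem_map, forall_exists_index, and_imp]
  rintro _ t ht rfl
  have haddr : nat.size B (x + t) ≤ 2 := size_nat_le (by have := hl t ht; omega) two_ne_zero
  have hone := one_le_size B messageTy z
  simp only [size_prod] at haddr hone ⊢
  omega

lemma size_flatMap_address_le {B g : ℕ} {x : ℕ} (hx : x + g ≤ B ^ 2) (l : List messageTy.den) :
    (list (prod nat messageTy)).size B
        (l.flatMap fun z => (List.range g).map fun t => (x + t, z)) ≤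
      3 * (g * ((list messageTy).size B l - 1)) + 1 := by
  induction l with
  | nil => exact Nat.le_add_left 1 _
  | cons z l ih =>
    have hz := size_map_address_le hx z (l := List.range g) (by simp)
    rw [List.length_range] at hz
    rw [size_cons, List.flatMap_cons]
    refine (size_append_le B (prod nat messageTy) hz ih).trans ?_
    rw [Nat.add_sub_assoc (one_le_size B (list messageTy) l), mul_add, mul_add]
    have : g * (3 * messageTy.size B z) = 3 * (g * messageTy.size B z) := by ring
    omega

lemma efficientOn_forward : EfficientOn
    (fun B N (x : (prod (prod nat nat) (prod messageTy (list (prod nat messageTy)))).den) =>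
      x.1.1 + x.1.2 ≤ B ^ 2 ∧ x.1.2 * messageTy.size B x.2.1 ≤ N) forward := by
  have messages : EfficientOn
      (fun B N (x : (prod (prod nat messageTy) (prod nat (list (prod nat messageTy)))).den) =>
        x.1.1 + x.2.1 ≤ B ^ 2 ∧ x.2.1 * messageTy.size B x.1.2 ≤ N)
      (loop (bin .cons (pair (bin .add (π₁ ⊳ π₁) (π₂ ⊳ π₁)) (π₁ ⊳ π₂)) (π₂ ⊳ π₂))) := by
    refine EfficientOn.loop (Efficient.on _ fun _ _ _ => True) 4 ?_
    rintro B N ⟨⟨y, z⟩, g, acc⟩ - hN ⟨haddr, hmul⟩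
    replace haddr : y + g ≤ B ^ 2 := haddr
    replace hmul : g * messageTy.size B z ≤ N := hmul
    rw [size_prod, size_prod B nat messageTy, size_prod B nat] at hN
    dsimp only at hN
    have hg : g ≤ N := (Nat.le_mul_of_pos_right g (one_le_size B messageTy z)).trans hmul
    refine ⟨hg.trans (Nat.le_mul_of_pos_left N four_pos),
      fun l₁ t l₂ hl => ⟨?_, fun _ _ => trivial⟩⟩
    have hlen : l₁.length ≤ g := by
      have := congrArg List.length hl
      simp only [List.length_range, List.length_append] at this
      omega
    have hnew := size_map_address_le haddr z (l := l₁) fun t' ht' => by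
      rw [← List.mem_range, hl]
      simp [ht']
    have hsize : l₁.length * (3 * messageTy.size B z) ≤ 3 * N :=
      calc l₁.length * (3 * messageTy.size B z) = 3 * (l₁.length * messageTy.size B z) := by ring
        _ ≤ 3 * N := Nat.mul_le_mul_left 3 ((Nat.mul_le_mul_right _ hlen).trans hmul)
    have hfold := foldl_map_cons (fun t : ℕ => (y + t, z)) l₁ acc
    simp only [eval_prim, eval_comp, eval_pair, Prim.eval] at hfold ⊢
    rw [hfold]
    refine (size_append_le B (prod nat messageTy) (x := 3 * N + 1)
      (y := (list (prod nat messageTy)).size B acc)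
      ((size_perm B _ (List.reverse_perm _)).le.trans
        (hnew.trans (Nat.succ_le_succ hsize))) (Nat.le_succ _)).trans ?_
    have := one_le_size B nat y
    omega
  refine (Efficient.on _ _).comp messages fun B N x _ _ hx N' hle => ?_
  simp only [eval_pair, eval_comp, eval_prim, Prim.eval]
  exact ⟨hx.1, hx.2.trans hle⟩

lemma efficientOn_fold_forward : EfficientOn
    (fun B N (x : (prod (prod nat nat) (prod (list messageTy)
        (list (prod nat messageTy)))).den) =>
      x.1.1 + x.1.2 ≤ B ^ 2 ∧ x.1.2 * ((list messageTy).size B x.2.1 - 1) ≤ N)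
    (fold forward) := by
  refine efficientOn_forward.fold 4 ?_
  rintro B N ⟨⟨y, g⟩, l, acc⟩ - hN ⟨haddr, hmul⟩ l₁ z l₂ hl
  replace hmul : g * ((list messageTy).size B l - 1) ≤ N := hmul
  rw [size_prod, size_prod B nat nat, size_prod B (list messageTy)] at hN
  dsimp only at hN
  obtain rfl : l = l₁ ++ z :: l₂ := hl
  have hsplit := size_append B messageTy l₁ (z :: l₂)
  have hcons := size_cons B messageTy z l₂
  have hone := one_le_size B (list messageTy) l₁
  have hone' := one_le_size B (list messageTy) l₂
  constructor
  · have hnew := size_flatMap_address_le haddr l₁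
    have hmono : g * ((list messageTy).size B l₁ - 1) ≤ N :=
      (Nat.mul_le_mul_left g (by omega)).trans hmul
    rw [foldl_forward]
    refine (size_append_le B (prod nat messageTy) (x := 3 * N + 1)
      (y := (list (prod nat messageTy)).size B acc)
      ((size_perm B _ (List.reverse_perm _)).le.trans
        (hnew.trans (Nat.succ_le_succ (Nat.mul_le_mul_left 3 hmono)))) (Nat.le_succ _)).trans ?_
    have := one_le_size B nat y
    omega
  · have hz : messageTy.size B z ≤ (list messageTy).size B (l₁ ++ z :: l₂) - 1 := by omega
    exact fun N' hN' => ⟨haddr, ((Nat.mul_le_mul_left g hz).trans hmul).trans hN'⟩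

lemma efficientOn_gather : EfficientOn (fun B N (x : stepInputTy.den) =>
    (ownGroup.eval x).1 + (ownGroup.eval x).2 ≤ B ^ 2 ∧
      (ownGroup.eval x).2 * ((list messageTy).size B (getInbox.eval x) - 1) ≤ N) gather := by
  refine (Efficient.on _ _).pair ((Efficient.on _ _).comp efficientOn_fold_forward
    fun B N x _ _ hx N' hle => ?_)
  simp only [eval_pair]
  exact ⟨hx.1, hx.2.trans hle⟩

/-- The addresses of the messages fit into two words, and their total size is linear in `N`. -/
structure Admissible (B N : ℕ) (x : stepInputTy.den) : Prop where
  scatter : getMode.eval x = (2 : ℕ) → ∀ i ∈ getChosen.eval x,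
    (scatterGroup.eval x).1 + i % (scatterGroup.eval x).2 < B ^ 2
  gather : getMode.eval x = (3 : ℕ) → (ownGroup.eval x).1 + (ownGroup.eval x).2 ≤ B ^ 2 ∧
    (ownGroup.eval x).2 * ((list messageTy).size B (getInbox.eval x) - 1) ≤ N

lemma eval_le_num_eq_zero {p : Code a nat} {k : ℕ} {x : a.den} :
    (bin .le p (num k)).eval x = (0 : ℕ) ↔ k < p.eval x := by
  simp

instance : Efficient sample := by unfold sample; infer_instance
instance : Efficient nextThreshold := by unfold nextThreshold; infer_instance
instance : Efficient updateChosen := by unfold updateChosen; infer_instance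
instance : Efficient receive := by unfold receive; infer_instance
instance : Efficient init := by unfold init; infer_instance

theorem efficientOn_step : EfficientOn Admissible step := by
  refine (Efficient.on _ _).ite ((Efficient.on _ _).ite (Efficient.on _ _)
    ((Efficient.on _ _).ite (efficientOn_scatter.mono ?_)
      ((Efficient.on _ _).ite (efficientOn_gather.mono ?_) (Efficient.on _ _)))) (Efficient.on _ _)
  · rintro B N x ⟨⟨⟨hx, -⟩, h1⟩, h2⟩
    rw [eval_le_num_eq_zero] at h1
    rw [ne_eq, eval_le_num_eq_zero, not_lt] at h2
    exact hx.scatter (le_antisymm h2 h1)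
  · rintro B N x ⟨⟨⟨⟨hx, -⟩, -⟩, h2⟩, h3⟩
    rw [eval_le_num_eq_zero] at h2
    rw [ne_eq, eval_le_num_eq_zero, not_lt] at h3
    exact hx.gather (le_antisymm h3 h2)

end Code

/-! ## Analysis of the local ratio method -/

section SetsOf

variable {n m : ℕ} (I : SetCover n m)

/-- The sets that contain `j`, as the list in which `j` is stored on its machine. -/
def setsOf (j : Fin m) : List ℕ :=
  ((List.finRange n).filter fun i => decide (i ∈ I.T j)).map (fun i : Fin n => (i : ℕ))

lemma mem_setsOf {j : Fin m} {k : ℕ} : k ∈ setsOf I j ↔ ∃ i ∈ I.T j, (i : ℕ) = k := by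
  simp [setsOf]

@[simp] lemma coe_mem_setsOf {j : Fin m} {i : Fin n} : (i : ℕ) ∈ setsOf I j ↔ j ∈ I.S i := by
  simp [mem_setsOf, Fin.val_inj]

lemma setsOf_ne_nil (j : Fin m) : setsOf I j ≠ [] := by
  obtain ⟨i, hi⟩ := I.feasible j
  exact List.ne_nil_of_mem ((coe_mem_setsOf I).2 hi)

lemma length_setsOf (j : Fin m) : (setsOf I j).length = #(I.T j) := by
  rw [setsOf, List.length_map,
    ← List.toFinset_card_of_nodup ((List.nodup_finRange n).filter _)]
  congr 1
  ext i
  simp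

end SetsOf

namespace LocalRatio

lemma minResidual_concat (T : List ℕ) (res : List (ℕ × ℝ)) (z : ℕ × ℝ) [Decidable (z.1 ∈ T ∧
    ((minResidual T res).1 = 0 ∨ z.2 ≤ (minResidual T res).2))] :
    minResidual T (res ++ [z]) =
      if z.1 ∈ T ∧ ((minResidual T res).1 = 0 ∨ z.2 ≤ (minResidual T res).2) then (1, z.2)
      else minResidual T res := by
  simp only [minResidual, List.foldl_append, List.foldl_cons, List.foldl_nil]
  congr

lemma minResidual_spec (T : List ℕ) (res : List (ℕ × ℝ)) :
    (minResidual T res = (0, 0) ∧ ∀ z ∈ res, z.1 ∉ T) ∨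
      ((minResidual T res).1 = 1 ∧
        IsLeast {x | ∃ i ∈ T, (i, x) ∈ res} (minResidual T res).2) := by
  classical
  induction res using List.reverseRecOn with
  | nil => exact Or.inl ⟨rfl, by simp⟩
  | append_singleton res z ih =>
    rw [minResidual_concat]
    have hset : {x | ∃ i ∈ T, (i, x) ∈ res ++ [z]} =
        {x | ∃ i ∈ T, (i, x) ∈ res} ∪ {x | z.1 ∈ T ∧ x = z.2} := by
      ext x
      simp only [List.mem_append, List.mem_singleton, Set.mem_ofPred_eq, Set.mem_union,
        and_or_left, exists_or]
      refine or_congr_right ⟨?_, fun h => ⟨z.1, h.1, by rw [h.2]⟩⟩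
      rintro ⟨i, hi, rfl⟩
      exact ⟨hi, rfl⟩
    rw [hset]
    by_cases hz : z.1 ∈ T
    · right
      simp only [hz, true_and, Set.ofPred_eq_eq_singleton]
      rcases ih with ⟨heq, hnone⟩ | ⟨hflag, hleast⟩
      · have hempty : {x | ∃ i ∈ T, (i, x) ∈ res} = ∅ :=
          Set.eq_empty_of_forall_notMem fun x ⟨i, hi, hx⟩ => hnone _ hx hi
        simp [heq, hempty]
      · have hunion := hleast.union (isLeast_singleton (a := z.2))
        by_cases hle : z.2 ≤ (minResidual T res).2
        · rw [if_pos (Or.inr hle)]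
          exact ⟨rfl, by rwa [min_eq_right hle] at hunion⟩
        · rw [if_neg (by simp [hflag, hle])]
          exact ⟨hflag, by rwa [min_eq_left (not_le.1 hle).le] at hunion⟩
    · simpa [hz, or_imp, forall_and] using ih

lemma process_nil (y : List (ℕ × ℝ) × List (List ℕ)) : process y [] = y := by
  rw [process, if_pos]
  rcases minResidual_spec [] y.1 with h | ⟨-, ⟨i, hi, -⟩, -⟩
  · rw [h.1]
  · simp at hi

/-- The residual weights and the recorded elements (last one first) after the elements in `L` have
been processed, starting from the weights `W`. -/
noncomputable def run (W : List (ℕ × ℝ)) (L : List (List ℕ)) : List (ℕ × ℝ) × List (List ℕ) :=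
  L.foldl process (W, [])

lemma run_append (W : List (ℕ × ℝ)) (L L' : List (List ℕ)) :
    run W (L ++ L') = L'.foldl process (run W L) := List.foldl_append

lemma run_reverse_run_snd (W : List (ℕ × ℝ)) (L : List (List ℕ)) :
    run W (run W L).2.reverse = run W L := by
  induction L using List.reverseRecOn with
  | nil => rfl
  | append_singleton L T ih =>
    rw [run_append, List.foldl_cons, List.foldl_nil]
    by_cases hzero : (minResidual T (run W L).1).2 ≤ 0
    · rw [process, if_pos hzero, ih]
    · have hcons : (process (run W L) T).2 = T :: (run W L).2 := by rw [process, if_neg hzero]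
      rw [hcons, List.reverse_cons, run_append, ih]
      rfl

open Classical in
/-- The indices of the sets whose residual weight has vanished. -/
noncomputable def vanishing (res : List (ℕ × ℝ)) : List ℕ :=
  (res.filter fun z => z.2 ≤ 0).map Prod.fst

section Entries

variable {n : ℕ}

/-- The weights `r`, listed with their indices in a given order (in which the weights arrive at
machine `0`). -/
def entries (order : List (Fin n)) (r : Fin n → ℝ) : List (ℕ × ℝ) :=
  order.map fun i : Fin n => ((i : ℕ), r i)

lemma mk_mem_entries {order : List (Fin n)} (r : Fin n → ℝ) {i : Fin n} {x : ℝ} :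
    ((i : ℕ), x) ∈ entries order r ↔ i ∈ order ∧ r i = x := by
  simp [entries, Fin.val_inj]

lemma mem_vanishing_entries {order : List (Fin n)} (horder : ∀ i, i ∈ order) (r : Fin n → ℝ)
    {k : ℕ} : k ∈ vanishing (entries order r) ↔ ∃ i : Fin n, (i : ℕ) = k ∧ r i ≤ 0 := by
  simp [vanishing, entries, horder, and_comm]

lemma nodup_vanishing_entries {order : List (Fin n)} (horder : order.Nodup) (r : Fin n → ℝ) :
    (vanishing (entries order r)).Nodup := by
  have hsublist : (vanishing (entries order r)).Sublist ((entries order r).map Prod.fst) :=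
    List.filter_sublist.map Prod.fst
  refine hsublist.nodup ?_
  rw [entries, List.map_map]
  exact horder.map Fin.val_injective

end Entries

variable {n m : ℕ}

section Subtract

variable (I : SetCover n m)

/-- The residual weights after subtracting `ε` from those of the sets that contain `j`. -/
def subtract (j : Fin m) (ε : ℝ) (r : Fin n → ℝ) : Fin n → ℝ :=
  fun i => if j ∈ I.S i then r i - ε else r i

lemma lower_entries (order : List (Fin n)) (j : Fin m) (ε : ℝ) (r : Fin n → ℝ) :
    lower (setsOf I j) ε (entries order r) = entries order (subtract I j ε r) := by
  simp only [lower, entries, List.map_map]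
  refine List.map_congr_left fun i _ => ?_
  simp only [Function.comp, coe_mem_setsOf, subtract]
  split_ifs <;> rfl

lemma subtract_le (j : Fin m) {ε : ℝ} (hε : 0 ≤ ε) (r : Fin n → ℝ) (i : Fin n) :
    subtract I j ε r i ≤ r i := by
  rw [subtract]
  split_ifs <;> linarith

lemma sum_sub_subtract (j : Fin m) (ε : ℝ) (r : Fin n → ℝ) (Y : Finset (Fin n)) :
    ∑ i ∈ Y, (I.w i - subtract I j ε r i) =
      ∑ i ∈ Y, (I.w i - r i) + #{i ∈ Y | j ∈ I.S i} * ε := by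
  rw [← nsmul_eq_mul, ← sum_const, sum_filter, ← sum_add_distrib]
  refine sum_congr rfl fun i _ => ?_
  rw [subtract]
  split_ifs <;> ring

end Subtract

/-- The local ratio invariant: `y.1` lists the residual weights `r`, the weight subtracted so far is
at most `f * D`, and every cover has lost at least `D`. -/
structure Invariant (I : SetCover n m) (order : List (Fin n))
    (y : List (ℕ × ℝ) × List (List ℕ)) (r : Fin n → ℝ) (D : ℝ) : Prop where
  eq_entries : y.1 = entries order r
  nonneg : ∀ i, 0 ≤ r i
  le_weight : ∀ i, r i ≤ I.w i
  sum_le : ∑ i, (I.w i - r i) ≤ I.maxFreq * D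
  le_sum : ∀ Y, I.IsCover Y → D ≤ ∑ i ∈ Y, (I.w i - r i)
  length_le : y.2.length ≤ #{i | r i ≤ 0}
  recorded : ∀ T ∈ y.2, ∃ j, T = setsOf I j

namespace Invariant

variable {I : SetCover n m} {order : List (Fin n)} {y : List (ℕ × ℝ) × List (List ℕ)}
  {r : Fin n → ℝ} {D : ℝ}

lemma init (I : SetCover n m) (order : List (Fin n)) :
    Invariant I order (entries order I.w, []) I.w 0 where
  eq_entries := rfl
  nonneg i := (I.w_pos i).le
  le_weight _ := le_rfl
  sum_le := by simp
  le_sum := by simp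
  length_le := Nat.zero_le _
  recorded := by simp

lemma subtract (h : Invariant I order y r D) {j : Fin m} {i₀ : Fin n} (hi₀ : j ∈ I.S i₀)
    (hpos : 0 < r i₀) (hmin : ∀ i, j ∈ I.S i → r i₀ ≤ r i) :
    Invariant I order (lower (setsOf I j) (r i₀) y.1, setsOf I j :: y.2)
      (LocalRatio.subtract I j (r i₀) r) (D + r i₀) where
  eq_entries := by rw [h.eq_entries, lower_entries]
  nonneg i := by
    rw [LocalRatio.subtract]
    split_ifs with hi
    · exact sub_nonneg.2 (hmin i hi)
    · exact h.nonneg i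
  le_weight i := (subtract_le I j hpos.le r i).trans (h.le_weight i)
  sum_le := by
    rw [sum_sub_subtract, mul_add]
    have hfreq : (#{i | j ∈ I.S i} : ℝ) ≤ I.maxFreq := mod_cast I.card_T_le_maxFreq j
    exact add_le_add h.sum_le (mul_le_mul_of_nonneg_right hfreq hpos.le)
  le_sum Y hY := by
    rw [sum_sub_subtract]
    obtain ⟨i, hi, hij⟩ := hY j
    have hcard : (1 : ℝ) ≤ #{i ∈ Y | j ∈ I.S i} := by
      exact_mod_cast card_pos.2 ⟨i, by simp [hi, hij]⟩
    exact add_le_add (h.le_sum Y hY) (le_mul_of_one_le_left hpos.le hcard)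
  length_le := by
    refine Nat.succ_le_of_lt (h.length_le.trans_lt (card_lt_card ?_))
    refine Finset.ssubset_iff_of_subset (monotone_filter_right _ fun i _ hi =>
      (subtract_le I j hpos.le r i).trans hi) |>.2 ⟨i₀, ?_, ?_⟩
    · exact mem_filter.2 ⟨mem_univ _, by simp [LocalRatio.subtract, hi₀]⟩
    · simpa using hpos
  recorded := by
    rintro T (- | ⟨_, hT⟩)
    · exact ⟨j, rfl⟩
    · exact h.recorded T hT

lemma process (horder : ∀ i, i ∈ order) (h : Invariant I order y r D) (j : Fin m) :
    ∃ r' D', Invariant I order (LocalRatio.process y (setsOf I j)) r' D' ∧ (∀ i, r' i ≤ r i) ∧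
      ∃ i, j ∈ I.S i ∧ r' i ≤ 0 := by
  have hmem {i : Fin n} : ((i : ℕ), r i) ∈ y.1 := by
    rw [h.eq_entries, mk_mem_entries]
    exact ⟨horder i, rfl⟩
  rcases minResidual_spec (setsOf I j) y.1 with ⟨-, hnone⟩ | ⟨-, hleast⟩
  · obtain ⟨i, hi⟩ := I.feasible j
    exact absurd ((coe_mem_setsOf I).2 hi) (hnone _ hmem)
  obtain ⟨i₀, hi₀, hr⟩ : ∃ i₀, j ∈ I.S i₀ ∧ r i₀ = (minResidual (setsOf I j) y.1).2 := by
    obtain ⟨_, hk, hres⟩ := hleast.1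
    obtain ⟨i, hi, rfl⟩ := (mem_setsOf I).1 hk
    rw [h.eq_entries, mk_mem_entries] at hres
    exact ⟨i, I.mem_T.1 hi, by rw [h.eq_entries, hres.2]⟩
  have hmin (i : Fin n) (hi : j ∈ I.S i) : r i₀ ≤ r i :=
    hr.trans_le (hleast.2 ⟨i, (coe_mem_setsOf I).2 hi, hmem⟩)
  rw [LocalRatio.process, ← hr]
  rcases le_or_gt (r i₀) 0 with hzero | hpos
  · rw [if_pos hzero]
    exact ⟨r, D, h, fun _ => le_rfl, i₀, hi₀, hzero⟩
  · rw [if_neg hpos.not_ge]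
    exact ⟨_, _, h.subtract hi₀ hpos hmin, subtract_le I j hpos.le r, i₀, hi₀,
      by simp [LocalRatio.subtract, hi₀]⟩

lemma foldl_process (horder : ∀ i, i ∈ order) {L : List (List ℕ)}
    (hL : ∀ T ∈ L, T = [] ∨ ∃ j, T = setsOf I j) (h : Invariant I order y r D) :
    ∃ r' D', Invariant I order (L.foldl LocalRatio.process y) r' D' ∧ (∀ i, r' i ≤ r i) ∧
      ∀ j, setsOf I j ∈ L → ∃ i, j ∈ I.S i ∧ r' i ≤ 0 := by
  induction L generalizing y r D with
  | nil => exact ⟨r, D, h, fun _ => le_rfl, by simp⟩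
  | cons T L ih =>
    rw [List.forall_mem_cons] at hL
    rw [List.foldl_cons]
    rcases hL.1 with rfl | ⟨j₀, rfl⟩
    · rw [process_nil]
      obtain ⟨r', D', hinv, hle, hzero⟩ := ih hL.2 h
      exact ⟨r', D', hinv, hle, fun j hj =>
        hzero j (List.mem_of_ne_of_mem (setsOf_ne_nil I j) hj)⟩
    · obtain ⟨r₁, D₁, hinv₁, hle₁, i, hi, hri⟩ := h.process horder j₀
      obtain ⟨r', D', hinv, hle, hzero⟩ := ih hL.2 hinv₁
      refine ⟨r', D', hinv, fun i => (hle i).trans (hle₁ i), fun j hj => ?_⟩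
      rcases List.mem_cons.1 hj with heq | hj
      · exact ⟨i, by rwa [← coe_mem_setsOf, heq, coe_mem_setsOf], (hle i).trans hri⟩
      · exact hzero j hj

lemma isApprox (h : Invariant I order y r D) {X : Finset (Fin n)} (hX : ∀ i, i ∈ X ↔ r i ≤ 0)
    (hcover : ∀ j, ∃ i, j ∈ I.S i ∧ r i ≤ 0) : I.IsApprox I.maxFreq X := by
  refine ⟨fun j => ?_, fun Y hY => ?_⟩
  · obtain ⟨i, hi, hzero⟩ := hcover j
    exact ⟨i, (hX i).2 hzero, hi⟩
  · calc I.cost X = ∑ i ∈ X, (I.w i - r i) := sum_congr rfl fun i hi => by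
          rw [le_antisymm ((hX i).1 hi) (h.nonneg i), sub_zero]
      _ ≤ ∑ i, (I.w i - r i) := sum_le_sum_of_subset_of_nonneg (subset_univ _)
          fun i _ _ => sub_nonneg.2 (h.le_weight i)
      _ ≤ I.maxFreq * D := h.sum_le
      _ ≤ I.maxFreq * I.cost Y := by
          refine mul_le_mul_of_nonneg_left ((h.le_sum Y hY).trans ?_) (Nat.cast_nonneg _)
          exact sum_le_sum fun i _ => sub_le_self _ (h.nonneg i)

end Invariant

/-! ### Recorded elements -/

/-- `E` is a list of recorded elements: the local ratio method applied to `E` maintains its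
invariant and records all of `E`. -/
structure Recorded (I : SetCover n m) (order : List (Fin n)) (E : List (List ℕ)) : Prop where
  invariant : ∃ r D, Invariant I order (run (entries order I.w) E) r D
  replay : (run (entries order I.w) E).2.reverse = E

/-- The sets chosen after the elements in `E` have been processed. -/
noncomputable def chosen (I : SetCover n m) (order : List (Fin n)) (E : List (List ℕ)) : List ℕ :=
  vanishing (run (entries order I.w) E).1

open Classical in
/-- The elements not covered by the chosen sets. -/
noncomputable def uncovered (I : SetCover n m) (order : List (Fin n)) (E : List (List ℕ)) :
    Finset (Fin m) :=
  {j | ∀ i ∈ setsOf I j, i ∉ chosen I order E}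

/-- The recorded elements after the elements in `F` have been processed on top of those in `E`. -/
noncomputable def record (I : SetCover n m) (order : List (Fin n)) (E F : List (List ℕ)) :
    List (List ℕ) :=
  (run (entries order I.w) (E ++ F)).2.reverse

variable {I : SetCover n m} {order : List (Fin n)} {E F : List (List ℕ)}

lemma run_record : run (entries order I.w) (record I order E F) =
    F.foldl process (run (entries order I.w) E) :=
  (run_reverse_run_snd _ _).trans (run_append _ _ _)

lemma Invariant.mem_chosen (horder : ∀ i, i ∈ order) {r : Fin n → ℝ} {D : ℝ}
    (h : Invariant I order (run (entries order I.w) E) r D) {k : ℕ} :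
    k ∈ chosen I order E ↔ ∃ i : Fin n, (i : ℕ) = k ∧ r i ≤ 0 := by
  rw [chosen, h.eq_entries, mem_vanishing_entries horder]

lemma Invariant.mem_uncovered (horder : ∀ i, i ∈ order) {r : Fin n → ℝ} {D : ℝ}
    (h : Invariant I order (run (entries order I.w) E) r D) {j : Fin m} :
    j ∈ uncovered I order E ↔ ∀ i, j ∈ I.S i → ¬ r i ≤ 0 := by
  simp [uncovered, mem_setsOf, h.mem_chosen horder, Fin.val_inj]

lemma chosen_nil (horder : ∀ i, i ∈ order) : chosen I order [] = [] := by
  refine List.eq_nil_iff_forall_not_mem.2 fun k hk => ?_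
  obtain ⟨i, -, hzero⟩ := ((Invariant.init I order).mem_chosen (E := []) horder).1 hk
  exact hzero.not_gt (I.w_pos i)

namespace Recorded

lemma nil (I : SetCover n m) (order : List (Fin n)) : Recorded I order [] :=
  ⟨⟨_, _, Invariant.init I order⟩, rfl⟩

lemma record (horder : ∀ i, i ∈ order) (h : Recorded I order E)
    (hF : ∀ T ∈ F, T = [] ∨ ∃ j, T = setsOf I j) : Recorded I order (record I order E F) := by
  obtain ⟨r, D, hinv⟩ := h.invariant
  obtain ⟨r', D', hinv', -, -⟩ := hinv.foldl_process horder hF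
  refine ⟨⟨r', D', by rwa [run_record]⟩, ?_⟩
  rw [run_record, ← run_append]
  rfl

lemma uncovered_record_subset (horder : ∀ i, i ∈ order) (h : Recorded I order E)
    (hF : ∀ T ∈ F, T = [] ∨ ∃ j, T = setsOf I j) :
    uncovered I order (LocalRatio.record I order E F) ⊆
      {j ∈ uncovered I order E | setsOf I j ∉ F} := by
  obtain ⟨r, D, hinv⟩ := h.invariant
  obtain ⟨r', D', hinv', hle, hzero⟩ := hinv.foldl_process horder hF
  rw [← run_record] at hinv'
  intro j hj
  rw [hinv'.mem_uncovered horder] at hj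
  rw [mem_filter, hinv.mem_uncovered horder]
  refine ⟨fun i hi hri => hj i hi ((hle i).trans hri), fun hjF => ?_⟩
  obtain ⟨i, hi, hri⟩ := hzero j hjF
  exact hj i hi hri

lemma length_le (h : Recorded I order E) : E.length ≤ n := by
  obtain ⟨r, D, hinv⟩ := h.invariant
  have hlen := hinv.length_le
  rw [← List.length_reverse, h.replay] at hlen
  exact hlen.trans (card_finset_fin_le _)

lemma exists_eq_setsOf (h : Recorded I order E) {T : List ℕ} (hT : T ∈ E) :
    ∃ j, T = setsOf I j := by
  obtain ⟨r, D, hinv⟩ := h.invariant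
  rw [← h.replay, List.mem_reverse] at hT
  exact hinv.recorded T hT

lemma nodup_chosen (horder : order.Nodup) (h : Recorded I order E) :
    (chosen I order E).Nodup := by
  obtain ⟨r, D, hinv⟩ := h.invariant
  rw [chosen, hinv.eq_entries]
  exact nodup_vanishing_entries horder r

lemma lt_of_mem_chosen (horder : ∀ i, i ∈ order) (h : Recorded I order E) {k : ℕ}
    (hk : k ∈ chosen I order E) : k < n := by
  obtain ⟨r, D, hinv⟩ := h.invariant
  obtain ⟨i, rfl, -⟩ := (hinv.mem_chosen horder).1 hk
  exact i.2

lemma isApprox (horder : ∀ i, i ∈ order) (h : Recorded I order E)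
    (hcover : uncovered I order E = ∅) {X : Finset (Fin n)}
    (hX : ∀ i : Fin n, i ∈ X ↔ (i : ℕ) ∈ chosen I order E) : I.IsApprox I.maxFreq X := by
  obtain ⟨r, D, hinv⟩ := h.invariant
  refine hinv.isApprox (fun i => ?_) fun j => ?_
  · simp [hX, hinv.mem_chosen horder, Fin.val_inj]
  · have hj : j ∉ uncovered I order E := by simp [hcover]
    simpa only [hinv.mem_uncovered horder, not_forall, not_not, exists_prop] using hj

end Recorded

end LocalRatio

/-! ## The rounds of the algorithm -/

section Deliver

variable {α : Type}

/-- The messages for machine `k` in a list of messages with recipients. -/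
def deliver (k : ℕ) (l : List (ℕ × α)) : List α := (l.filter fun z => decide (z.1 = k)).map Prod.snd

lemma deliver_append (k : ℕ) (l l' : List (ℕ × α)) :
    deliver k (l ++ l') = deliver k l ++ deliver k l' := by
  simp only [deliver, List.filter_append, List.map_append]

lemma deliver_map_const (k i : ℕ) (l : List α) :
    deliver k (l.map fun z => (i, z)) = if i = k then l else [] := by
  split_ifs with h <;> simp [deliver, List.filter_map, Function.comp_def, h]

lemma deliver_broadcast (k b g : ℕ) (l : List α) :
    deliver k (l.flatMap fun z => (List.range g).map fun t => (b + t, z)).reverse =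
      if b ≤ k ∧ k < b + g then l.reverse else [] := by
  have hsingle (z : α) : deliver k ((List.range g).map fun t => (b + t, z)) =
      if b ≤ k ∧ k < b + g then [z] else [] := by
    induction g with
    | zero => simp [deliver]
    | succ g ih =>
      rw [List.range_succ, List.map_append, deliver_append, ih]
      by_cases hlast : b + g = k
      · rw [if_neg (by omega), if_pos (by omega)]
        simp [deliver, hlast]
      · have hiff : b ≤ k ∧ k < b + (g + 1) ↔ b ≤ k ∧ k < b + g := by omega
        simp [deliver, hlast, hiff]
  simp only [deliver, List.filter_reverse, List.map_reverse, List.filter_flatMap,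
    List.map_flatMap] at hsingle ⊢
  simp only [hsingle]
  split_ifs <;> simp

lemma flatMap_finRange_eq {M : ℕ} (f : Fin M → List α) (i : Fin M) (h : ∀ j, j ≠ i → f j = []) :
    (List.finRange M).flatMap f = f i := by
  have hnodup (l : List (Fin M)) (hl : l.Nodup) : l.flatMap f = if i ∈ l then f i else [] := by
    induction l with
    | nil => rfl
    | cons j l ih =>
      rw [List.nodup_cons] at hl
      rw [List.flatMap_cons, ih hl.2]
      by_cases hj : j = i
      · subst hj
        simp [hl.1]
      · simp [h j hj, Ne.symm hj]
  rw [hnodup _ (List.nodup_finRange M), if_pos (List.mem_finRange i)]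

end Deliver

lemma next_eq {P : Algorithm} {M : ℕ} {C C' : Config P M} {ρ : Fin M → List ℕ}
    {out : Fin M → List (ℕ × P.msg.den)}
    (hstep : ∀ k, P.step.eval (C.state k, C.inbox k, ρ k) = (C'.state k, out k))
    (hinbox : ∀ k : Fin M, (List.finRange M).flatMap (fun i => deliver k (out i)) = C'.inbox k) :
    P.next C ρ = C' := by
  obtain ⟨state', inbox'⟩ := C'
  simp only [Algorithm.next, Algorithm.stepInput, hstep, Config.mk.injEq, true_and]
  exact funext hinbox

section Indices

variable {p M : ℕ} (f : Fin p → Fin M)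

/-- The indices below `p`, sorted by the machines that they are assigned to. -/
def byMachine : List (Fin p) :=
  (List.finRange M).flatMap fun k => (List.finRange p).filter fun j => decide (f j = k)

lemma mem_byMachine (j : Fin p) : j ∈ byMachine f := by
  simp [byMachine]

lemma nodup_byMachine : (byMachine f).Nodup := by
  rw [byMachine, List.nodup_flatMap]
  refine ⟨fun k _ => (List.nodup_finRange p).filter _, ?_⟩
  refine (List.nodup_finRange M).imp fun {k k'} hne j hk hk' => hne ?_
  simp only [List.mem_filter, decide_eq_true_eq] at hk hk'
  exact hk.2.symm.trans hk'.2

lemma length_byMachine : (byMachine f).length = p := by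
  rw [← List.toFinset_card_of_nodup (nodup_byMachine f),
    Finset.eq_univ_of_forall fun j => List.mem_toFinset.2 (mem_byMachine f j), Finset.card_univ,
    Fintype.card_fin]

end Indices

variable {n m s : ℕ}

/-- The elements on machine `k`. -/
def storedElements (H : Placement n m s) (k : Fin (numMachines m s)) : List (Fin m) :=
  (List.finRange m).filter fun j => decide (H.elt j = k)

section Instance

variable (I : SetCover n m) (H : Placement n m s)

/-- The elements on machine `k`, each with the sets that contain it. -/
def elementData (k : Fin (numMachines m s)) : List (ℕ × List ℕ) :=
  (storedElements H k).map fun j : Fin m => ((j : ℕ), setsOf I j)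

/-- The weights on machine `k`. -/
def weightData (k : Fin (numMachines m s)) : List (ℕ × ℝ) :=
  entries ((List.finRange n).filter fun i => decide (H.set i = k)) I.w

lemma localInput_eq (k : Fin (numMachines m s)) : localInput I H k =
    (((k : ℕ), numMachines m s, n, m, s), elementData I H k, weightData I H k) := rfl

/-- The order in which the weights arrive at machine `0`. -/
abbrev order : List (Fin n) := byMachine H.set

/-- The position, among the random words of its machine, of the word that belongs to `j`. -/
def wordIndex (j : Fin m) : ℕ := rank (elementData I H (H.elt j)) j

/-- The random word in `ρ` that belongs to `j` is below `θ`. -/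
abbrev HasLowWord (ρ : Fin (numMachines m s) → List ℕ) (θ : ℕ) (j : Fin m) : Prop :=
  (ρ (H.elt j)).getD (wordIndex I H j) 0 < θ

open Classical in
/-- The elements that are sent to machine `0`, for the recorded elements `E`, the threshold `θ` and
the random words `ρ`. -/
noncomputable def sampledSet (E : List (List ℕ)) (θ : ℕ)
    (ρ : Fin (numMachines m s) → List ℕ) : Finset (Fin m) :=
  {j ∈ uncovered I (order H) E | HasLowWord I H ρ θ j}

open Classical in
/-- The messages to machine `0` if the elements in `Q` are sampled. -/
noncomputable def sampleMail (Q : Finset (Fin m)) : List messageTy.den :=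
  (List.finRange (numMachines m s)).flatMap fun k =>
    ((storedElements H k).filter fun j => decide (j ∈ Q)).map (fun j => (setsOf I j, [])) ++
      (weightData I H k).map fun z => ([], [z])

/-- The recorded elements after a phase in which the elements in `Q` are sampled. -/
noncomputable def nextRecorded (E : List (List ℕ)) (Q : Finset (Fin m)) : List (List ℕ) :=
  record I (order H) E ((sampleMail I H Q).map Prod.fst)

/-- The threshold for the next phase. -/
def nextThreshold (n m s θ : ℕ) : ℕ := if n + m + s + 2 ≤ θ then θ else 2 * s * θ / n

variable {I H} in
lemma eq_nil_or_eq_setsOf_of_mem_sampleMail {Q : Finset (Fin m)} {T : List ℕ}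
    (hT : T ∈ (sampleMail I H Q).map Prod.fst) : T = [] ∨ ∃ j, T = setsOf I j := by
  simp only [sampleMail, List.mem_map, List.mem_flatMap, List.mem_append] at hT
  obtain ⟨_, ⟨k, _, ⟨j, _, rfl⟩ | ⟨z, _, rfl⟩⟩, rfl⟩ := hT
  · exact Or.inr ⟨j, rfl⟩
  · exact Or.inl rfl

lemma setsOf_mem_sampleMail {Q : Finset (Fin m)} {j : Fin m} (hj : j ∈ Q) :
    setsOf I j ∈ (sampleMail I H Q).map Prod.fst := by
  simp only [sampleMail, List.mem_map, List.mem_flatMap, List.mem_append]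
  exact ⟨_, ⟨H.elt j, List.mem_finRange _, Or.inl ⟨j, by simp [storedElements, hj], rfl⟩⟩, rfl⟩

lemma flatten_map_snd_sampleMail (Q : Finset (Fin m)) :
    ((sampleMail I H Q).map Prod.snd).flatten = entries (order H) I.w := by
  have hsingle (l : List (ℕ × ℝ)) : (l.map fun z => [z]).flatten = l := by
    induction l with
    | nil => rfl
    | cons z l ih => simp [ih]
  simp only [sampleMail, byMachine, entries, List.map_flatMap, List.map_append, List.map_map]
  rw [List.flatMap, List.flatten_flatten, List.map_map, List.flatMap]
  refine congrArg List.flatten (List.map_congr_left fun k _ => ?_)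
  simpa [Function.comp_def, entries, weightData] using hsingle (weightData I H k)

/-- The configuration with chosen sets `X`, recorded elements `E`, threshold `θ`, the given mode and
number `q` of informed machines, and waiting messages `mail`. -/
def configuration (mode q θ : ℕ) (E : List (List ℕ)) (X : Fin (numMachines m s) → List ℕ)
    (mail : Fin (numMachines m s) → List messageTy.den) :
    Config randomizedLocalRatio (numMachines m s) where
  state k := (localInput I H k, X k, if k = 0 then E else [], θ, mode, q)
  inbox := mail

end Instance

variable {I : SetCover n m} {H : Placement n m s} {q θ : ℕ} {E : List (List ℕ)}
  {X : Fin (numMachines m s) → List ℕ} {mail : Fin (numMachines m s) → List messageTy.den}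
  {ρ : Fin (numMachines m s) → List ℕ}

lemma next_sample (hX : ∀ k, (X k).Perm (chosen I (order H) E)) :
    randomizedLocalRatio.next (configuration I H 0 q θ E X mail) ρ =
      configuration I H 1 q θ E X fun k =>
        if k = 0 then sampleMail I H (sampledSet I H E θ ρ) else [] := by
  classical
  refine next_eq (out := fun k =>
    (((storedElements H k).filter fun j => decide (j ∈ sampledSet I H E θ ρ)).map
      (fun j => (setsOf I j, [])) ++ (weightData I H k).map fun z => ([], [z])).map
        fun z => ((0 : ℕ), z)) (fun k => ?_) fun k => ?_
  · simp only [configuration, localInput_eq]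
    refine (Code.eval_step_sample ..).trans (congrArg (Prod.mk _) ?_)
    rw [List.map_append, List.map_map, List.map_map, elementData, List.filter_map, List.map_map]
    refine congrArg (fun l => List.map _ l ++ _) (List.filter_congr fun j hj => ?_)
    have hjk : H.elt j = k := by simpa [storedElements] using hj
    refine decide_eq_decide.2 ?_
    simp [sampledSet, uncovered, IsSampled, wordIndex, hjk, elementData, (hX k).mem_iff]
  · simp only [deliver_map_const, configuration]
    by_cases hk : k = 0
    · simp only [hk, Fin.val_zero, if_true, sampleMail]
    · rw [if_neg hk]
      simpa using fun _ h => absurd (Fin.ext h.symm) hk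

lemma next_updateChosen {Q : Finset (Fin m)} :
    randomizedLocalRatio.next
        (configuration I H 1 q θ E X fun k => if k = 0 then sampleMail I H Q else []) ρ =
      configuration I H 2 1 (nextThreshold n m s θ) (nextRecorded I H E Q)
        (fun k => if k = 0 then chosen I (order H) (nextRecorded I H E Q) else [])
        fun _ => [] := by
  refine next_eq (out := fun _ => []) (fun k => ?_) fun k => by simp [configuration, deliver]
  simp only [configuration, localInput_eq]
  refine (Code.eval_step_updateChosen ..).trans ?_
  by_cases hk : k = 0
  · simp only [hk, if_true]
    rw [chosen, nextRecorded, run_record, ← run_append, record, run,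
      ← flatten_map_snd_sampleMail I H Q]
    rfl
  · simp only [hk, if_false]
    rfl

/-! ### The relay of the chosen sets -/

/-- The machine that informs the group of machine `k`. -/
def leader (k : Fin (numMachines m s)) : Fin (numMachines m s) :=
  ⟨(k : ℕ) / s, (Nat.div_le_self _ _).trans_lt k.2⟩

/-- The size of the group of machine `k`. -/
def ownGroupSize (k : Fin (numMachines m s)) : ℕ :=
  groupSize s (numMachines m s) ((k : ℕ) / s * s)

/-- The message that carries the index `i`. -/
abbrev indexMessage (i : ℕ) : messageTy.den := ([i], [])

/-- The indices that machine `k` gets from its leader. -/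
def share (X : Fin (numMachines m s) → List ℕ) (k : Fin (numMachines m s)) : List ℕ :=
  (X (leader k)).filter fun x => decide (x % ownGroupSize k = (k : ℕ) % s)

/-- The indices that machine `k` gets from its group. -/
def gathered (X : Fin (numMachines m s) → List ℕ) (k : Fin (numMachines m s)) : List ℕ :=
  (List.finRange (numMachines m s)).flatMap fun i : Fin (numMachines m s) =>
    if (i : ℕ) / s = (k : ℕ) / s then (share X i).reverse else []

lemma ownGroupSize_eq (k : Fin (numMachines m s)) :
    ownGroupSize k = min s (numMachines m s - (k : ℕ) / s * s) := rfl

lemma div_mul_add_mod_ownGroupSize_lt (hs : 0 < s) (k : Fin (numMachines m s)) (x : ℕ) :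
    x % ownGroupSize k < s ∧ (k : ℕ) / s * s + x % ownGroupSize k < numMachines m s := by
  have hk := k.2
  have hle := Nat.div_mul_le_self (k : ℕ) s
  have hmin := ownGroupSize_eq k
  have hlt := Nat.mod_lt x (show 0 < ownGroupSize k by omega)
  omega

lemma mul_add_mod_groupSize_eq_iff (hs : 0 < s) (i k : Fin (numMachines m s)) (x : ℕ) :
    i * s + x % groupSize s (numMachines m s) (i * s) = k ↔
      i = leader k ∧ x % ownGroupSize k = k % s := by
  have hdiv := Nat.div_add_mod' (k : ℕ) s
  constructor
  · intro h
    have hgroup : groupSize s (numMachines m s) (i * s) =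
      min s (numMachines m s - i * s) := rfl
    have hlt := Nat.mod_lt x
      (show 0 < groupSize s (numMachines m s) (i * s) by have := k.2; omega)
    have hi : (i : ℕ) = k / s :=
      ((Nat.div_eq_iff hs).2 ⟨by omega, by omega⟩).symm
    refine ⟨Fin.ext hi, ?_⟩
    rw [hi] at h
    exact Nat.add_left_cancel (h.trans hdiv.symm)
  · rintro ⟨rfl, h⟩
    exact (congrArg (k / s * s + ·) h).trans hdiv

lemma mem_group_iff (hs : 0 < s) (i k : Fin (numMachines m s)) :
    (i : ℕ) / s * s ≤ k ∧ (k : ℕ) < i / s * s + ownGroupSize i ↔ (i : ℕ) / s = k / s := by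
  have hdiv := Nat.div_add_mod' (k : ℕ) s
  have hmod := Nat.mod_lt (k : ℕ) hs
  rw [ownGroupSize_eq]
  refine ⟨fun h => ((Nat.div_eq_iff hs).2 ⟨h.1, by omega⟩).symm, fun h => ?_⟩
  rw [h]
  omega

lemma next_scatter_of_le (hq : numMachines m s ≤ q) :
    randomizedLocalRatio.next (configuration I H 2 q θ E X mail) ρ =
      configuration I H 0 q θ E X fun _ => [] := by
  refine next_eq (out := fun _ => []) (fun k => ?_) fun k => by simp [configuration, deliver]
  simp only [configuration, localInput_eq]
  exact (Code.eval_step_scatter ..).trans (if_pos hq)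

lemma next_scatter_of_lt (hs : 0 < s) (hq : q < numMachines m s) :
    randomizedLocalRatio.next (configuration I H 2 q θ E X mail) ρ =
      configuration I H 3 q θ E X fun k => (share X k).map indexMessage := by
  refine next_eq (out := fun k => (X k).map fun x => ((k : ℕ) * s +
    x % groupSize s (numMachines m s) ((k : ℕ) * s), indexMessage x)) (fun k => ?_) fun k => ?_
  · simp only [configuration, localInput_eq]
    exact (Code.eval_step_scatter ..).trans (if_neg hq.not_ge)
  · simp only [deliver, List.filter_map, List.map_map, Function.comp_def,
      mul_add_mod_groupSize_eq_iff hs]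
    rw [flatMap_finRange_eq _ (leader k) fun i hi => by simp [hi]]
    simp [configuration, share]

lemma next_gather (hs : 0 < s) :
    randomizedLocalRatio.next
        (configuration I H 3 q θ E X fun k => (share X k).map indexMessage) ρ =
      configuration I H 4 q θ E X fun k => (gathered X k).map indexMessage := by
  refine next_eq (out := fun k => (((share X k).map indexMessage).flatMap fun z =>
    (List.range (ownGroupSize k)).map fun t => ((k : ℕ) / s * s + t, z)).reverse)
    (fun k => ?_) fun k => ?_
  · simp only [configuration, localInput_eq]
    exact Code.eval_step_gather ..
  · simp only [deliver_broadcast, mem_group_iff hs, configuration, gathered, List.map_flatMap]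
    refine congrArg (List.flatMap · _) (funext fun i => ?_)
    split_ifs <;> simp

lemma next_receive :
    randomizedLocalRatio.next
        (configuration I H 4 q θ E X fun k => (gathered X k).map indexMessage) ρ =
      configuration I H 2 (q * s) θ E (gathered X) fun _ => [] := by
  refine next_eq (out := fun _ => []) (fun k => ?_) fun k => by simp [configuration, deliver]
  have hflatten (l : List ℕ) : ((l.map indexMessage).map Prod.fst).flatten = l := by
    induction l with
    | nil => rfl
    | cons x l ih => simpa using ih
  simp only [configuration, localInput_eq]
  refine (Code.eval_step_receive ..).trans ?_
  rw [hflatten]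

lemma share_eq {i k : Fin (numMachines m s)} (h : (i : ℕ) / s = (k : ℕ) / s) :
    share X i = (X (leader k)).filter fun x => decide (x % ownGroupSize k = (i : ℕ) % s) := by
  rw [share, show leader i = leader k from Fin.ext h, ownGroupSize, ownGroupSize, h]

lemma gathered_perm (hs : 0 < s) (X : Fin (numMachines m s) → List ℕ)
    (k : Fin (numMachines m s)) : (gathered X k).Perm (X (leader k)) := by
  rw [List.perm_iff_count]
  intro x
  obtain ⟨hlt, hmachine⟩ := div_mul_add_mod_ownGroupSize_lt hs k x
  have hdiv : ((k : ℕ) / s * s + x % ownGroupSize k) / s = k / s :=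
    (Nat.div_eq_iff hs).2 ⟨by omega, by omega⟩
  have hmod : ((k : ℕ) / s * s + x % ownGroupSize k) % s = x % ownGroupSize k :=
    Nat.mul_add_mod_of_lt hlt
  rw [gathered, List.count_flatMap, ← Fin.sum_univ_def,
    Finset.sum_eq_single ⟨(k : ℕ) / s * s + x % ownGroupSize k, hmachine⟩]
  · rw [Function.comp_apply, if_pos hdiv, share_eq hdiv, List.count_reverse, List.count_filter]
    simp [hmod]
  · intro i _ hne
    rw [Function.comp_apply]
    split_ifs with hi
    · rw [share_eq hi, List.count_reverse, List.count_eq_zero]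
      rintro hx
      refine hne (Fin.ext ?_)
      simp only [List.mem_filter, decide_eq_true_eq] at hx
      rw [← Nat.div_add_mod' (i : ℕ) s, hi, ← hx.2]
    · rfl
  · simp

/-- Exactly the machines with numbers below `q` hold the list `L`, up to order; the others hold
nothing. -/
def HeldBelow (q : ℕ) (L : List ℕ) (X : Fin (numMachines m s) → List ℕ) : Prop :=
  ∀ k : Fin (numMachines m s), ((k : ℕ) < q → (X k).Perm L) ∧ (q ≤ (k : ℕ) → X k = [])

lemma HeldBelow.gathered (hs : 0 < s) {L : List ℕ} (h : HeldBelow q L X) :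
    HeldBelow (q * s) L (gathered X) := by
  intro k
  have hlt : (leader k : ℕ) < q ↔ (k : ℕ) < q * s := Nat.div_lt_iff_lt_mul hs
  refine ⟨fun hk => (gathered_perm hs X k).trans ((h (leader k)).1 (hlt.2 hk)), fun hk => ?_⟩
  rw [← List.perm_nil, ← (h (leader k)).2 (not_lt.1 (mt hlt.1 hk.not_gt))]
  exact gathered_perm hs X k

/-! ## The memory of the machines -/

lemma one_le_maxFreq (I : SetCover n m) (hm : 1 ≤ m) : 1 ≤ I.maxFreq := by
  obtain ⟨i, hi⟩ := I.feasible ⟨0, hm⟩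
  exact (Finset.card_pos.2 ⟨i, (SetCover.mem_T I).2 hi⟩).trans_le (I.card_T_le_maxFreq ⟨0, hm⟩)

lemma one_le_of_feasible (I : SetCover n m) (hm : 1 ≤ m) : 1 ≤ n := by
  obtain ⟨i, -⟩ := I.feasible ⟨0, hm⟩
  exact Nat.one_le_of_lt i.2

lemma numMachines_le (hm : 1 ≤ m) : numMachines m s ≤ m := by
  have := Nat.div_le_self (m - 1) s
  unfold numMachines
  omega

lemma length_le_of_nodup {l : List ℕ} (hl : l.Nodup) (hlt : ∀ x ∈ l, x < n) : l.length ≤ n :=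
  (List.subperm_of_subset hl fun x hx => List.mem_range.2 (hlt x hx)).length_le.trans_eq
    List.length_range

lemma mul_length_filter_mod_eq_le {l : List ℕ} (hl : l.Nodup) (hlt : ∀ x ∈ l, x < n) (g r : ℕ) :
    g * (l.filter fun x => decide (x % g = r)).length ≤ n + g := by
  have hmod {x : ℕ} (hx : x ∈ l.filter fun x => decide (x % g = r)) : x ∈ l ∧ x % g = r := by
    simpa using hx
  have hnodup : ((l.filter fun x => decide (x % g = r)).map (· / g)).Nodup := by
    refine (hl.filter _).map_on fun x hx y hy hxy => ?_
    rw [← Nat.div_add_mod x g, ← Nat.div_add_mod y g, hxy, (hmod hx).2, (hmod hy).2]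
  have hlength := length_le_of_nodup (n := n / g + 1) hnodup fun y hy => by
    obtain ⟨x, hx, rfl⟩ := List.mem_map.1 hy
    exact Nat.lt_succ_of_le (Nat.div_le_div_right (hlt x (hmod hx).1).le)
  rw [List.length_map] at hlength
  refine (Nat.mul_le_mul_left g hlength).trans ?_
  rw [mul_add, mul_one]
  exact Nat.add_le_add_right (Nat.mul_div_le n g) g

section Size

variable {B : ℕ}

lemma size_list_nat_le {l : List ℕ} (hl : ∀ x ∈ l, x < B) :
    (list nat).size B l ≤ l.length + 1 := by
  simpa using size_list_le B nat (k := 1) (l := l) fun x hx => (size_nat_of_lt (hl x hx)).le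

lemma size_map_indexMessage_le {l : List ℕ} (hl : ∀ x ∈ l, x < B) :
    (list messageTy).size B (l.map indexMessage) ≤ l.length * 3 + 1 := by
  refine (size_list_le B messageTy (k := 3) fun z hz => ?_).trans (by simp)
  obtain ⟨x, hx, rfl⟩ := List.mem_map.1 hz
  rw [size_prod, size_cons, size_nil, size_nil, size_nat_of_lt (hl x hx)]

lemma size_entries_le (hB : n < B) (l : List (Fin n)) (r : Fin n → ℝ) :
    (list (prod nat wt)).size B (entries l r) ≤ l.length * 2 + 1 := by
  refine (size_list_le B _ (k := 2) fun z hz => ?_).trans (by simp [entries])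
  obtain ⟨i, -, rfl⟩ := List.mem_map.1 hz
  rw [size_prod, size_nat_of_lt (i.2.trans hB)]
  exact le_rfl

lemma size_setsOf_le (I : SetCover n m) (hB : n < B) (j : Fin m) :
    (list nat).size B (setsOf I j) ≤ I.maxFreq + 1 := by
  refine (size_list_nat_le fun k hk => ?_).trans ?_
  · obtain ⟨i, -, rfl⟩ := (mem_setsOf I).1 hk
    exact i.2.trans hB
  · rw [length_setsOf]
    exact Nat.add_le_add_right (I.card_T_le_maxFreq j) 1

lemma LocalRatio.Recorded.size_le {l : List (Fin n)} (hE : Recorded I l E) (hB : n < B) :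
    (list (list nat)).size B E ≤ n * (I.maxFreq + 1) + 1 := by
  refine (size_list_le B _ (k := I.maxFreq + 1) fun T hT => ?_).trans
    (Nat.add_le_add_right (Nat.mul_le_mul_right _ hE.length_le) 1)
  obtain ⟨j, rfl⟩ := hE.exists_eq_setsOf hT
  exact size_setsOf_le I hB j

lemma sampleMail_perm (I : SetCover n m) (H : Placement n m s) (Q : Finset (Fin m)) :
    (sampleMail I H Q).Perm
      (((byMachine H.elt).filter fun j => decide (j ∈ Q)).map (fun j => (setsOf I j, [])) ++
        (entries (order H) I.w).map fun z => ([], [z])) := by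
  refine (List.flatMap_append_perm _ _ _).symm.trans (List.Perm.of_eq ?_)
  simp only [byMachine, entries, weightData, storedElements, List.filter_flatMap,
    List.map_flatMap]

lemma size_sampleMail_le (I : SetCover n m) (H : Placement n m s) (hB : n < B)
    (Q : Finset (Fin m)) :
    (list messageTy).size B (sampleMail I H Q) ≤ #Q * (I.maxFreq + 2) + n * 4 + 1 := by
  have hsample : (list messageTy).size B (((byMachine H.elt).filter fun j => decide (j ∈ Q)).map
      fun j => (setsOf I j, [])) ≤ #Q * (I.maxFreq + 2) + 1 := by
    refine (size_list_le B messageTy (k := I.maxFreq + 2) fun z hz => ?_).trans ?_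
    · obtain ⟨j, -, rfl⟩ := List.mem_map.1 hz
      exact Nat.add_le_add_right (size_setsOf_le I hB j) 1
    · rw [List.length_map, ← List.toFinset_card_of_nodup ((nodup_byMachine H.elt).filter _)]
      refine Nat.add_le_add_right (Nat.mul_le_mul_right _ (Finset.card_le_card fun j hj => ?_)) 1
      simpa [mem_byMachine] using hj
  have hweights : (list messageTy).size B ((entries (order H) I.w).map fun z => ([], [z])) ≤
      n * 4 + 1 := by
    refine (size_list_le B messageTy (k := 4) fun z hz => ?_).trans
      (by simp [entries, length_byMachine])
    obtain ⟨y, hy, rfl⟩ := List.mem_map.1 hz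
    obtain ⟨i, -, rfl⟩ := List.mem_map.1 hy
    rw [size_prod, size_cons, size_prod, size_nil, size_nil, size_nat_of_lt (i.2.trans hB)]
    exact le_rfl
  have happend := size_append B messageTy
    (((byMachine H.elt).filter fun j => decide (j ∈ Q)).map fun j => (setsOf I j, []))
    ((entries (order H) I.w).map fun z => ([], [z]))
  rw [size_perm B messageTy (sampleMail_perm I H Q)]
  exact Nat.le_of_succ_le_succ <| (happend.le.trans (Nat.add_le_add hsample hweights)).trans
    (by omega)

end Size

lemma length_storedElements_le (H : Placement n m s) (k : Fin (numMachines m s)) :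
    (storedElements H k).length ≤ s := by
  rw [storedElements, ← List.toFinset_card_of_nodup ((List.nodup_finRange m).filter _)]
  refine (Finset.card_le_card fun j hj => ?_).trans (H.balanced k)
  simpa using hj

lemma lt_wordCap : n < wordCap n m s := by
  unfold wordCap
  omega

lemma size_elementData_le (I : SetCover n m) (H : Placement n m s) (k : Fin (numMachines m s)) :
    (list (prod nat (list nat))).size (wordCap n m s) (elementData I H k) ≤
      s * (I.maxFreq + 2) + 1 := by
  refine (size_list_le _ _ (k := I.maxFreq + 2) fun z hz => ?_).trans ?_
  · obtain ⟨j, -, rfl⟩ := List.mem_map.1 hz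
    have hj : (j : ℕ) < wordCap n m s := by
      unfold wordCap
      omega
    rw [size_prod, size_nat_of_lt hj, add_comm]
    exact Nat.add_le_add_right (size_setsOf_le I lt_wordCap j) 1
  · rw [elementData, List.length_map]
    exact Nat.add_le_add_right (Nat.mul_le_mul_right _ (length_storedElements_le H k)) 1

lemma size_weightData_le (I : SetCover n m) (H : Placement n m s) (k : Fin (numMachines m s)) :
    (list (prod nat wt)).size (wordCap n m s) (weightData I H k) ≤ n * 2 + 1 := by
  refine (size_entries_le lt_wordCap _ _).trans ?_
  have := List.length_filter_le (fun i => decide (H.set i = k)) (List.finRange n)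
  rw [List.length_finRange] at this
  omega

lemma size_localInput_le (I : SetCover n m) (H : Placement n m s) (hm : 1 ≤ m)
    (k : Fin (numMachines m s)) :
    inputTy.size (wordCap n m s) (localInput I H k) ≤ s * (I.maxFreq + 2) + n * 2 + 7 := by
  have hM := numMachines_le (s := s) hm
  have hword {x : ℕ} (hx : x ≤ n + m + s) : nat.size (wordCap n m s) x = 1 :=
    size_nat_of_lt (by unfold wordCap; omega)
  have helements := size_elementData_le I H k
  have hweights := size_weightData_le I H k
  rw [localInput_eq]
  simp only [size_prod, hword (x := k) (by omega), hword (x := numMachines m s) (by omega),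
    hword (x := n) (by omega), hword (x := m) (by omega), hword (x := s) (by omega)]
  omega

lemma mul_add_lt_wordCap_sq (n m s : ℕ) : m * s + n + m + s < wordCap n m s ^ 2 := by
  unfold wordCap
  nlinarith [Nat.zero_le (n * m), Nat.zero_le (n * s), Nat.zero_le (m * s), sq_nonneg n,
    sq_nonneg m, sq_nonneg s]

/-- The bound for the size of the data of a machine, up to which the local computations are
analysed. -/
def sizeBound (I : SetCover n m) (s : ℕ) : ℕ := 60 * (I.maxFreq * s)

/-- The lists `ρ k` can be the random words of a round. -/
def IsWords (n m s : ℕ) (ρ : Fin (numMachines m s) → List ℕ) : Prop :=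
  ∀ k, (ρ k).length ≤ s ∧ ∀ x ∈ ρ k, x < wordCap n m s

/-- In the next round, all machines start from data of bounded size, and their code is efficient. -/
def Fits (I : SetCover n m) (C : Config randomizedLocalRatio (numMachines m s))
    (ρ : Fin (numMachines m s) → List ℕ) : Prop :=
  ∀ k, stepInputTy.size (wordCap n m s) (randomizedLocalRatio.stepInput C ρ k) ≤ sizeBound I s ∧
    Code.Admissible (wordCap n m s) (sizeBound I s) (randomizedLocalRatio.stepInput C ρ k)

/-- The numbers and lists that the machines keep are small. -/
structure IsSmall (I : SetCover n m) (H : Placement n m s) (q θ : ℕ) (E : List (List ℕ))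
    (X : Fin (numMachines m s) → List ℕ) : Prop where
  informed_lt : q < wordCap n m s ^ 2
  threshold_lt : θ < wordCap n m s ^ 3
  recorded : Recorded I (order H) E
  nodup k : (X k).Nodup
  lt k : ∀ x ∈ X k, x < n

namespace IsSmall

variable {mode : ℕ}

lemma of_heldBelow {q' : ℕ} (hq : q < wordCap n m s ^ 2) (hθ : θ < wordCap n m s ^ 3)
    (hE : Recorded I (order H) E) (hX : HeldBelow q' (chosen I (order H) E) X) :
    IsSmall I H q θ E X := by
  refine ⟨hq, hθ, hE, fun k => ?_, fun k x hx => ?_⟩ <;> rcases lt_or_ge (k : ℕ) q' with hk | hk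
  · exact ((hX k).1 hk).nodup_iff.2 (hE.nodup_chosen (nodup_byMachine _))
  · simp [(hX k).2 hk]
  · exact hE.lt_of_mem_chosen (mem_byMachine _) (((hX k).1 hk).mem_iff.1 hx)
  · simp [(hX k).2 hk] at hx

lemma size_state_le (hsmall : IsSmall I H q θ E X) (hm : 1 ≤ m) (hns : n ≤ s)
    (hmode : mode ≤ 4) (k : Fin (numMachines m s)) :
    stateTy.size (wordCap n m s) ((configuration I H mode q θ E X mail).state k) ≤
      s * (I.maxFreq + 2) + n * (I.maxFreq + 4) + 15 := by
  have hn := one_le_of_feasible I hm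
  have hinput := size_localInput_le I H hm k
  have hchosen : (list nat).size (wordCap n m s) (X k) ≤ n + 1 :=
    (size_list_nat_le fun x hx => (hsmall.lt k x hx).trans lt_wordCap).trans
      (Nat.add_le_add_right (length_le_of_nodup (hsmall.nodup k) (hsmall.lt k)) 1)
  have hrecorded : (list (list nat)).size (wordCap n m s) (if k = 0 then E else []) ≤
      n * (I.maxFreq + 1) + 1 := by
    split_ifs
    · exact hsmall.recorded.size_le lt_wordCap
    · exact Nat.le_add_left 1 _
  have hthreshold : nat.size (wordCap n m s) θ ≤ 3 :=
    size_nat_le hsmall.threshold_lt (by norm_num)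
  have hinformed : nat.size (wordCap n m s) q ≤ 2 := size_nat_le hsmall.informed_lt (by norm_num)
  have hmode_size : nat.size (wordCap n m s) mode = 1 :=
    size_nat_of_lt (by unfold wordCap; omega)
  calc stateTy.size (wordCap n m s) ((configuration I H mode q θ E X mail).state k)
      = inputTy.size (wordCap n m s) (localInput I H k) +
          ((list nat).size (wordCap n m s) (X k) +
            ((list (list nat)).size (wordCap n m s) (if k = 0 then E else []) +
              (nat.size (wordCap n m s) θ + (nat.size (wordCap n m s) mode +
                nat.size (wordCap n m s) q)))) := rfl
    _ ≤ s * (I.maxFreq + 2) + n * (I.maxFreq + 4) + 15 := by linarith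

lemma size_stepInput_le (hsmall : IsSmall I H q θ E X) (hm : 1 ≤ m) (hns : n ≤ s)
    (hmode : mode ≤ 4)
    (hmail : ∀ k, (list messageTy).size (wordCap n m s) (mail k) ≤
      9 * s * (I.maxFreq + 2) + n * 4 + 1)
    (hρ : IsWords n m s ρ) (k : Fin (numMachines m s)) :
    stepInputTy.size (wordCap n m s)
        (randomizedLocalRatio.stepInput (configuration I H mode q θ E X mail) ρ k) ≤
      sizeBound I s := by
  have hn := one_le_of_feasible I hm
  have hstate := hsmall.size_state_le (mail := mail) hm hns hmode k
  have hmail_k := hmail k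
  have hwords : (list nat).size (wordCap n m s) (ρ k) ≤ s + 1 :=
    (size_list_nat_le (hρ k).2).trans (Nat.add_le_add_right (hρ k).1 1)
  have hnf : n * I.maxFreq ≤ s * I.maxFreq := Nat.mul_le_mul_right _ hns
  have hsf : s ≤ s * I.maxFreq := Nat.le_mul_of_pos_right _ (one_le_maxFreq I hm)
  calc stepInputTy.size (wordCap n m s)
        (randomizedLocalRatio.stepInput (configuration I H mode q θ E X mail) ρ k)
      = stateTy.size (wordCap n m s) ((configuration I H mode q θ E X mail).state k) +
          ((list messageTy).size (wordCap n m s) (mail k) +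
            (list nat).size (wordCap n m s) (ρ k)) := rfl
    _ ≤ sizeBound I s := by
        unfold sizeBound
        linarith

lemma admissible (hsmall : IsSmall I H q θ E X) (hm : 1 ≤ m)
    (hgather : mode = 3 → ∀ k, ownGroupSize k *
      ((list messageTy).size (wordCap n m s) (mail k) - 1) ≤ sizeBound I s)
    (k : Fin (numMachines m s)) :
    Code.Admissible (wordCap n m s) (sizeBound I s)
      (randomizedLocalRatio.stepInput (configuration I H mode q θ E X mail) ρ k) := by
  have hk := k.2
  have hM := numMachines_le (s := s) hm
  constructor
  · rintro - (i : ℕ) hi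
    have hi_lt : i < n := hsmall.lt k i hi
    have hmod := Nat.mod_le i (groupSize s (numMachines m s) ((k : ℕ) * s))
    have hmul := Nat.mul_le_mul_right s (hk.le.trans hM)
    have hcap := mul_add_lt_wordCap_sq n m s
    have haddress : (k : ℕ) * s + i % groupSize s (numMachines m s) (k * s) <
        wordCap n m s ^ 2 := by omega
    simpa [Algorithm.stepInput, configuration, localInput_eq] using haddress
  · intro hmode
    have hload := hgather hmode k
    have hdiv := Nat.div_mul_le_self (k : ℕ) s
    have hgroup := ownGroupSize_eq k
    have hcap := mul_add_lt_wordCap_sq n m s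
    simp only [Algorithm.stepInput, configuration, localInput_eq, Code.eval_ownGroup,
      Code.eval_comp, Code.eval_prim, Prim.eval]
    refine ⟨?_, hload⟩
    change (k : ℕ) / s * s + ownGroupSize k ≤ _
    omega

lemma fits (hsmall : IsSmall I H q θ E X) (hm : 1 ≤ m) (hns : n ≤ s) (hmode : mode ≤ 4)
    (hmail : ∀ k, (list messageTy).size (wordCap n m s) (mail k) ≤
      9 * s * (I.maxFreq + 2) + n * 4 + 1)
    (hgather : mode = 3 → ∀ k, ownGroupSize k *
      ((list messageTy).size (wordCap n m s) (mail k) - 1) ≤ sizeBound I s)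
    (hρ : IsWords n m s ρ) : Fits I (configuration I H mode q θ E X mail) ρ :=
  fun k => ⟨hsmall.size_stepInput_le hm hns hmode hmail hρ k, hsmall.admissible hm hgather k⟩

lemma fits_of_mail_nil (hsmall : IsSmall I H q θ E X) (hm : 1 ≤ m) (hns : n ≤ s)
    (hmode : mode ≤ 4) (hρ : IsWords n m s ρ) :
    Fits I (configuration I H mode q θ E X fun _ => []) ρ :=
  hsmall.fits hm hns hmode (fun _ => Nat.le_add_left 1 _) (fun _ _ => Nat.zero_le _) hρ

lemma fits_sample (hsmall : IsSmall I H q θ E X) (hm : 1 ≤ m) (hns : n ≤ s)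
    {Q : Finset (Fin m)} (hQ : #Q ≤ 9 * s) (hρ : IsWords n m s ρ) :
    Fits I (configuration I H 1 q θ E X fun k => if k = 0 then sampleMail I H Q else []) ρ := by
  refine hsmall.fits hm hns (by norm_num) (fun k => ?_) (by norm_num) hρ
  split_ifs
  · have := Nat.mul_le_mul_right (I.maxFreq + 2) hQ
    exact (size_sampleMail_le I H lt_wordCap Q).trans (by omega)
  · exact Nat.le_add_left 1 _

lemma fits_share (hsmall : IsSmall I H q θ E X) (hm : 1 ≤ m) (hns : n ≤ s)
    (hρ : IsWords n m s ρ) :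
    Fits I (configuration I H 3 q θ E X fun k => (share X k).map indexMessage) ρ := by
  have hshare_lt k : ∀ x ∈ share X k, x < n := fun x hx =>
    hsmall.lt _ x (List.mem_of_mem_filter hx)
  have hsize k : (list messageTy).size (wordCap n m s) ((share X k).map indexMessage) ≤
      (share X k).length * 3 + 1 :=
    size_map_indexMessage_le fun x hx => (hshare_lt k x hx).trans lt_wordCap
  refine hsmall.fits hm hns (by norm_num) (fun k => ?_) (fun _ k => ?_) hρ
  · have : (share X k).length ≤ n :=
      length_le_of_nodup ((hsmall.nodup (leader k)).filter _) (hshare_lt k)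
    exact (hsize k).trans (by omega)
  · have hload := mul_length_filter_mod_eq_le (hsmall.nodup (leader k)) (hsmall.lt _)
      (ownGroupSize k) ((k : ℕ) % s)
    have hgroup := ownGroupSize_eq k
    have hsf : s ≤ I.maxFreq * s := Nat.le_mul_of_pos_left _ (one_le_maxFreq I hm)
    calc ownGroupSize k * ((list messageTy).size (wordCap n m s)
          ((share X k).map indexMessage) - 1)
        ≤ ownGroupSize k * ((share X k).length * 3) :=
          Nat.mul_le_mul_left _ (Nat.sub_le_of_le_add (hsize k))
      _ = 3 * (ownGroupSize k * (share X k).length) := by ring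
      _ ≤ 3 * (n + ownGroupSize k) := Nat.mul_le_mul_left 3 hload
      _ ≤ sizeBound I s := by
          unfold sizeBound
          omega

lemma fits_gathered (hsmall : IsSmall I H q θ E X) (hm : 1 ≤ m) (hns : n ≤ s)
    (hρ : IsWords n m s ρ) :
    Fits I (configuration I H 4 q θ E X fun k => (gathered X k).map indexMessage) ρ := by
  have hs : 0 < s := (one_le_of_feasible I hm).trans hns
  refine hsmall.fits hm hns le_rfl (fun k => ?_) (by norm_num) hρ
  have hperm := gathered_perm hs X k
  have hsize : (list messageTy).size (wordCap n m s) ((gathered X k).map indexMessage) ≤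
      (gathered X k).length * 3 + 1 :=
    size_map_indexMessage_le fun x hx =>
      (hsmall.lt _ x (hperm.mem_iff.1 hx)).trans lt_wordCap
  rw [hperm.length_eq] at hsize
  have := length_le_of_nodup (hsmall.nodup (leader k)) (hsmall.lt _)
  exact hsize.trans (by omega)

end IsSmall

/-! ## The phases of the algorithm -/

variable (I H) in
/-- A phase begins: all machines know the chosen sets. -/
def AtSample (C : Config randomizedLocalRatio (numMachines m s)) (θ : ℕ)
    (E : List (List ℕ)) : Prop :=
  ∃ q X, C = configuration I H 0 q θ E X (fun _ => []) ∧ q < wordCap n m s ^ 2 ∧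
    ∀ k, (X k).Perm (chosen I (order H) E)

variable (I H) in
/-- The relay has reached the first `q` machines. -/
def AtScatter (C : Config randomizedLocalRatio (numMachines m s)) (q θ : ℕ)
    (E : List (List ℕ)) : Prop :=
  ∃ X, C = configuration I H 2 q θ E X (fun _ => []) ∧ 0 < q ∧ q < wordCap n m s ^ 2 ∧
    HeldBelow q (chosen I (order H) E) X

variable (I H) in
/-- Machine `0` would output the chosen sets. -/
def Shows (C : Config randomizedLocalRatio (numMachines m s)) (E : List (List ℕ)) : Prop :=
  (C.state 0).2.1.Perm (chosen I (order H) E)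

/-- A sequence of configurations in which each one follows from the one before. -/
structure IsRun (n : ℕ) {m s : ℕ} (Cs : ℕ → Config randomizedLocalRatio (numMachines m s))
    (ρs : ℕ → Fin (numMachines m s) → List ℕ) : Prop where
  next r : Cs (r + 1) = randomizedLocalRatio.next (Cs r) (ρs r)
  isWords r : IsWords n m s (ρs r)

lemma nextThreshold_le (hθ : θ ≤ 4 * s * wordCap n m s) :
    nextThreshold n m s θ ≤ 4 * s * wordCap n m s := by
  unfold nextThreshold
  split_ifs with h
  · exact hθ
  · refine (Nat.div_le_self _ _).trans ?_
    unfold wordCap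
    nlinarith

lemma lt_wordCap_pow_three (hn : 1 ≤ n) (hm : 1 ≤ m) (hθ : θ ≤ 4 * s * wordCap n m s) :
    θ < wordCap n m s ^ 3 := by
  have hfour : 4 ≤ wordCap n m s := by unfold wordCap; omega
  have hs : s < wordCap n m s := by unfold wordCap; omega
  calc θ ≤ 4 * s * wordCap n m s := hθ
    _ < wordCap n m s * wordCap n m s * wordCap n m s :=
        Nat.mul_lt_mul_of_pos_right (by nlinarith) (by omega)
    _ = wordCap n m s ^ 3 := by ring

variable {Cs : ℕ → Config randomizedLocalRatio (numMachines m s)}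
  {ρs : ℕ → Fin (numMachines m s) → List ℕ} {r : ℕ}

lemma LocalRatio.Recorded.nextRecorded (hE : Recorded I (order H) E) (Q : Finset (Fin m)) :
    Recorded I (order H) (nextRecorded I H E Q) :=
  hE.record (mem_byMachine _) fun _ hT => eq_nil_or_eq_setsOf_of_mem_sampleMail hT

lemma AtSample.step (h : AtSample I H (Cs r) θ E) (hrun : IsRun n Cs ρs) (hm : 1 ≤ m) (hns : n ≤ s)
    (hE : Recorded I (order H) E) (hθ : θ < wordCap n m s ^ 3)
    (hQ : #(sampledSet I H E θ (ρs r)) ≤ 9 * s) :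
    (∀ t < 2, Fits I (Cs (r + t)) (ρs (r + t)) ∧ Shows I H (Cs (r + t)) E) ∧
      AtScatter I H (Cs (r + 2)) 1 (nextThreshold n m s θ)
        (nextRecorded I H E (sampledSet I H E θ (ρs r))) := by
  obtain ⟨q, X, hsample, hq, hX⟩ := h
  have hsmall : IsSmall I H q θ E X :=
    .of_heldBelow (q' := numMachines m s) hq hθ hE fun k =>
      ⟨fun _ => hX k, fun hk => absurd k.2 hk.not_gt⟩
  have hupdate := hrun.next r
  rw [hsample, next_sample hX] at hupdate
  have hscatter := hrun.next (r + 1)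
  rw [hupdate, next_updateChosen] at hscatter
  refine ⟨fun t ht => ?_, _, hscatter, one_pos, ?_, fun k => ⟨fun hk => ?_, fun hk => ?_⟩⟩
  · interval_cases t
    · rw [add_zero, hsample]
      exact ⟨hsmall.fits_of_mail_nil hm hns (by norm_num) (hrun.isWords _), hX 0⟩
    · rw [hupdate]
      exact ⟨hsmall.fits_sample hm hns hQ (hrun.isWords _), hX 0⟩
  · have := mul_add_lt_wordCap_sq n m s
    omega
  · simp [show k = 0 from Fin.ext (by simpa using hk)]
  · exact if_neg fun hzero => by simp [hzero] at hk

lemma AtScatter.fits (h : AtScatter I H (Cs r) q θ E) (hrun : IsRun n Cs ρs) (hm : 1 ≤ m)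
    (hns : n ≤ s) (hE : Recorded I (order H) E) (hθ : θ < wordCap n m s ^ 3) :
    Fits I (Cs r) (ρs r) ∧ Shows I H (Cs r) E := by
  obtain ⟨X, hscatter, hq_pos, hq, hX⟩ := h
  rw [hscatter]
  exact ⟨(IsSmall.of_heldBelow hq hθ hE hX).fits_of_mail_nil hm hns (by norm_num)
    (hrun.isWords r), (hX 0).1 hq_pos⟩

lemma AtScatter.atSample (h : AtScatter I H (Cs r) q θ E) (hrun : IsRun n Cs ρs)
    (hM : numMachines m s ≤ q) : AtSample I H (Cs (r + 1)) θ E := by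
  obtain ⟨X, hscatter, -, hq, hX⟩ := h
  exact ⟨q, X, by rw [hrun.next, hscatter, next_scatter_of_le hM], hq,
    fun k => (hX k).1 (k.2.trans_le hM)⟩

lemma AtScatter.round (h : AtScatter I H (Cs r) q θ E) (hrun : IsRun n Cs ρs) (hm : 1 ≤ m)
    (hns : n ≤ s) (hE : Recorded I (order H) E) (hθ : θ < wordCap n m s ^ 3)
    (hM : q < numMachines m s) :
    (∀ t < 3, Fits I (Cs (r + t)) (ρs (r + t)) ∧ Shows I H (Cs (r + t)) E) ∧
      AtScatter I H (Cs (r + 3)) (q * s) θ E := by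
  have hs : 0 < s := (one_le_of_feasible I hm).trans hns
  have hfits := h.fits hrun hm hns hE hθ
  obtain ⟨X, hscatter, hq_pos, hq, hX⟩ := h
  have hsmall : IsSmall I H q θ E X := .of_heldBelow hq hθ hE hX
  have hgather := hrun.next r
  rw [hscatter, next_scatter_of_lt hs hM] at hgather
  have hreceive := hrun.next (r + 1)
  rw [hgather, next_gather hs] at hreceive
  have hnext := hrun.next (r + 2)
  rw [hreceive, next_receive] at hnext
  refine ⟨fun t ht => ?_, _, hnext, Nat.mul_pos hq_pos hs, ?_, hX.gathered hs⟩
  · interval_cases t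
    · exact hfits
    · rw [hgather]
      exact ⟨hsmall.fits_share hm hns (hrun.isWords _), (hX 0).1 hq_pos⟩
    · rw [hreceive]
      exact ⟨hsmall.fits_gathered hm hns (hrun.isWords _), (hX 0).1 hq_pos⟩
  · have hmul := Nat.mul_le_mul_right s (hM.le.trans (numMachines_le (s := s) hm))
    have hcap := mul_add_lt_wordCap_sq n m s
    omega

lemma AtScatter.relay (h : AtScatter I H (Cs r) 1 θ E) (hrun : IsRun n Cs ρs) (hm : 1 ≤ m)
    (hns : n ≤ s) (hE : Recorded I (order H) E) (hθ : θ < wordCap n m s ^ 3) {L : ℕ}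
    (hL : ∀ i < L, s ^ i < numMachines m s) :
    (∀ t < 3 * L, Fits I (Cs (r + t)) (ρs (r + t)) ∧ Shows I H (Cs (r + t)) E) ∧
      AtScatter I H (Cs (r + 3 * L)) (s ^ L) θ E := by
  induction L with
  | zero => exact ⟨by simp, by simpa using h⟩
  | succ L ih =>
    obtain ⟨hbefore, hL_scatter⟩ := ih fun i hi => hL i (by omega)
    obtain ⟨hround, hnext⟩ := hL_scatter.round hrun hm hns hE hθ (hL L (by omega))
    refine ⟨fun t ht => ?_, by rw [pow_succ]; exact hnext⟩
    rcases lt_or_ge t (3 * L) with ht' | ht'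
    · exact hbefore t ht'
    · obtain ⟨u, rfl⟩ := Nat.exists_eq_add_of_le ht'
      rw [← add_assoc]
      exact hround u (by omega)

lemma AtSample.phase (h : AtSample I H (Cs r) θ E) (hrun : IsRun n Cs ρs) (hm : 1 ≤ m)
    (hns : n ≤ s) (hE : Recorded I (order H) E) (hθ : θ ≤ 4 * s * wordCap n m s)
    (hQ : #(sampledSet I H E θ (ρs r)) ≤ 9 * s) {L : ℕ}
    (hL : ∀ i < L, s ^ i < numMachines m s) (hL' : numMachines m s ≤ s ^ L) :
    (∀ t < 3 * L + 3, Fits I (Cs (r + t)) (ρs (r + t)) ∧ (Shows I H (Cs (r + t)) E ∨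
        Shows I H (Cs (r + t)) (nextRecorded I H E (sampledSet I H E θ (ρs r))))) ∧
      AtSample I H (Cs (r + (3 * L + 3))) (nextThreshold n m s θ)
        (nextRecorded I H E (sampledSet I H E θ (ρs r))) := by
  have hn := one_le_of_feasible I hm
  have hE' := hE.nextRecorded (sampledSet I H E θ (ρs r))
  have hθ' := lt_wordCap_pow_three hn hm (nextThreshold_le hθ)
  obtain ⟨hsample, hscatter⟩ := h.step hrun hm hns hE (lt_wordCap_pow_three hn hm hθ) hQ
  obtain ⟨hrelay, hrelayed⟩ := hscatter.relay hrun hm hns hE' hθ' hL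
  obtain ⟨hfits, hshows⟩ := hrelayed.fits hrun hm hns hE' hθ'
  refine ⟨fun t ht => ?_, ?_⟩
  · rcases lt_or_ge t 2 with ht' | ht'
    · exact ⟨(hsample t ht').1, Or.inl (hsample t ht').2⟩
    obtain ⟨u, rfl⟩ := Nat.exists_eq_add_of_le ht'
    rw [← add_assoc]
    rcases lt_or_ge u (3 * L) with hu | hu
    · exact ⟨(hrelay u hu).1, Or.inr (hrelay u hu).2⟩
    · obtain rfl : u = 3 * L := by omega
      exact ⟨hfits, Or.inr hshows⟩
  · have hdone := hrelayed.atSample hrun hL'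
    rwa [show r + 2 + 3 * L + 1 = r + (3 * L + 3) by ring] at hdone

/-! ## Sampling with random words -/

lemma sum_ite_lt_le {B θ : ℕ} (hB : 0 < B) (hθ : θ ≤ B) (z : ℝ) :
    ∑ v : Fin B, (if (v : ℕ) < θ then z else 1) ≤ B * Real.exp ((z - 1) * (θ / B)) := by
  have hlt : #{v : Fin B | (v : ℕ) < θ} = θ := by
    rw [Fin.card_filter_val_lt, min_eq_right hθ]
  have hge : (#{v : Fin B | ¬ (v : ℕ) < θ} : ℝ) = B - θ := by
    rw [eq_sub_iff_add_eq']
    have hsum := card_filter_add_card_filter_not (s := univ) fun v : Fin B => (v : ℕ) < θ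
    rw [hlt, card_univ, Fintype.card_fin] at hsum
    exact_mod_cast hsum
  have hB' : (0 : ℝ) < B := by exact_mod_cast hB
  calc ∑ v : Fin B, (if (v : ℕ) < θ then z else 1) = θ * z + (B - θ) := by
        simp only [sum_ite, sum_const, hlt, nsmul_eq_mul, hge, mul_one]
    _ = B * ((z - 1) * (θ / B) + 1) := by field_simp; ring
    _ ≤ _ := mul_le_mul_of_nonneg_left (Real.add_one_le_exp _) hB'.le

lemma sum_pow_card_le {ι : Type*} [Fintype ι] [DecidableEq ι] {B θ : ℕ} (hB : 0 < B)
    (hθ : θ ≤ B) (W : Finset ι) {z : ℝ} (hz : 0 ≤ z) :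
    ∑ ν : ι → Fin B, z ^ #{x ∈ W | (ν x : ℕ) < θ} ≤
      Fintype.card (ι → Fin B) * Real.exp ((z - 1) * (#W * θ / B)) := by
  have hprod (ν : ι → Fin B) : z ^ #{x ∈ W | (ν x : ℕ) < θ} =
      ∏ x, if x ∈ W ∧ (ν x : ℕ) < θ then z else 1 := by
    rw [prod_ite, prod_const, prod_const_one, mul_one]
    congr 2
    ext x
    simp
  have hfactor (x : ι) : (∑ v : Fin B, if x ∈ W ∧ (v : ℕ) < θ then z else 1) ≤
      B * (if x ∈ W then Real.exp ((z - 1) * (θ / B)) else 1) := by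
    by_cases hx : x ∈ W
    · simpa only [hx, true_and, if_true] using sum_ite_lt_le hB hθ z
    · simp [hx]
  calc ∑ ν : ι → Fin B, z ^ #{x ∈ W | (ν x : ℕ) < θ}
      = ∏ x : ι, ∑ v : Fin B, if x ∈ W ∧ (v : ℕ) < θ then z else 1 := by
        rw [prod_univ_sum, Fintype.piFinset_univ]
        exact sum_congr rfl fun ν _ => hprod ν
    _ ≤ ∏ x : ι, (B * (if x ∈ W then Real.exp ((z - 1) * (θ / B)) else 1) : ℝ) :=
        prod_le_prod (fun x _ => sum_nonneg fun v _ => by split_ifs <;> positivity)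
          fun x _ => hfactor x
    _ = Fintype.card (ι → Fin B) * Real.exp ((z - 1) * (#W * θ / B)) := by
        rw [prod_mul_distrib, prod_const, prod_ite, prod_const, prod_const_one, mul_one,
          ← Real.exp_nat_mul, card_univ]
        simp only [Fintype.card_pi, Fintype.card_fin, prod_const, card_univ, Nat.cast_pow,
          filter_mem_eq_inter, univ_inter]
        congr 2
        ring

lemma card_filter_le_of_update {κ α : Type*} [Fintype κ] [DecidableEq κ] [Fintype α] [Nonempty α]
    (r : κ) (A : (κ → α) → Prop) [DecidablePred A] {δ : ℝ}
    (h : ∀ ω, (#{σ | A (Function.update ω r σ)} : ℝ) ≤ δ * Fintype.card α) :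
    (#{ω | A ω} : ℝ) ≤ δ * Fintype.card (κ → α) := by
  have hα : (0 : ℝ) < Fintype.card α := by exact_mod_cast Fintype.card_pos
  have hcount : #{ω | A ω} * Fintype.card α =
      ∑ ω : κ → α, #{σ | A (Function.update ω r σ)} := by
    rw [← card_univ (α := α), ← card_product, ← card_sigma]
    exact card_bij' (fun x _ => ⟨Function.update x.1 r x.2, x.1 r⟩)
      (fun y _ => (Function.update y.1 r y.2, y.1 r)) (fun x hx => by simpa using hx)
      (fun y hy => by simpa using hy) (fun x _ => by simp) (fun y _ => by simp)
  refine le_of_mul_le_mul_right ?_ hα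
  calc (#{ω | A ω} : ℝ) * Fintype.card α
      = ∑ ω : κ → α, (#{σ | A (Function.update ω r σ)} : ℝ) := by exact_mod_cast hcount
    _ ≤ ∑ _ω : κ → α, δ * Fintype.card α := sum_le_sum fun ω _ => h ω
    _ = δ * Fintype.card (κ → α) * Fintype.card α := by
        rw [sum_const, nsmul_eq_mul, card_univ]
        ring

section Sampling

variable (I H)

lemma wordIndex_lt (j : Fin m) : wordIndex I H j < s := by
  refine lt_of_lt_of_le ?_ (length_storedElements_le H (H.elt j))
  rw [wordIndex, rank, elementData, List.filter_map, List.length_map]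
  exact List.length_filter_lt_length_iff_exists.mpr ⟨j, by simp [storedElements], by simp⟩

/-- The machine and the position of the random word that belongs to the element `j`. -/
def slot (j : Fin m) : Fin (numMachines m s) × Fin s :=
  (H.elt j, ⟨wordIndex I H j, wordIndex_lt I H j⟩)

lemma wordIndex_lt_wordIndex {j j' : Fin m} (h : j < j') (hk : H.elt j = H.elt j') :
    wordIndex I H j < wordIndex I H j' := by
  simp only [wordIndex, rank, elementData, List.filter_map, List.length_map, hk, storedElements]
  have hnodup (p q : Fin m → Bool) : (((List.finRange m).filter p).filter q).Nodup :=
    ((List.nodup_finRange m).filter _).filter _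
  rw [← List.toFinset_card_of_nodup (hnodup _ _), ← List.toFinset_card_of_nodup (hnodup _ _)]
  refine card_lt_card (ssubset_iff_of_subset ?_ |>.mpr ⟨j, ?_, ?_⟩)
  · intro x
    simp only [List.mem_toFinset, List.mem_filter, Function.comp, decide_eq_true_eq]
    exact fun hx => ⟨hx.1, hx.2.trans h⟩
  · simpa [hk] using h
  · simp

lemma slot_injective : Function.Injective (slot I H) := by
  intro j j' h
  simp only [slot, Prod.mk.injEq, Fin.mk.injEq] at h
  rcases lt_trichotomy j j' with hlt | heq | hgt
  · exact absurd h.2 (wordIndex_lt_wordIndex I H hlt h.1).ne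
  · exact heq
  · exact absurd h.2.symm (wordIndex_lt_wordIndex I H hgt h.1.symm).ne

/-- The random words of one round: `s` words for every machine. -/
abbrev Row (n m s : ℕ) : Type := Fin (numMachines m s) → Fin s → Fin (wordCap n m s)

/-- The random words of a round as the lists that the machines receive. -/
def Row.words (σ : Row n m s) (k : Fin (numMachines m s)) : List ℕ :=
  List.ofFn fun t => (σ k t : ℕ)

lemma Row.hasLowWord_iff (σ : Row n m s) (j : Fin m) :
    HasLowWord I H σ.words θ j ↔ (σ (slot I H j).1 (slot I H j).2 : ℕ) < θ := by
  have := wordIndex_lt I H j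
  simp [HasLowWord, Row.words, List.getD_eq_getElem?_getD, this, slot]

instance (n m s : ℕ) : NeZero (wordCap n m s) := ⟨by unfold wordCap; omega⟩

open Classical in
lemma sum_pow_card_hasLowWord_le (hθ : θ ≤ wordCap n m s) (W : Finset (Fin m)) {z : ℝ}
    (hz : 0 ≤ z) :
    ∑ σ : Row n m s, z ^ #{j ∈ W | HasLowWord I H σ.words θ j} ≤
      Fintype.card (Row n m s) * Real.exp ((z - 1) * (#W * θ / wordCap n m s)) := by
  have hsum := sum_pow_card_le (B := wordCap n m s) (NeZero.pos _) hθ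
    (W.map ⟨slot I H, slot_injective I H⟩) hz
  rw [card_map] at hsum
  rw [← Fintype.card_congr (Equiv.curry _ _ _), ← Equiv.sum_comp (Equiv.curry _ _ _)]
  refine (sum_congr rfl fun ν _ => ?_).le.trans hsum
  congr 1
  rw [filter_map, card_map]
  congr 1
  exact filter_congr fun j _ => Row.hasLowWord_iff I H _ j

open Classical in
lemma card_large_sample_le (hθ : θ ≤ wordCap n m s) (hns : n ≤ s)
    (hU : #(uncovered I (order H) E) * θ ≤ 4 * s * wordCap n m s) :
    (#{σ : Row n m s | 9 * s < #(sampledSet I H E θ σ.words)} : ℝ) ≤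
      Real.exp (-n) * Fintype.card (Row n m s) := by
  have hB : (0 : ℝ) < wordCap n m s := by exact_mod_cast NeZero.pos (wordCap n m s)
  have hmarkov : (#{σ : Row n m s | 9 * s < #(sampledSet I H E θ σ.words)} : ℝ) * 2 ^ (9 * s) ≤
      Fintype.card (Row n m s) * Real.exp (4 * s) := by
    calc _ ≤ ∑ σ : Row n m s with 9 * s < #(sampledSet I H E θ σ.words),
            (2 : ℝ) ^ #(sampledSet I H E θ σ.words) := by
          rw [← nsmul_eq_mul]
          exact card_nsmul_le_sum _ _ _ fun σ hσ =>
            pow_le_pow_right₀ one_le_two (mem_filter.1 hσ).2.le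
      _ ≤ ∑ σ : Row n m s, (2 : ℝ) ^ #(sampledSet I H E θ σ.words) :=
          sum_le_sum_of_subset_of_nonneg (filter_subset _ _) fun _ _ _ => by positivity
      _ ≤ Fintype.card (Row n m s) *
            Real.exp ((2 - 1) * (#(uncovered I (order H) E) * θ / wordCap n m s)) :=
          sum_pow_card_hasLowWord_le I H hθ _ zero_le_two
      _ ≤ _ := by
          rw [show (2 : ℝ) - 1 = 1 by norm_num, one_mul]
          refine mul_le_mul_of_nonneg_left (Real.exp_le_exp.2 ?_) (Nat.cast_nonneg _)
          rw [div_le_iff₀ hB]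
          exact_mod_cast hU
  have hexp : Real.exp (4 * s) * Real.exp n ≤ 2 ^ (9 * s) := by
    rw [← Real.exp_log (show (0 : ℝ) < 2 ^ (9 * s) by positivity), Real.log_pow, ← Real.exp_add,
      Real.exp_le_exp]
    have hns' : (n : ℝ) ≤ s := by exact_mod_cast hns
    push_cast
    nlinarith [Real.log_two_gt_d9]
  rw [Real.exp_neg, inv_mul_eq_div, le_div_iff₀ (Real.exp_pos _)]
  refine le_of_mul_le_mul_right ?_ (Real.exp_pos (4 * s))
  calc _ = (#{σ : Row n m s | 9 * s < #(sampledSet I H E θ σ.words)} : ℝ) *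
          (Real.exp (4 * s) * Real.exp n) := by ring
    _ ≤ _ := by gcongr
    _ ≤ _ := hmarkov

/-- The elements that are not covered by the sets in `Y`. -/
def missed (Y : Finset (Fin n)) : Finset (Fin m) := {j | ∀ i ∈ I.T j, i ∉ Y}

lemma missed_chosen :
    missed I {i | (i : ℕ) ∈ chosen I (order H) E} = uncovered I (order H) E := by
  ext j
  simp only [missed, uncovered, mem_filter, mem_univ, true_and, mem_setsOf]
  constructor
  · rintro h _ ⟨i, hi, rfl⟩
    exact h i hi
  · exact fun h i hi => h i ⟨i, hi, rfl⟩

variable {I H} in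
lemma not_hasLowWord_of_mem_uncovered (hE : Recorded I (order H) E) {j : Fin m}
    (hj : j ∈ uncovered I (order H) (nextRecorded I H E (sampledSet I H E θ ρ))) :
    ¬ HasLowWord I H ρ θ j := by
  intro hlow
  have hrest := mem_filter.mp (hE.uncovered_record_subset (mem_byMachine _)
    (fun _ hT => eq_nil_or_eq_setsOf_of_mem_sampleMail hT) hj)
  exact hrest.2 (setsOf_mem_sampleMail I H (mem_filter.mpr ⟨hrest.1, hlow⟩))

open Classical in
lemma card_forall_not_hasLowWord_le (hθ : θ ≤ wordCap n m s) {W : Finset (Fin m)}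
    (hW : 2 * n * wordCap n m s ≤ #W * θ) :
    (#{σ : Row n m s | ∀ j ∈ W, ¬ HasLowWord I H σ.words θ j} : ℝ) ≤
      Fintype.card (Row n m s) * Real.exp (-(2 * n)) := by
  have hB : (0 : ℝ) < wordCap n m s := by exact_mod_cast NeZero.pos (wordCap n m s)
  calc (#{σ : Row n m s | ∀ j ∈ W, ¬ HasLowWord I H σ.words θ j} : ℝ)
      = ∑ σ : Row n m s, (0 : ℝ) ^ #{j ∈ W | HasLowWord I H σ.words θ j} := by
        simp only [zero_pow_eq, card_eq_zero, filter_eq_empty_iff, sum_boole]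
    _ ≤ Fintype.card (Row n m s) * Real.exp ((0 - 1) * (#W * θ / wordCap n m s)) :=
        sum_pow_card_hasLowWord_le I H hθ W le_rfl
    _ ≤ _ := by
        gcongr
        rw [zero_sub, neg_one_mul, neg_le_neg_iff, le_div_iff₀ hB]
        exact_mod_cast hW

lemma two_pow_le_exp (n : ℕ) : (2 : ℝ) ^ n ≤ Real.exp n := by
  rw [← mul_one (n : ℝ), Real.exp_nat_mul]
  gcongr
  linarith [Real.add_one_le_exp (1 : ℝ)]

open Classical in
/-- A union bound over the `2 ^ n` possible collections of chosen sets: each one that leaves many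
elements uncovered arises only if none of these elements is sampled. -/
lemma card_large_uncovered_le (hθ : θ ≤ wordCap n m s) (hE : Recorded I (order H) E) :
    (#{σ : Row n m s | 2 * n * wordCap n m s <
        #(uncovered I (order H) (nextRecorded I H E (sampledSet I H E θ σ.words))) * θ} : ℝ) ≤
      Real.exp (-n) * Fintype.card (Row n m s) := by
  let large : Finset (Finset (Fin n)) := {Y | 2 * n * wordCap n m s < #(missed I Y) * θ}
  let avoiding (Y : Finset (Fin n)) : Finset (Row n m s) :=
    {σ | ∀ j ∈ missed I Y, ¬ HasLowWord I H σ.words θ j}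
  have hsubset : ({σ | 2 * n * wordCap n m s <
      #(uncovered I (order H) (nextRecorded I H E (sampledSet I H E θ σ.words))) * θ} :
      Finset (Row n m s)) ⊆ large.biUnion avoiding := by
    intro σ hσ
    have hlarge := (mem_filter.1 hσ).2
    rw [← missed_chosen] at hlarge
    refine mem_biUnion.2 ⟨_, mem_filter.2 ⟨mem_univ _, hlarge⟩, mem_filter.2 ⟨mem_univ _, ?_⟩⟩
    rw [missed_chosen]
    exact fun j hj => not_hasLowWord_of_mem_uncovered hE hj
  calc _ ≤ (#(large.biUnion avoiding) : ℝ) := by exact_mod_cast card_le_card hsubset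
    _ ≤ ∑ Y ∈ large, (#(avoiding Y) : ℝ) := by exact_mod_cast card_biUnion_le
    _ ≤ #large • (Fintype.card (Row n m s) * Real.exp (-(2 * n))) :=
        sum_le_card_nsmul _ _ _ fun Y hY =>
          card_forall_not_hasLowWord_le I H hθ (mem_filter.1 hY).2.le
    _ ≤ Real.exp n * (Fintype.card (Row n m s) * Real.exp (-(2 * n))) := by
        rw [nsmul_eq_mul]
        gcongr
        refine le_trans ?_ (two_pow_le_exp n)
        exact_mod_cast (card_le_univ large).trans (by simp)
    _ = Real.exp (-n) * Fintype.card (Row n m s) := by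
        rw [show -(n : ℝ) = n + -(2 * n) by ring, Real.exp_add]
        ring

end Sampling

/-! ## The course of all phases -/

/-- The threshold in phase `p`. -/
def threshold (n m s : ℕ) : ℕ → ℕ
  | 0 => 4 * s * wordCap n m s / m
  | p + 1 => nextThreshold n m s (threshold n m s p)

/-- In phase `p₀`, for the first time, every random word is below the threshold, so that all
uncovered elements are sampled. -/
structure IsFinalPhase (n m s p₀ : ℕ) : Prop where
  lt : ∀ p < p₀, threshold n m s p < wordCap n m s
  le : wordCap n m s ≤ threshold n m s p₀

variable {p p₀ : ℕ}

lemma threshold_le (p : ℕ) : threshold n m s p ≤ 4 * s * wordCap n m s := by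
  induction p with
  | zero => exact Nat.div_le_self _ _
  | succ p ih => exact nextThreshold_le ih

lemma threshold_succ (h : threshold n m s p < wordCap n m s) :
    threshold n m s (p + 1) = 2 * s * threshold n m s p / n :=
  if_neg (not_le.mpr h)

lemma IsFinalPhase.wordCap_le (h : IsFinalPhase n m s p₀) (hp : p₀ ≤ p) :
    wordCap n m s ≤ threshold n m s p := by
  induction p, hp using Nat.le_induction with
  | base => exact h.le
  | succ p _ ih =>
    rw [threshold, nextThreshold]
    exact (if_pos ih).symm ▸ ih

section Phases

variable (I H) in
/-- The elements recorded before phase `p`, if a phase has `l` rounds and the random words of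
round `r` are `ρs r`. -/
noncomputable def recordedAt (l : ℕ) (ρs : ℕ → Fin (numMachines m s) → List ℕ) :
    ℕ → List (List ℕ)
  | 0 => []
  | p + 1 => nextRecorded I H (recordedAt l ρs p)
      (sampledSet I H (recordedAt l ρs p) (threshold n m s p) (ρs (p * l)))

variable (I H) in
/-- The elements sampled in phase `p`. -/
noncomputable def sampledAt (l : ℕ) (ρs : ℕ → Fin (numMachines m s) → List ℕ) (p : ℕ) :
    Finset (Fin m) :=
  sampledSet I H (recordedAt I H l ρs p) (threshold n m s p) (ρs (p * l))

variable (I H) in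
/-- The elements that are uncovered before phase `p`. -/
noncomputable def uncoveredAt (l : ℕ) (ρs : ℕ → Fin (numMachines m s) → List ℕ) (p : ℕ) :
    Finset (Fin m) :=
  uncovered I (order H) (recordedAt I H l ρs p)

variable {l : ℕ} {ρs : ℕ → Fin (numMachines m s) → List ℕ}

lemma recordedAt_congr {ρs' : ℕ → Fin (numMachines m s) → List ℕ}
    (h : ∀ p' < p, ρs (p' * l) = ρs' (p' * l)) :
    recordedAt I H l ρs p = recordedAt I H l ρs' p := by
  induction p with
  | zero => rfl
  | succ p ih => rw [recordedAt, recordedAt, ih fun p' hp' => h p' (by omega), h p (by omega)]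

lemma recorded_recordedAt (p : ℕ) : Recorded I (order H) (recordedAt I H l ρs p) := by
  induction p with
  | zero => exact Recorded.nil I _
  | succ p ih => exact ih.nextRecorded _

lemma IsWords.hasLowWord (hρ : IsWords n m s ρ) (hθ : wordCap n m s ≤ θ) (j : Fin m) :
    HasLowWord I H ρ θ j := by
  refine lt_of_lt_of_le ?_ hθ
  rw [List.getD_eq_getElem?_getD]
  by_cases hlt : wordIndex I H j < (ρ (H.elt j)).length
  · rw [List.getElem?_eq_getElem hlt]
    exact (hρ _).2 _ (List.getElem_mem hlt)
  · rw [List.getElem?_eq_none (not_lt.mp hlt)]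
    exact NeZero.pos _

lemma uncoveredAt_succ_eq_empty (hρ : ∀ r, IsWords n m s (ρs r))
    (h : wordCap n m s ≤ threshold n m s p) : uncoveredAt I H l ρs (p + 1) = ∅ :=
  eq_empty_of_forall_notMem fun j hj =>
    not_hasLowWord_of_mem_uncovered (recorded_recordedAt p) hj ((hρ _).hasLowWord h j)

/-- In the first `p₀` phases, no sample is too large, and each one leaves few elements uncovered. -/
def IsGood (I : SetCover n m) (H : Placement n m s) (l p₀ : ℕ)
    (ρs : ℕ → Fin (numMachines m s) → List ℕ) : Prop :=
  ∀ p < p₀, #(sampledAt I H l ρs p) ≤ 9 * s ∧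
    #(uncoveredAt I H l ρs (p + 1)) * threshold n m s p ≤ 2 * n * wordCap n m s

lemma card_uncoveredAt_zero_mul_le :
    #(uncoveredAt I H l ρs 0) * threshold n m s 0 ≤ 4 * s * wordCap n m s :=
  (Nat.mul_le_mul_right _ ((card_le_univ _).trans (by simp))).trans (Nat.mul_div_le _ _)

lemma card_uncoveredAt_succ_mul_le (hθ : threshold n m s p < wordCap n m s)
    (h : #(uncoveredAt I H l ρs (p + 1)) * threshold n m s p ≤ 2 * n * wordCap n m s) :
    #(uncoveredAt I H l ρs (p + 1)) * threshold n m s (p + 1) ≤ 4 * s * wordCap n m s := by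
  rw [threshold_succ hθ]
  refine (Nat.mul_div_le_mul_div_assoc _ _ _).trans (Nat.div_le_of_le_mul ?_)
  nlinarith

lemma IsGood.card_uncoveredAt_mul_le (h : IsGood I H l p₀ ρs) (hρ : ∀ r, IsWords n m s (ρs r))
    (hp₀ : IsFinalPhase n m s p₀) (p : ℕ) :
    #(uncoveredAt I H l ρs p) * threshold n m s p ≤ 4 * s * wordCap n m s := by
  cases p with
  | zero => exact card_uncoveredAt_zero_mul_le
  | succ p =>
    by_cases hp : p < p₀
    · exact card_uncoveredAt_succ_mul_le (hp₀.lt p hp) (h p hp).2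
    · rw [uncoveredAt_succ_eq_empty hρ (hp₀.wordCap_le (not_lt.mp hp))]
      simp

lemma IsGood.card_sampledAt_le (h : IsGood I H l p₀ ρs) (hρ : ∀ r, IsWords n m s (ρs r))
    (hp₀ : IsFinalPhase n m s p₀) (p : ℕ) : #(sampledAt I H l ρs p) ≤ 9 * s := by
  by_cases hp : p < p₀
  · exact (h p hp).1
  · have huncovered : #(uncoveredAt I H l ρs p) ≤ 4 * s :=
      Nat.le_of_mul_le_mul_right ((Nat.mul_le_mul_left _ (hp₀.wordCap_le (not_lt.mp hp))).trans
        (h.card_uncoveredAt_mul_le hρ hp₀ p)) (NeZero.pos _)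
    have hsampled : #(sampledAt I H l ρs p) ≤ #(uncoveredAt I H l ρs p) :=
      card_le_card (filter_subset _ _)
    omega

variable {Cs : ℕ → Config randomizedLocalRatio (numMachines m s)} {L : ℕ}

lemma IsGood.atSample (h : IsGood I H (3 * L + 3) p₀ ρs) (hp₀ : IsFinalPhase n m s p₀)
    (hrun : IsRun n Cs ρs) (hm : 1 ≤ m) (hns : n ≤ s)
    (hstart : Cs 0 = ⟨fun k => Code.init.eval (localInput I H k), fun _ => []⟩)
    (hL : ∀ i < L, s ^ i < numMachines m s) (hL' : numMachines m s ≤ s ^ L) (p : ℕ) :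
    AtSample I H (Cs (p * (3 * L + 3))) (threshold n m s p) (recordedAt I H (3 * L + 3) ρs p) := by
  induction p with
  | zero =>
    refine ⟨1, fun _ => [], ?_, ?_, fun k => ?_⟩
    · rw [zero_mul, hstart, configuration]
      simp only [recordedAt, ite_self]
      rfl
    · have := mul_add_lt_wordCap_sq n m s
      omega
    · rw [recordedAt, chosen_nil (mem_byMachine _)]
  | succ p ih =>
    have hnext := (ih.phase hrun hm hns (recorded_recordedAt p) (threshold_le p)
      (h.card_sampledAt_le hrun.isWords hp₀ p) hL hL').2
    rwa [← Nat.succ_mul] at hnext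

lemma IsGood.fits_and_shows (h : IsGood I H (3 * L + 3) p₀ ρs) (hp₀ : IsFinalPhase n m s p₀)
    (hrun : IsRun n Cs ρs) (hm : 1 ≤ m) (hns : n ≤ s)
    (hstart : Cs 0 = ⟨fun k => Code.init.eval (localInput I H k), fun _ => []⟩)
    (hL : ∀ i < L, s ^ i < numMachines m s) (hL' : numMachines m s ≤ s ^ L) (r : ℕ) :
    Fits I (Cs r) (ρs r) ∧ ((p₀ + 1) * (3 * L + 3) ≤ r → ∃ E, Recorded I (order H) E ∧
      uncovered I (order H) E = ∅ ∧ Shows I H (Cs r) E) := by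
  set p := r / (3 * L + 3)
  obtain ⟨hfits, hshows⟩ := ((h.atSample hp₀ hrun hm hns hstart hL hL' p).phase hrun hm hns
    (recorded_recordedAt p) (threshold_le p) (h.card_sampledAt_le hrun.isWords hp₀ p) hL hL').1
    (r % (3 * L + 3)) (Nat.mod_lt _ (by omega))
  rw [Nat.div_add_mod'] at hfits hshows
  refine ⟨hfits, fun hr => ?_⟩
  have hp : p₀ + 1 ≤ p := (Nat.le_div_iff_mul_le (by omega)).mpr hr
  have hempty (p') (hp' : p₀ + 1 ≤ p') : uncoveredAt I H (3 * L + 3) ρs p' = ∅ := by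
    obtain ⟨q, rfl⟩ := Nat.exists_eq_add_of_le' (show 1 ≤ p' by omega)
    exact uncoveredAt_succ_eq_empty hrun.isWords (hp₀.wordCap_le (by omega))
  rcases hshows with hbefore | hafter
  · exact ⟨_, recorded_recordedAt _, hempty _ hp, hbefore⟩
  · exact ⟨_, recorded_recordedAt (p + 1), hempty _ (by omega), hafter⟩

end Phases

/-! ## The success probability -/

section SuccessProbability

variable {R : ℕ}

lemma Tape.words_of_lt (ω : Tape n m s R) {r : ℕ} (h : r < R) :
    ω.words r = Row.words (ω ⟨r, h⟩) := by
  funext k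
  rw [Tape.words, dif_pos h]
  rfl

lemma Tape.isWords (ω : Tape n m s R) (r : ℕ) : IsWords n m s (ω.words r) := by
  intro k
  rw [Tape.words]
  split_ifs with h
  · refine ⟨by simp, fun x hx => ?_⟩
    rw [List.mem_ofFn] at hx
    obtain ⟨t, rfl⟩ := hx
    exact Fin.is_lt _
  · simp

lemma Tape.words_update_self (ω : Tape n m s R) {r : ℕ} (hr : r < R) (σ : Row n m s) :
    Tape.words (Function.update ω ⟨r, hr⟩ σ) r = σ.words := by
  rw [Tape.words_of_lt _ hr, Function.update_self]

lemma Tape.words_update_of_ne (ω : Tape n m s R) {r r' : ℕ} (hr : r < R) (h : r' ≠ r)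
    (σ : Row n m s) : Tape.words (Function.update ω ⟨r, hr⟩ σ) r' = ω.words r' := by
  funext k
  rw [Tape.words, Tape.words]
  split_ifs with hr'
  · rw [Function.update_of_ne]
    simpa [Fin.ext_iff] using h
  · rfl

variable {l : ℕ}

lemma recordedAt_update (ω : Tape n m s R) (hl : 0 < l) (hp : p * l < R) (σ : Row n m s) :
    recordedAt I H l (Tape.words (Function.update ω ⟨p * l, hp⟩ σ)) p =
      recordedAt I H l ω.words p :=
  recordedAt_congr fun _ hp' => ω.words_update_of_ne hp (Nat.mul_lt_mul_of_pos_right hp' hl).ne σ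

variable (I H) in
open Classical in
lemma card_large_sampledAt_le (hns : n ≤ s) (hl : 0 < l) (hθ : threshold n m s p ≤ wordCap n m s)
    (hp : p * l < R) :
    (#{ω : Tape n m s R |
        #(uncoveredAt I H l ω.words p) * threshold n m s p ≤ 4 * s * wordCap n m s ∧
          9 * s < #(sampledAt I H l ω.words p)} : ℝ) ≤
      Real.exp (-n) * Fintype.card (Tape n m s R) := by
  refine card_filter_le_of_update ⟨p * l, hp⟩ _ fun (ω : Tape n m s R) => ?_
  simp only [uncoveredAt, sampledAt, recordedAt_update ω hl hp, Tape.words_update_self]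
  by_cases hU : #(uncovered I (order H) (recordedAt I H l ω.words p)) * threshold n m s p ≤
    4 * s * wordCap n m s
  · simp only [hU, true_and]
    exact card_large_sample_le I H hθ hns hU
  · simp only [hU, false_and, filter_false, card_empty, Nat.cast_zero]
    positivity

variable (I H) in
open Classical in
lemma card_large_uncoveredAt_le (hl : 0 < l) (hθ : threshold n m s p ≤ wordCap n m s)
    (hp : p * l < R) :
    (#{ω : Tape n m s R | 2 * n * wordCap n m s <
        #(uncoveredAt I H l ω.words (p + 1)) * threshold n m s p} : ℝ) ≤
      Real.exp (-n) * Fintype.card (Tape n m s R) := by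
  refine card_filter_le_of_update ⟨p * l, hp⟩ _ fun (ω : Tape n m s R) => ?_
  simp only [uncoveredAt, recordedAt, recordedAt_update ω hl hp, Tape.words_update_self]
  exact card_large_uncovered_le I H hθ (recorded_recordedAt p)

variable (I H) in
open Classical in
lemma card_not_isGood_le (hns : n ≤ s) (hl : 0 < l) (hp₀ : IsFinalPhase n m s p₀)
    (hR : p₀ * l ≤ R) :
    (#{ω : Tape n m s R | ¬ IsGood I H l p₀ ω.words} : ℝ) ≤
      2 * p₀ * Real.exp (-n) * Fintype.card (Tape n m s R) := by
  let largeSample (p : ℕ) : Finset (Tape n m s R) :=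
    {ω | #(uncoveredAt I H l ω.words p) * threshold n m s p ≤ 4 * s * wordCap n m s ∧
      9 * s < #(sampledAt I H l ω.words p)}
  let largeRest (p : ℕ) : Finset (Tape n m s R) :=
    {ω | 2 * n * wordCap n m s < #(uncoveredAt I H l ω.words (p + 1)) * threshold n m s p}
  have hsubset : ({ω | ¬ IsGood I H l p₀ ω.words} : Finset (Tape n m s R)) ⊆
      (range p₀).biUnion fun p => largeSample p ∪ largeRest p := by
    intro ω hω
    by_contra hnot
    simp only [mem_biUnion, mem_range, mem_union, mem_filter, mem_univ, true_and, largeSample,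
      largeRest, not_exists, not_and, not_or, not_lt] at hnot hω
    refine hω fun p hp => ⟨(hnot p hp).1 ?_, (hnot p hp).2⟩
    cases p with
    | zero => exact card_uncoveredAt_zero_mul_le
    | succ p => exact card_uncoveredAt_succ_mul_le (hp₀.lt p (by omega)) (hnot p (by omega)).2
  calc _ ≤ (#((range p₀).biUnion fun p => largeSample p ∪ largeRest p) : ℝ) := by
        exact_mod_cast card_le_card hsubset
    _ ≤ ∑ p ∈ range p₀, (#(largeSample p ∪ largeRest p) : ℝ) := by exact_mod_cast card_biUnion_le
    _ ≤ ∑ _p ∈ range p₀, 2 * (Real.exp (-n) * Fintype.card (Tape n m s R)) := by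
        refine sum_le_sum fun p hp => ?_
        have hp := mem_range.1 hp
        have hpR : p * l < R := (Nat.mul_lt_mul_of_pos_right hp hl).trans_le hR
        have hunion : (#(largeSample p ∪ largeRest p) : ℝ) ≤ #(largeSample p) + #(largeRest p) := by
          exact_mod_cast card_union_le _ _
        linarith [card_large_sampledAt_le I H hns hl (hp₀.lt p hp).le hpR,
          card_large_uncoveredAt_le I H hl (hp₀.lt p hp).le hpR]
    _ = 2 * p₀ * Real.exp (-n) * Fintype.card (Tape n m s R) := by
        rw [sum_const, card_range, nsmul_eq_mul]
        ring

/-- On inputs of size at most `N`, the algorithm stays within memory `σ` and local time `τ`. -/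
structure Affords (n m s N : ℕ) (σ τ : ℝ) : Prop where
  init x : inputTy.size (wordCap n m s) x ≤ N →
    (randomizedLocalRatio.init.space (wordCap n m s) x : ℝ) ≤ σ ∧
      (randomizedLocalRatio.init.time x : ℝ) ≤ τ
  step x : stepInputTy.size (wordCap n m s) x ≤ N → Code.Admissible (wordCap n m s) N x →
    (randomizedLocalRatio.step.space (wordCap n m s) x : ℝ) ≤ σ ∧
      (randomizedLocalRatio.step.time x : ℝ) ≤ τ
  output x : stateTy.size (wordCap n m s) x ≤ N →
    (randomizedLocalRatio.output.space (wordCap n m s) x : ℝ) ≤ σ ∧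
      (randomizedLocalRatio.output.time x : ℝ) ≤ τ

variable {L : ℕ} {σ τ : ℝ}

lemma IsGood.respects_and_isApprox {ω : Tape n m s R} (h : IsGood I H (3 * L + 3) p₀ ω.words)
    (hp₀ : IsFinalPhase n m s p₀) (hm : 1 ≤ m) (hns : n ≤ s)
    (hL : ∀ i < L, s ^ i < numMachines m s) (hL' : numMachines m s ≤ s ^ L)
    (hR : (p₀ + 1) * (3 * L + 3) ≤ R) (hafford : Affords n m s (sizeBound I s) σ τ) :
    randomizedLocalRatio.Respects I H ω σ τ ∧
      I.IsApprox I.maxFreq (randomizedLocalRatio.result I H ω) := by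
  have hrun := h.fits_and_shows (Cs := randomizedLocalRatio.run I H ω) hp₀
    ⟨fun _ => rfl, ω.isWords⟩ hm hns rfl hL hL'
  refine ⟨⟨fun k => hafford.init _ ?_, fun r _ k => ?_, hafford.output _ ?_⟩, ?_⟩
  · refine (size_localInput_le I H hm k).trans ?_
    have hn := one_le_of_feasible I hm
    have hf := Nat.mul_le_mul_left s (one_le_maxFreq I hm)
    unfold sizeBound
    nlinarith
  · exact hafford.step _ ((hrun r).1 k).1 ((hrun r).1 k).2
  · refine le_trans ?_ ((hrun R).1 0).1
    rw [Algorithm.stepInput, size_prod]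
    exact Nat.le_add_right _ _
  · obtain ⟨E, hE, hU, hX⟩ := (hrun R).2 hR
    refine hE.isApprox (mem_byMachine _) hU fun i => ?_
    rw [← hX.mem_iff, Algorithm.result, mem_filter]
    simp only [mem_univ, true_and, Code.eval_comp, Code.eval_prim, Prim.eval]

theorem one_sub_le_successProb (I : SetCover n m) (H : Placement n m s) (hm : 1 ≤ m) (hns : n ≤ s)
    (hp₀ : IsFinalPhase n m s p₀) (hL : numMachines m s ≤ s ^ L)
    (hR : (p₀ + 1) * (3 * L + 3) ≤ R) (hafford : Affords n m s (sizeBound I s) σ τ) :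
    1 - 2 * p₀ * Real.exp (-n) ≤ randomizedLocalRatio.successProb I H R σ τ I.maxFreq := by
  classical
  have hexists : ∃ L, numMachines m s ≤ s ^ L := ⟨L, hL⟩
  obtain ⟨L₀, hle, hlow, hhigh⟩ : ∃ L₀ ≤ L, (∀ i < L₀, s ^ i < numMachines m s) ∧
      numMachines m s ≤ s ^ L₀ :=
    ⟨Nat.find hexists, Nat.find_min' _ hL, fun _ hi => not_le.1 (Nat.find_min hexists hi),
      Nat.find_spec hexists⟩
  have hR₀ : (p₀ + 1) * (3 * L₀ + 3) ≤ R := le_trans (by gcongr) hR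
  have hbad := card_not_isGood_le I H (l := 3 * L₀ + 3) (R := R) hns (by omega) hp₀ (by nlinarith)
  have hgood : (#{ω : Tape n m s R | IsGood I H (3 * L₀ + 3) p₀ ω.words} : ℝ) ≤
      #{ω : Tape n m s R | randomizedLocalRatio.Respects I H ω σ τ ∧
        I.IsApprox I.maxFreq (randomizedLocalRatio.result I H ω)} := by
    exact_mod_cast card_le_card (monotone_filter_right _ fun ω _ hω =>
      IsGood.respects_and_isApprox hω hp₀ hm hns hlow hhigh hR₀ hafford)
  have hsum : (#{ω : Tape n m s R | IsGood I H (3 * L₀ + 3) p₀ ω.words} : ℝ) +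
      #{ω : Tape n m s R | ¬ IsGood I H (3 * L₀ + 3) p₀ ω.words} =
      Fintype.card (Tape n m s R) := by
    exact_mod_cast card_filter_add_card_filter_not (s := univ) _
  rw [Algorithm.successProb, Nat.card_eq_fintype_card, Nat.card_eq_fintype_card,
    Fintype.card_subtype, le_div_iff₀ (by exact_mod_cast Fintype.card_pos)]
  linarith

end SuccessProbability

/-! ## Numerical bounds -/

section Numerics

variable {c μ : ℝ}

lemma le_memUnit (n : ℕ) (μ : ℝ) : (n : ℝ) ^ (1 + μ) ≤ memUnit n μ := Nat.le_ceil _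

lemma le_memUnit_of_pos (hn : 1 ≤ n) (hμ : 0 < μ) : n ≤ memUnit n μ := by
  have hn' : (1 : ℝ) ≤ n := by exact_mod_cast hn
  exact_mod_cast (Real.self_le_rpow_of_one_le hn' (by linarith)).trans (le_memUnit n μ)

lemma memUnit_le (hn : 1 ≤ n) (hμ : 0 < μ) : (memUnit n μ : ℝ) ≤ 2 * (n : ℝ) ^ (1 + μ) := by
  have hn' : (1 : ℝ) ≤ n := by exact_mod_cast hn
  have hpow : (1 : ℝ) ≤ (n : ℝ) ^ (1 + μ) := Real.one_le_rpow hn' (by linarith)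
  have hceil := Nat.ceil_lt_add_one (zero_le_one.trans hpow)
  unfold memUnit
  linarith

lemma le_mul_floor_div_add_one (hμ : 0 < μ) : c ≤ μ * (⌊c / μ⌋₊ + 1) := by
  rw [← div_le_iff₀' hμ]
  exact (Nat.lt_floor_add_one _).le

lemma numMachines_le_memUnit_pow (hn : 1 ≤ n) (hμ : 0 < μ) (hm : 1 ≤ m)
    (hmn : (m : ℝ) ≤ (n : ℝ) ^ (1 + c)) :
    numMachines m (memUnit n μ) ≤ memUnit n μ ^ (⌊c / μ⌋₊ + 1) := by
  have hn' : (1 : ℝ) ≤ n := by exact_mod_cast hn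
  refine (numMachines_le hm).trans ?_
  suffices hreal : (m : ℝ) ≤ (memUnit n μ : ℝ) ^ (⌊c / μ⌋₊ + 1) by exact_mod_cast hreal
  calc (m : ℝ) ≤ (n : ℝ) ^ (1 + c) := hmn
    _ ≤ (n : ℝ) ^ ((1 + μ) * ((⌊c / μ⌋₊ + 1 : ℕ) : ℝ)) := by
        refine Real.rpow_le_rpow_of_exponent_le hn' ?_
        push_cast
        nlinarith [le_mul_floor_div_add_one (c := c) hμ, Nat.cast_nonneg (α := ℝ) ⌊c / μ⌋₊]
    _ = ((n : ℝ) ^ (1 + μ)) ^ (⌊c / μ⌋₊ + 1) := by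
        rw [Real.rpow_mul (by linarith), Real.rpow_natCast]
    _ ≤ _ := pow_le_pow_left₀ (by positivity) (le_memUnit n μ) _

lemma numMachines_le_self (hm : 1 ≤ m) (h : m ≤ s ^ 2) : numMachines m s ≤ s := by
  unfold numMachines
  have hs : 0 < s := Nat.pos_of_ne_zero fun hs => by simp [hs] at h; omega
  have : (m - 1) / s < s := by
    rw [Nat.div_lt_iff_lt_mul hs, ← sq]
    omega
  omega

lemma div_le_cast_div {a b : ℕ} (hb : 0 < b) (h : b ≤ a) : (a : ℝ) / (2 * b) ≤ (a / b : ℕ) := by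
  have hquotient : 1 ≤ a / b := (Nat.one_le_div_iff hb).mpr h
  have hlt : a ≤ 2 * b * (a / b) := by
    have := Nat.div_add_mod a b
    have := Nat.mod_lt a hb
    nlinarith
  rw [div_le_iff₀' (by positivity)]
  exact_mod_cast hlt

lemma wordCap_mul_le_threshold_zero (hn : 1 ≤ n) (hm : 1 ≤ m) (hmn : (m : ℝ) ≤ (n : ℝ) ^ (1 + c))
    (hs : (n : ℝ) ^ (1 + μ) ≤ s) : wordCap n m s * (n : ℝ) ^ (μ - c) ≤ threshold n m s 0 := by
  have hn' : (0 : ℝ) < n := by exact_mod_cast hn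
  have hs' : 1 ≤ s := by
    have : (0 : ℝ) < s := lt_of_lt_of_le (by positivity) hs
    exact_mod_cast this
  have hmcap : m ≤ 4 * s * wordCap n m s := by
    unfold wordCap
    nlinarith
  have hload : (n : ℝ) ^ (μ - c) * m ≤ s := by
    calc (n : ℝ) ^ (μ - c) * m ≤ (n : ℝ) ^ (μ - c) * (n : ℝ) ^ (1 + c) := by gcongr
      _ = (n : ℝ) ^ (1 + μ) := by rw [← Real.rpow_add hn']; congr 1; ring
      _ ≤ s := hs
  refine le_trans ?_ (div_le_cast_div hm hmcap)
  rw [le_div_iff₀ (by positivity)]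
  push_cast
  calc (wordCap n m s : ℝ) * (n : ℝ) ^ (μ - c) * (2 * m)
      = 2 * wordCap n m s * ((n : ℝ) ^ (μ - c) * m) := by ring
    _ ≤ 2 * wordCap n m s * s := by gcongr
    _ ≤ 4 * s * wordCap n m s := by nlinarith [Nat.cast_nonneg (α := ℝ) (wordCap n m s * s)]

lemma mul_threshold_le_threshold_succ (hn : 1 ≤ n) (hns : n ≤ s)
    (hlt : threshold n m s p < wordCap n m s) (hpos : 1 ≤ threshold n m s p) :
    (s / n : ℝ) * threshold n m s p ≤ threshold n m s (p + 1) := by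
  rw [threshold_succ hlt]
  refine le_trans (le_of_eq ?_) (div_le_cast_div hn (by nlinarith))
  push_cast
  field_simp

lemma wordCap_mul_le_threshold (hn : 1 ≤ n) (hμ : 0 < μ) (hm : 1 ≤ m)
    (hmn : (m : ℝ) ≤ (n : ℝ) ^ (1 + c))
    (hlow : ∀ r < p, threshold n m (memUnit n μ) r < wordCap n m (memUnit n μ)) :
    wordCap n m (memUnit n μ) * ((n : ℝ) ^ (μ - c) * ((n : ℝ) ^ μ) ^ p) ≤
      threshold n m (memUnit n μ) p := by
  have hn' : (0 : ℝ) < n := by exact_mod_cast hn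
  have hs := le_memUnit n μ
  have hns := le_memUnit_of_pos hn hμ
  have hcap : 0 < wordCap n m (memUnit n μ) := Nat.succ_pos _
  generalize memUnit n μ = s at *
  induction p with
  | zero => simpa using wordCap_mul_le_threshold_zero hn hm hmn hs
  | succ p ih =>
    have hp := ih fun r hr => hlow r (hr.trans p.lt_succ_self)
    have hpos : 1 ≤ threshold n m s p := by
      have : (0 : ℝ) < threshold n m s p := lt_of_lt_of_le (by positivity) hp
      exact_mod_cast this
    have hgrowth : (n : ℝ) ^ μ ≤ s / n := by
      rwa [le_div_iff₀ hn', ← Real.rpow_add_one hn'.ne', add_comm]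
    calc (wordCap n m s : ℝ) * ((n : ℝ) ^ (μ - c) * ((n : ℝ) ^ μ) ^ (p + 1))
        = (n : ℝ) ^ μ * (wordCap n m s * ((n : ℝ) ^ (μ - c) * ((n : ℝ) ^ μ) ^ p)) := by ring
      _ ≤ s / n * threshold n m s p := by gcongr
      _ ≤ threshold n m s (p + 1) :=
          mul_threshold_le_threshold_succ hn hns (hlow p p.lt_succ_self) hpos

lemma exists_isFinalPhase (hn : 1 ≤ n) (hμ : 0 < μ) (hm : 1 ≤ m)
    (hmn : (m : ℝ) ≤ (n : ℝ) ^ (1 + c)) :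
    ∃ p₀ ≤ ⌊c / μ⌋₊, IsFinalPhase n m (memUnit n μ) p₀ := by
  classical
  have hn' : (1 : ℝ) ≤ n := by exact_mod_cast hn
  obtain ⟨p, hp, hle⟩ :
      ∃ p ≤ ⌊c / μ⌋₊, wordCap n m (memUnit n μ) ≤ threshold n m (memUnit n μ) p := by
    by_contra! hlow
    refine (hlow _ le_rfl).not_ge ?_
    have hgrown := wordCap_mul_le_threshold hn hμ hm hmn fun r hr => hlow r (le_of_lt hr)
    have hfactor : (1 : ℝ) ≤ (n : ℝ) ^ (μ - c) * ((n : ℝ) ^ μ) ^ ⌊c / μ⌋₊ := by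
      rw [← Real.rpow_natCast, ← Real.rpow_mul (by linarith), ← Real.rpow_add (by linarith)]
      refine Real.one_le_rpow hn' ?_
      linarith [le_mul_floor_div_add_one (c := c) hμ]
    exact_mod_cast (le_mul_of_one_le_right (Nat.cast_nonneg _) hfactor).trans hgrown
  have hexists : ∃ p, wordCap n m (memUnit n μ) ≤ threshold n m (memUnit n μ) p := ⟨p, hle⟩
  exact ⟨Nat.find hexists, (Nat.find_min' hexists hle).trans hp,
    fun _ hr => not_le.1 (Nat.find_min hexists hr), Nat.find_spec hexists⟩

lemma mul_sizeBound_le (I : SetCover n m) (hn : 1 ≤ n) (hμ : 0 < μ) (C : ℕ) :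
    ((C * sizeBound I (memUnit n μ) : ℕ) : ℝ) ≤ 120 * C * (I.maxFreq * (n : ℝ) ^ (1 + μ)) := by
  unfold sizeBound
  push_cast
  calc (C : ℝ) * (60 * (I.maxFreq * memUnit n μ))
      ≤ C * (60 * (I.maxFreq * (2 * (n : ℝ) ^ (1 + μ)))) := by
        gcongr
        exact memUnit_le hn hμ
    _ = 120 * C * (I.maxFreq * (n : ℝ) ^ (1 + μ)) := by ring

lemma mul_sizeBound_add_one_le_wordCap_pow (I : SetCover n m) (s C : ℕ) :
    C * sizeBound I s + 1 ≤ wordCap n m s ^ (60 * C + 3) := by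
  have hcap : 2 ≤ wordCap n m s := Nat.le_add_left _ _
  have hproduct : I.maxFreq * s ≤ wordCap n m s ^ 2 := by
    rw [sq]
    have := I.maxFreq_le
    exact Nat.mul_le_mul (by unfold wordCap; omega) (by unfold wordCap; omega)
  calc C * sizeBound I s + 1 = 60 * C * (I.maxFreq * s) + 1 := by unfold sizeBound; ring
    _ ≤ 60 * C * wordCap n m s ^ 2 + wordCap n m s ^ 2 := by
        gcongr
        exact Nat.one_le_pow _ _ (by omega)
    _ = (60 * C + 1) * wordCap n m s ^ 2 := by ring
    _ ≤ 2 ^ (60 * C + 1) * wordCap n m s ^ 2 := by gcongr; exact Nat.lt_two_pow_self.le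
    _ ≤ wordCap n m s ^ (60 * C + 1) * wordCap n m s ^ 2 := by gcongr
    _ = wordCap n m s ^ (60 * C + 3) := by rw [← pow_add]

lemma Code.Cost.space_le_and_time_le {p : Code a b} {x : a.den} {C K : ℕ}
    (h : p.Cost (wordCap n m (memUnit n μ)) (C * sizeBound I (memUnit n μ)) C x)
    (hn : 1 ≤ n) (hμ : 0 < μ) (hspace : 120 * C ≤ K) (htime : (60 * C + 3) * C ≤ K) :
    (p.space (wordCap n m (memUnit n μ)) x : ℝ) ≤ K * (I.maxFreq * (n : ℝ) ^ (1 + μ)) ∧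
      (p.time x : ℝ) ≤ (wordCap n m (memUnit n μ) : ℝ) ^ K := by
  constructor
  · calc (p.space (wordCap n m (memUnit n μ)) x : ℝ)
        ≤ (C * sizeBound I (memUnit n μ) : ℕ) := by exact_mod_cast h.space_le
      _ ≤ 120 * C * (I.maxFreq * (n : ℝ) ^ (1 + μ)) := mul_sizeBound_le I hn hμ C
      _ ≤ K * (I.maxFreq * (n : ℝ) ^ (1 + μ)) := by gcongr; exact_mod_cast hspace
  · suffices p.time x ≤ wordCap n m (memUnit n μ) ^ K by exact_mod_cast this
    calc p.time x ≤ (C * sizeBound I (memUnit n μ) + 1) ^ C := h.time_le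
      _ ≤ (wordCap n m (memUnit n μ) ^ (60 * C + 3)) ^ C := by
          gcongr
          exact mul_sizeBound_add_one_le_wordCap_pow I _ C
      _ = wordCap n m (memUnit n μ) ^ ((60 * C + 3) * C) := (pow_mul _ _ _).symm
      _ ≤ wordCap n m (memUnit n μ) ^ K := Nat.pow_le_pow_right (Nat.succ_pos _) htime

lemma exists_affords : ∃ K : ℕ, 18 ≤ K ∧ ∀ (n m : ℕ) (μ : ℝ) (I : SetCover n m), 1 ≤ n → 0 < μ →
    Affords n m (memUnit n μ) (sizeBound I (memUnit n μ)) (K * (I.maxFreq * (n : ℝ) ^ (1 + μ)))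
      ((wordCap n m (memUnit n μ) : ℝ) ^ K) := by
  obtain ⟨Cinit, hinit⟩ := Code.Efficient.efficientOn (p := randomizedLocalRatio.init)
  obtain ⟨Cstep, hstep⟩ := Code.efficientOn_step
  obtain ⟨Cout, hout⟩ := Code.Efficient.efficientOn (p := randomizedLocalRatio.output)
  set C := Cinit + Cstep + Cout
  refine ⟨120 * C + (60 * C + 3) * C + 18, by omega, fun n m μ I hn hμ => ?_⟩
  have hcap : 2 ≤ wordCap n m (memUnit n μ) := Nat.le_add_left _ _
  have hbound {a b : Ty} {p : Code a b} {x : a.den} {C' : ℕ} (hC' : C' ≤ C)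
      (h : p.Cost (wordCap n m (memUnit n μ)) (C' * sizeBound I (memUnit n μ)) C' x) :=
    (h.mono (Nat.mul_le_mul_right _ hC') hC').space_le_and_time_le
      (K := 120 * C + (60 * C + 3) * C + 18) hn hμ (by omega) (by omega)
  exact ⟨fun x hx => hbound (by omega) (hinit _ hcap _ x hx trivial),
    fun x hx hx' => hbound (by omega) (hstep _ hcap _ x hx hx'),
    fun x hx => hbound (by omega) (hout _ hcap _ x hx trivial)⟩

section Rounds

variable {K : ℕ} {x : ℝ}

lemma add_one_mul_le_floor (hK : 18 ≤ K) (hx : 1 ≤ x) (hp : p₀ ≤ ⌊x⌋₊) :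
    (p₀ + 1) * (3 * 1 + 3) ≤ ⌊K * x⌋₊ := by
  refine Nat.le_floor ?_
  have hpx : (p₀ : ℝ) ≤ x := (Nat.le_floor_iff (by linarith)).1 hp
  have hK' : (18 : ℝ) ≤ K := by exact_mod_cast hK
  push_cast
  nlinarith

lemma add_one_mul_le_floor_sq (hK : 18 ≤ K) (hx : 1 ≤ x) (hp : p₀ ≤ ⌊x⌋₊) :
    (p₀ + 1) * (3 * (⌊x⌋₊ + 1) + 3) ≤ ⌊K * x ^ 2⌋₊ := by
  refine Nat.le_floor ?_
  have hpx : (p₀ : ℝ) ≤ x := (Nat.le_floor_iff (by linarith)).1 hp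
  have hfloor : (⌊x⌋₊ : ℝ) ≤ x := Nat.floor_le (by linarith)
  have hK' : (18 : ℝ) ≤ K := by exact_mod_cast hK
  push_cast
  calc ((p₀ : ℝ) + 1) * (3 * (⌊x⌋₊ + 1) + 3) ≤ (x + x) * (3 * (x + x) + 3 * x) := by
        gcongr
        linarith
    _ = 18 * x ^ 2 := by ring
    _ ≤ K * x ^ 2 := by gcongr

end Rounds

end Numerics

end MapReduce

theorem mainTheorem2 :
    ∃ (P : MapReduce.Algorithm) (K : ℕ), ∀ (c μ : ℝ), 0 < μ → μ < c →
      ∀ (n m : ℕ) (I : SetCover n m), 1 ≤ m → (m : ℝ) ≤ (n : ℝ) ^ (1 + c) →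
      ∀ H : MapReduce.Placement n m (MapReduce.memUnit n μ),
        (I.IsVertexCoverInstance →
          1 - K * (c / μ) * Real.exp (-(n : ℝ)) ≤
            P.successProb I H ⌊K * (c / μ)⌋₊
              (K * (I.maxFreq * (n : ℝ) ^ (1 + μ)))
              ((MapReduce.wordCap n m (MapReduce.memUnit n μ) : ℝ) ^ K) I.maxFreq) ∧
        1 - K * (c / μ) * Real.exp (-(n : ℝ)) ≤
          P.successProb I H ⌊K * (c / μ) ^ 2⌋₊
            (K * (I.maxFreq * (n : ℝ) ^ (1 + μ)))
            ((MapReduce.wordCap n m (MapReduce.memUnit n μ) : ℝ) ^ K) I.maxFreq := by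
  obtain ⟨K, hK, hafford⟩ := MapReduce.exists_affords
  refine ⟨MapReduce.randomizedLocalRatio, K, fun c μ hμ hc n m I hm hmn H => ?_⟩
  have hn := MapReduce.one_le_of_feasible I hm
  have hns := MapReduce.le_memUnit_of_pos hn hμ
  have hratio : 1 ≤ c / μ := (one_le_div hμ).2 hc.le
  obtain ⟨p₀, hp₀, hfinal⟩ := MapReduce.exists_isFinalPhase hn hμ hm hmn
  have hfailure : 2 * p₀ * Real.exp (-(n : ℝ)) ≤ K * (c / μ) * Real.exp (-(n : ℝ)) := by
    have hK' : (18 : ℝ) ≤ K := by exact_mod_cast hK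
    have : (p₀ : ℝ) ≤ c / μ := (Nat.le_floor_iff (by linarith)).1 hp₀
    gcongr
    linarith
  have hsuccess {L R : ℕ} (hL : MapReduce.numMachines m (MapReduce.memUnit n μ) ≤
      MapReduce.memUnit n μ ^ L) (hR : (p₀ + 1) * (3 * L + 3) ≤ R) :=
    (sub_le_sub_left hfailure 1).trans (MapReduce.one_sub_le_successProb I H hm hns hfinal hL hR
      (hafford n m μ I hn hμ))
  refine ⟨fun hvc => hsuccess ?_ (MapReduce.add_one_mul_le_floor hK hratio hp₀),
    hsuccess (MapReduce.numMachines_le_memUnit_pow hn hμ hm hmn)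
      (MapReduce.add_one_mul_le_floor_sq hK hratio hp₀)⟩
  rw [pow_one]
  exact MapReduce.numMachines_le_self hm (hvc.le_sq.trans (Nat.pow_le_pow_left hns 2))
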